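/- A *map* is a proper embedding of a connected finite multigraph (multiple edges allowed) with at least one edge into the two-dimensional sphere, up to orientation-preserving homeomorphism; it is *rooted* if one edge is distinguished as the root and oriented, and rooted maps are considered up to homeomorphisms that also respect the root. The degree of a vertex is the number of half-edges at it. A map is a *triangulation* if all its faces have degree 3, and it is *non-separable* if it has no loops and the deletion of any one vertex does not disconnect it. The number of edges of a triangulation is a multiple of 3. Let $\mathbf H$ be the set of rooted non-separable triangulations in which every vertex not incident to the root edge has degree at least $4$, and let $\mathbf H^*$ be the set of rooted non-separable triangulations in which every vertex has degree at least $4$. Let $\mathbb H(t)=\sum_n h_n t^n$ and $\mathbb H^*(t)=\sum_n h^*_n t^n$, where $h_n$ and $h^*_n$ are the numbers of maps with $3n$ edges in $\mathbf H$ and in $\mathbf H^*$. Then, as formal power series, $$\mathbb H^*(t)=\frac{1-5t+5t^2-3t^3}{1-t}\,\mathbb H(t).$$ The series $\mathbb H(t)$ is the unique power series $Y\in\mathbb Q[[t]]$ with $$16t^2(t-1)^4Y^3+C(t)\,Y+8t(t-1)^2Q(t)\,Y^2+t^4(t-1)R(t)=0,$$ where $C(t)=t^8+12t^7-14t^6-84t^5+207t^4-192t^3+86t^2-16t+1$,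 $Q(t)=t^4+4t^3-13t^2+8t+1$ and $R(t)=t^3+5t^2-8t+1$. Consequently, with $p(t)=1-5t+5t^2-3t^3$, the series $\mathbb H^*(t)$ is the unique power series $Y\in\mathbb Q[[t]]$ with $$16t^2(1-t)^6Y^3+8t(1-t)^3Q(t)\,p(t)\,Y^2+C(t)\,p(t)^2\,Y-t^4R(t)\,p(t)^3=0.$$ -/

import Mathlib

open scoped PowerSeries

/-- A combinatorial map (rotation system) on a finite set `D` of darts (half-edges, that is,
oriented edges).  `next` sends a dart to the counterclockwise next dart around its origin, and
`opp` sends a dart to the same edge with the opposite orientation.  Loops and multiple edges are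
allowed. -/
structure CombMap (D : Type) where
  next : Equiv.Perm D
  opp : Equiv.Perm D
  opp_opp : ∀ d, opp (opp d) = d
  opp_ne : ∀ d, opp d ≠ d

namespace CombMap

variable {D : Type} (M : CombMap D)

/-- The permutation that follows the boundary of a face: `facePerm d` is the dart after `d` along
the face on the right of `d`. -/
def facePerm : Equiv.Perm D := M.next * M.opp

/-- Vertices: cycles of darts around a common origin. -/
def Vertex : Type := Quotient (Equiv.Perm.SameCycle.setoid M.next)

/-- Edges: pairs of opposite darts. -/
def Edge : Type := Quotient (Equiv.Perm.SameCycle.setoid M.opp)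

/-- Faces: cycles of darts along a common face. -/
def Face : Type := Quotient (Equiv.Perm.SameCycle.setoid M.facePerm)

/-- The origin of a dart. -/
def origin (d : D) : M.Vertex := Quotient.mk (Equiv.Perm.SameCycle.setoid M.next) d

/-- The end of a dart. -/
def target (d : D) : M.Vertex := M.origin (M.opp d)

/-- The face on the right of a dart. -/
def rightFace (d : D) : M.Face := Quotient.mk (Equiv.Perm.SameCycle.setoid M.facePerm) d

/-- The degree of a vertex: the number of half-edges at it. -/
noncomputable def vertexDegree (v : M.Vertex) : ℕ := Nat.card {d : D // M.origin d = v}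

/-- The degree of a face: the number of edge sides along it. -/
noncomputable def faceDegree (f : M.Face) : ℕ := Nat.card {d : D // M.rightFace d = f}

/-- The simple graph on the vertices of the map that joins two distinct vertices if some edge of
the map does.  It carries the connectivity of the map. -/
def graph : SimpleGraph M.Vertex where
  Adj u v := u ≠ v ∧ ∃ d : D, M.origin d = u ∧ M.target d = v
  symm := ⟨by
    rintro u v ⟨h, d, hu, hv⟩
    refine ⟨h.symm, M.opp d, hv, ?_⟩
    rw [target, M.opp_opp]
    exact hu⟩
  loopless := ⟨fun _ h => h.1 rfl⟩

/-- No edge has its two ends at the same vertex. -/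
def Loopless : Prop := ∀ d : D, M.origin d ≠ M.target d

/-- The map is loopless, and deleting any one vertex (with its edges) does not disconnect it. -/
def NonSeparable : Prop := M.Loopless ∧ ∀ v : M.Vertex, (M.graph.induce {v}ᶜ).Preconnected

/-- All faces have degree 3. -/
def IsTriangulation : Prop := ∀ f : M.Face, M.faceDegree f = 3

end CombMap

/-- A rooted planar map with finite dart set `D`: a connected combinatorial map whose surface is
the sphere (Euler's formula), with a distinguished oriented edge. -/
structure RootedMap (D : Type) extends CombMap D where
  connected : toCombMap.graph.Connected
  euler : Nat.card toCombMap.Vertex + Nat.card toCombMap.Face = Nat.card toCombMap.Edge + 2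
  root : D

namespace RootedMap

variable {D : Type}

/-- Two rooted maps are the same if a relabelling of the darts respects the rotations, the edges
and the root (this is orientation-preserving homeomorphism of rooted maps on the sphere). -/
def Iso (M N : RootedMap D) : Prop :=
  ∃ e : Equiv.Perm D, (∀ d, e (M.next d) = N.next (e d)) ∧ (∀ d, e (M.opp d) = N.opp (e d)) ∧
    e M.root = N.root

theorem iso_equivalence : Equivalence (Iso (D := D)) where
  refl M := ⟨1, fun _ => rfl, fun _ => rfl, rfl⟩
  symm := by
    rintro M N ⟨e, h1, h2, h3⟩
    refine ⟨e.symm, fun d => ?_, fun d => ?_, ?_⟩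
    · rw [Equiv.symm_apply_eq, h1, Equiv.apply_symm_apply]
    · rw [Equiv.symm_apply_eq, h2, Equiv.apply_symm_apply]
    · rw [Equiv.symm_apply_eq, h3]
  trans := by
    rintro M N P ⟨e, h1, h2, h3⟩ ⟨f, k1, k2, k3⟩
    refine ⟨e.trans f, fun d => ?_, fun d => ?_, ?_⟩
    · simp [h1, k1]
    · simp [h2, k2]
    · simp [h3, k3]

def isoSetoid (D : Type) : Setoid (RootedMap D) := ⟨Iso, iso_equivalence⟩

/-- Non-separable triangulations in which every vertex not incident to the root has degree at
least 4. -/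
def IsH (M : RootedMap D) : Prop :=
  M.NonSeparable ∧ M.IsTriangulation ∧
    ∀ v : M.Vertex, v ≠ M.origin M.root → v ≠ M.target M.root → 4 ≤ M.vertexDegree v

/-- Non-separable triangulations in which every vertex has degree at least 4. -/
def IsHStar (M : RootedMap D) : Prop :=
  M.NonSeparable ∧ M.IsTriangulation ∧ ∀ v : M.Vertex, 4 ≤ M.vertexDegree v

/-- The number of rooted planar maps with `m` edges (`2 * m` darts) in the family `P`, counted up
to isomorphism. -/
noncomputable def count (m : ℕ) (P : RootedMap (Fin (2 * m)) → Prop) : ℕ :=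
  Set.ncard (Quotient.mk (isoSetoid (Fin (2 * m))) '' {M | P M})

/-- The generating function `𝐇(t)`: the coefficient of `t ^ n` is the number of maps with `3 * n`
edges. -/
noncomputable def genH : ℚ⟦X⟧ := PowerSeries.mk fun n => (count (3 * n) IsH : ℚ)

/-- The generating function `𝐇*(t)`: the coefficient of `t ^ n` is the number of maps with `3 * n`
edges. -/
noncomputable def genHStar : ℚ⟦X⟧ := PowerSeries.mk fun n => (count (3 * n) IsHStar : ℚ)

end RootedMap

/-!
A rooted non-separable triangulation is opened at the face on the right of its root.  What remains
is a triangulated polygon with three boundary vertices: a loopless disk whose boundary is a simple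
cycle and whose inner faces are triangles.  The second half of non-separability is automatic,
because the neighbours of a vertex of a loopless triangulation form a closed walk
(`CombMap.nonSeparable_of_triangles`).  So it suffices to count the triangulated polygons with a
root edge on the boundary, whose inner vertices have degree at least 4, by the number of triangles,
and to keep track of the degrees of the boundary vertices (`RootedMap.isH_iff`,
`RootedMap.isHStar_iff`).  The single edge is a polygon with two vertices.

Remove the root edge of a polygon other than a single edge. If the third vertex of its triangle is
an inner vertex, the result is a polygon with one more boundary vertex, where this vertex has degree
at least 4; otherwise the result falls apart at this vertex into two polygons. Both operations can
be inverted, so that polygons correspond to certain trees with nodes of arity zero, one and two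
(`PolygonTree`), from which the boundary degrees can be read off: `PolygonTree.add_good`,
`PolygonTree.exists_iso_add` and `PolygonTree.add_injective`. For combinatorial maps given by
permutations of darts, everything reduces to the effect of a transposition on the cycles of a
permutation. The one topological input is that the genus is nonnegative (`euler_inequality`): it
shows that a vertex that occurs twice on the boundary is a cut vertex. For the induction it is
convenient to work with disjoint unions of polygons (`Patch`), to which a tree adds one component.

In the trees the condition that the covered vertex has degree at least 4 is handled by exclusion: a
boundary vertex of degree 2 or 3 next to the root edge is visible in the two topmost nodes of the
tree (`PolygonTree.gf_dg_two`, `PolygonTree.gf_dg_three`), after a change of the root edge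
(`PolygonTree.gf_rotate`).  This gives a functional equation for the generating function `K` of
polygons, where `z` marks triangles and `x` marks boundary vertices beyond the second one
(`PolygonTree.gf_len_eq`):
  `x K = x + (z - z³) (K - K(0) - z x K + x² K²)`.
It has a unique solution, which is explicit in terms of the series `s` with
`s (1 + z² - z⁴ - 2 s²) = z - z³` and of the Catalan series
(`PowerSeries.exists_kernel_solution`, `PowerSeries.kernel_unique`).  Its value `K(0)` at `x = 0`
counts the polygons with two vertices.  Eliminating `s²` yields a cubic equation for `K(0) - 1`
over `ℚ[z²]` (`PolygonTree.cubic_digons`).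

A polygon with two vertices that is not an edge is a capped triangle.  Hence `K(0) - 1` is the
generating function of the first family, with `t = z²`.  The second family is reached by inclusion
and exclusion over the boundary vertices of degree at most 3, where again the topmost nodes of the
tree suffice (`PolygonTree.triangles_four_le`).  The cubic equation has only one power series as a
solution, because its linear coefficient is invertible while those of the square and of the cube
vanish at `t = 0` (`PowerSeries.cubic_unique`).
-/

/-! ### Orbits of permutations under multiplication by a transposition -/

section Orbits

variable {D : Type}

/-- The partition into classes of `s`, with the classes of `a` and `b` united. -/
def Setoid.glue (s : Setoid D) (a b : D) : Setoid D where
  r x y := s x y ∨ (s x a ∧ s b y) ∨ (s x b ∧ s a y)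
  iseqv := by
    refine ⟨fun x => Or.inl (s.refl x), ?_, ?_⟩
    · rintro x y (h | ⟨h, k⟩ | ⟨h, k⟩)
      · exact Or.inl (s.symm h)
      · exact Or.inr (Or.inr ⟨s.symm k, s.symm h⟩)
      · exact Or.inr (Or.inl ⟨s.symm k, s.symm h⟩)
    · rintro x y z (h | ⟨h, k⟩ | ⟨h, k⟩) (h' | ⟨h', k'⟩ | ⟨h', k'⟩)
      · exact Or.inl (s.trans h h')
      · exact Or.inr (Or.inl ⟨s.trans h h', k'⟩)
      · exact Or.inr (Or.inr ⟨s.trans h h', k'⟩)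
      · exact Or.inr (Or.inl ⟨h, s.trans k h'⟩)
      · exact Or.inr (Or.inl ⟨h, k'⟩)
      · exact Or.inl (s.trans h k')
      · exact Or.inr (Or.inr ⟨h, s.trans k h'⟩)
      · exact Or.inl (s.trans h k')
      · exact Or.inr (Or.inr ⟨h, k'⟩)

theorem Setoid.glue_iff {s : Setoid D} {a b x y : D} :
    s.glue a b x y ↔ s x y ∨ (s x a ∧ s b y) ∨ (s x b ∧ s a y) := Iff.rfl

theorem Setoid.le_glue (s : Setoid D) (a b : D) : s ≤ s.glue a b := fun _ _ h => Or.inl h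

theorem Setoid.glue_rel (s : Setoid D) (a b : D) : s.glue a b a b :=
  Or.inr (Or.inl ⟨s.refl a, s.refl b⟩)

theorem Setoid.glue_le {s t : Setoid D} {a b : D} (h : s ≤ t) (hab : t a b) :
    s.glue a b ≤ t := by
  rintro x y (k | ⟨k, l⟩ | ⟨k, l⟩)
  · exact h k
  · exact t.trans (h k) (t.trans hab (h l))
  · exact t.trans (h k) (t.trans (t.symm hab) (h l))

theorem Setoid.glue_eq_self {s : Setoid D} {a b : D} (h : s a b) : s.glue a b = s :=
  le_antisymm (Setoid.glue_le le_rfl h) (s.le_glue a b)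

/-- The number of equivalence classes. -/
noncomputable def numClasses (s : Setoid D) : ℕ := Nat.card (Quotient s)

theorem numClasses_comap {E : Type} (p : E → D) (hp : Function.Surjective p) (s : Setoid D) :
    numClasses (s.comap p) = numClasses s := by
  refine Nat.card_congr (Equiv.ofBijective
    (Quotient.map' (s₁ := s.comap p) (s₂ := s) p fun _ _ k => k) ⟨?_, ?_⟩)
  · rintro ⟨x⟩ ⟨y⟩ h
    exact Quotient.sound (s := s.comap p) (Quotient.exact (s := s) h)
  · rintro ⟨x⟩
    obtain ⟨y, rfl⟩ := hp x
    exact ⟨Quotient.mk (s.comap p) y, rfl⟩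

theorem numClasses_glue [Finite D] {s : Setoid D} {a b : D} (h : ¬ s a b) :
    numClasses (s.glue a b) + 1 = numClasses s := by
  classical
  -- the quotient by `s` is the quotient by `s.glue a b` plus one more point, the class of `b`
  have e : Quotient (s.glue a b) ≃ {q : Quotient s // q ≠ Quotient.mk s b} := by
    refine (Equiv.ofBijective (fun q : {q : Quotient s // q ≠ Quotient.mk s b} =>
      Quotient.map' (s₁ := s) (s₂ := s.glue a b) id (fun _ _ k => Or.inl k) q.1) ⟨?_, ?_⟩).symm
    · rintro ⟨⟨x⟩, hx⟩ ⟨⟨y⟩, hy⟩ k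
      have hx' : ¬ s x b := fun k => hx (Quotient.sound k)
      have hy' : ¬ s y b := fun k => hy (Quotient.sound k)
      have k' : s.glue a b x y := Quotient.exact (s := s.glue a b) k
      rcases k' with k' | ⟨_, k'⟩ | ⟨k', _⟩
      · exact Subtype.ext (Quotient.sound k')
      · exact absurd (s.symm k') hy'
      · exact absurd k' hx'
    · rintro ⟨x⟩
      by_cases hx : s x b
      · refine ⟨⟨Quotient.mk s a, fun k => h (Quotient.exact k)⟩, ?_⟩
        exact Quotient.sound (s := s.glue a b) (Or.inr (Or.inl ⟨s.refl a, s.symm hx⟩))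
      · exact ⟨⟨Quotient.mk s x, fun k => hx (Quotient.exact k)⟩, rfl⟩
  have := Fintype.ofFinite (Quotient s)
  rw [numClasses, numClasses, Nat.card_congr e, Nat.card_eq_fintype_card, Nat.card_eq_fintype_card,
    Fintype.card_subtype_compl]
  simp only [Fintype.card_unique]
  have : 0 < Fintype.card (Quotient s) := Fintype.card_pos_iff.2 ⟨Quotient.mk s b⟩
  omega

/-- The partition into cycles of a permutation. -/
abbrev cyc (f : Equiv.Perm D) : Setoid D := Equiv.Perm.SameCycle.setoid f

theorem cyc_le_iff {f : Equiv.Perm D} {t : Setoid D} : cyc f ≤ t ↔ ∀ x, t x (f x) := by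
  constructor
  · intro h x
    exact h (show f.SameCycle x (f x) from ⟨1, by simp⟩)
  · rintro h x _ ⟨i, rfl⟩
    induction i with
    | zero => exact t.refl _
    | succ n ih =>
      rw [add_comm, zpow_add, zpow_one]
      exact t.trans ih (h _)
    | pred n ih =>
      rw [sub_eq_add_neg, add_comm, zpow_add, zpow_neg_one]
      refine t.trans ih (t.symm ?_)
      have := h (f⁻¹ ((f ^ (-(n : ℤ))) x))
      rwa [show f (f⁻¹ ((f ^ (-(n : ℤ))) x)) = (f ^ (-(n : ℤ))) x by simp] at this

theorem cyc_apply (f : Equiv.Perm D) (x : D) : cyc f x (f x) := cyc_le_iff.1 le_rfl x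

theorem apply_cyc (f : Equiv.Perm D) (x : D) : cyc f (f x) x := (cyc f).symm (cyc_apply f x)

/-- On a finite set, forward closed sets are unions of cycles. -/
theorem forward_induction [Finite D] {f : Equiv.Perm D} {p : D → Prop} {a x : D}
    (h : cyc f a x) (ha : p a) (hp : ∀ y, p y → p (f y)) : p x := by
  obtain ⟨n, -, rfl⟩ := Equiv.Perm.SameCycle.exists_pow_eq' (f := f) h
  clear h
  induction n with
  | zero => simpa using ha
  | succ n ih => rw [pow_succ']; exact hp _ ih

/-- The partition into orbits of the group generated by two permutations. -/
def conn (f g : Equiv.Perm D) : Setoid D := cyc f ⊔ cyc g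

theorem conn_le_iff {f g : Equiv.Perm D} {t : Setoid D} :
    conn f g ≤ t ↔ (∀ x, t x (f x)) ∧ ∀ x, t x (g x) := by
  rw [conn, sup_le_iff, cyc_le_iff, cyc_le_iff]

theorem cyc_le_conn_left (f g : Equiv.Perm D) : cyc f ≤ conn f g := le_sup_left
theorem cyc_le_conn_right (f g : Equiv.Perm D) : cyc g ≤ conn f g := le_sup_right

theorem cyc_mul_le_conn (f g : Equiv.Perm D) : cyc (f * g) ≤ conn f g :=
  cyc_le_iff.2 fun x => (conn f g).trans (cyc_le_conn_right f g (cyc_apply g x))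
    (cyc_le_conn_left f g (cyc_apply f (g x)))

variable [DecidableEq D]

theorem glue_swap_apply (s : Setoid D) (a b x : D) : s.glue a b x (Equiv.swap a b x) := by
  rw [Equiv.swap_apply_def]
  split_ifs with h1 h2
  · subst h1; exact s.glue_rel _ _
  · subst h2; exact Setoid.symm' _ (s.glue_rel _ _)
  · exact Setoid.refl' _ _

theorem cyc_swap_mul_glue (f : Equiv.Perm D) (a b : D) :
    (cyc (Equiv.swap a b * f)).glue a b = (cyc f).glue a b := by
  apply le_antisymm
  · refine Setoid.glue_le (cyc_le_iff.2 fun x => ?_) (Setoid.glue_rel _ _ _)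
    exact Setoid.trans' _ (Setoid.le_glue _ _ _ (cyc_apply f x)) (glue_swap_apply _ _ _ _)
  · refine Setoid.glue_le (cyc_le_iff.2 fun x => ?_) (Setoid.glue_rel _ _ _)
    refine Setoid.trans' _ (Setoid.le_glue _ _ _ (cyc_apply (Equiv.swap a b * f) x)) ?_
    exact Setoid.symm' _ (glue_swap_apply _ a b (f x))

theorem conn_swap_mul_glue (f g : Equiv.Perm D) (a b : D) :
    (conn (Equiv.swap a b * f) g).glue a b = (conn f g).glue a b := by
  apply le_antisymm
  · refine Setoid.glue_le (conn_le_iff.2 ⟨fun x => ?_, fun x => ?_⟩) (Setoid.glue_rel _ _ _)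
    · exact Setoid.trans' _ (Setoid.le_glue _ _ _ (cyc_le_conn_left f g (cyc_apply f x)))
        (glue_swap_apply _ _ _ _)
    · exact Setoid.le_glue _ _ _ (cyc_le_conn_right f g (cyc_apply g x))
  · refine Setoid.glue_le (conn_le_iff.2 ⟨fun x => ?_, fun x => ?_⟩) (Setoid.glue_rel _ _ _)
    · refine Setoid.trans' _ (Setoid.le_glue _ _ _ (cyc_le_conn_left _ g
        (cyc_apply (Equiv.swap a b * f) x))) ?_
      exact Setoid.symm' _ (glue_swap_apply _ a b (f x))
    · exact Setoid.le_glue _ _ _ (cyc_le_conn_right _ g (cyc_apply g x))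

/-- If `a` and `b` lie in one cycle of `f`, then `swap a b * f` splits this cycle. -/
theorem glue_cyc_swap_mul {f : Equiv.Perm D} {a b : D} (h : cyc f a b) :
    (cyc (Equiv.swap a b * f)).glue a b = cyc f := by
  rw [cyc_swap_mul_glue, Setoid.glue_eq_self h]

variable [Finite D]

/-- If `a` and `b` lie in different cycles of `f`, then `swap a b * f` unites these cycles. -/
theorem cyc_swap_mul_of_not {f : Equiv.Perm D} {a b : D} (h : ¬ cyc f a b) :
    cyc (Equiv.swap a b * f) a b := by
  set g := Equiv.swap a b * f with hg
  have key : ∀ x, cyc f a x → cyc f a x ∧ cyc g a x := by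
    intro x hx
    refine forward_induction (p := fun x => cyc f a x ∧ cyc g a x) hx
      ⟨Setoid.refl' _ _, Setoid.refl' _ _⟩ ?_
    rintro y ⟨h1, h2⟩
    have h3 : cyc f a (f y) := (cyc f).trans h1 (cyc_apply f y)
    refine ⟨h3, ?_⟩
    by_cases h4 : f y = a
    · rw [h4]
    · have h5 : f y ≠ b := fun h5 => h (h5 ▸ h3)
      have h6 : g y = f y := by rw [hg, Equiv.Perm.mul_apply, Equiv.swap_apply_of_ne_of_ne h4 h5]
      rw [← h6]
      exact (cyc g).trans h2 (cyc_apply g y)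
  have h1 : cyc f a (f⁻¹ a) := by
    have := apply_cyc f (f⁻¹ a)
    rwa [show f (f⁻¹ a) = a from by simp] at this
  have h2 := (key _ h1).2
  have h3 : g (f⁻¹ a) = b := by simp [hg]
  rw [← h3]
  exact (cyc g).trans h2 (cyc_apply g _)

theorem not_cyc_swap_mul {f : Equiv.Perm D} {a b : D} (hne : a ≠ b) (h : cyc f a b) :
    ¬ cyc (Equiv.swap a b * f) a b := by
  classical
  set g := Equiv.swap a b * f with hg
  have hex : ∃ j, (f ^ j) a = b := by
    obtain ⟨n, -, hn⟩ := Equiv.Perm.SameCycle.exists_pow_eq' (f := f) h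
    exact ⟨n, hn⟩
  obtain ⟨j, hj, hmin⟩ : ∃ j, (f ^ j) a = b ∧ ∀ i < j, (f ^ i) a ≠ b :=
    ⟨Nat.find hex, Nat.find_spec hex, fun i hi => Nat.find_min hex hi⟩
  intro hab
  -- the cycle of `a` under `g` stays among the points that `f` visits between `a` and `b`
  have : ∃ i < j, b = (f ^ i) a := by
    refine forward_induction (p := fun x => ∃ i < j, x = (f ^ i) a) hab ⟨0, ?_, by simp⟩ ?_
    · rcases Nat.eq_zero_or_pos j with h0 | h0
      · subst h0; exact absurd hj hne
      · exact h0
    · rintro _ ⟨i, hi, rfl⟩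
      have hgi : g ((f ^ i) a) = Equiv.swap a b ((f ^ (i + 1)) a) := by
        rw [hg, Equiv.Perm.mul_apply, pow_succ', Equiv.Perm.mul_apply]
      rw [hgi]
      by_cases h1 : (f ^ (i + 1)) a = b
      · rw [h1, Equiv.swap_apply_right]
        exact ⟨0, by omega, by simp⟩
      · have hij : i + 1 < j := lt_of_le_of_ne hi (fun k => h1 (k ▸ hj))
        have h2 : (f ^ (i + 1)) a ≠ a := by
          intro h2
          have h3 : (f ^ (j - (i + 1))) ((f ^ (i + 1)) a) = b := by
            rw [← Equiv.Perm.mul_apply, ← pow_add, Nat.sub_add_cancel hij.le, hj]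
          rw [h2] at h3
          exact hmin _ (by omega) h3
        rw [Equiv.swap_apply_of_ne_of_ne h2 h1]
        exact ⟨i + 1, hij, rfl⟩
  obtain ⟨i, hi, hb⟩ := this
  exact hmin i hi hb.symm

theorem cyc_swap_mul_eq_glue {f : Equiv.Perm D} {a b : D} (h : ¬ cyc f a b) :
    cyc (Equiv.swap a b * f) = (cyc f).glue a b := by
  rw [← cyc_swap_mul_glue, Setoid.glue_eq_self (cyc_swap_mul_of_not h)]

theorem numClasses_swap_mul_of_not {f : Equiv.Perm D} {a b : D} (h : ¬ cyc f a b) :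
    numClasses (cyc (Equiv.swap a b * f)) + 1 = numClasses (cyc f) := by
  rw [cyc_swap_mul_eq_glue h, numClasses_glue h]

theorem numClasses_swap_mul {f : Equiv.Perm D} {a b : D} (hne : a ≠ b) (h : cyc f a b) :
    numClasses (cyc (Equiv.swap a b * f)) = numClasses (cyc f) + 1 := by
  rw [← glue_cyc_swap_mul h, numClasses_glue (not_cyc_swap_mul hne h)]

/-- The genus of a (possibly disconnected) combinatorial map is nonnegative: the number of
vertices plus the number of faces is at most the number of edges plus twice the number of
components.  Splitting vertices one dart at a time reduces to the map whose components are
single edges. -/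
theorem euler_inequality {g : Equiv.Perm D} (hg : ∀ x, g (g x) = x) (f : Equiv.Perm D) :
    numClasses (cyc f) + numClasses (cyc (f * g)) ≤
      numClasses (cyc g) + 2 * numClasses (conn f g) := by
  have := Fintype.ofFinite D
  induction hn : f.support.card using Nat.strong_induction_on generalizing f with
  | _ n ih =>
  by_cases hf : f = 1
  · -- every component has at most two darts, each of them a vertex, and one face
    subst hf
    have h1 : conn (1 : Equiv.Perm D) g = cyc g := by
      refine le_antisymm (conn_le_iff.2 ⟨fun x => Setoid.refl' _ _, cyc_apply g⟩)
        (cyc_le_conn_right _ _)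
    have h2 : numClasses (cyc (1 : Equiv.Perm D)) ≤ 2 * numClasses (cyc g) := by
      have hsurj : Function.Surjective (fun q : Quotient (cyc g) × Bool =>
          if q.2 then Quotient.mk (cyc (1 : Equiv.Perm D)) q.1.out
          else Quotient.mk (cyc (1 : Equiv.Perm D)) (g q.1.out)) := by
        rintro ⟨x⟩
        have hx : (Quotient.mk (cyc g) x).out = x ∨ g (Quotient.mk (cyc g) x).out = x := by
          have h : cyc g (Quotient.mk (cyc g) x).out x := Quotient.mk_out (s := cyc g) x
          refine forward_induction (p := fun z => (Quotient.mk (cyc g) x).out = z ∨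
            g (Quotient.mk (cyc g) x).out = z) h (Or.inl rfl) ?_
          rintro y (rfl | rfl)
          · exact Or.inr rfl
          · exact Or.inl (hg _).symm
        rcases hx with hx | hx
        · exact ⟨(Quotient.mk _ x, true), by simp only [if_true]; rw [hx]; rfl⟩
        · refine ⟨(Quotient.mk _ x, false), ?_⟩
          simp only [Bool.false_eq_true, if_false]; rw [hx]; rfl
      have := Nat.card_le_card_of_surjective _ hsurj
      rw [Nat.card_prod, Nat.card_eq_fintype_card (α := Bool), Fintype.card_bool] at this
      rw [numClasses, numClasses]; omega
    rw [one_mul, h1]; omega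
  · obtain ⟨a, ha⟩ : ∃ a, f a ≠ a := by
      by_contra! h; exact hf (Equiv.ext h)
    set f' := Equiv.swap a (f a) * f with hf'
    have hff : f = Equiv.swap a (f a) * f' := by
      rw [hf', ← mul_assoc, Equiv.swap_mul_self, one_mul]
    have hlt : f'.support.card < n := by
      rw [← hn]
      exact Equiv.Perm.card_support_swap_mul ha
    have hI := ih _ hlt f' rfl
    have hc : cyc f a (f a) := cyc_apply f a
    have h1 : numClasses (cyc f') = numClasses (cyc f) + 1 := numClasses_swap_mul ha.symm hc
    have h2 : f' * g = Equiv.swap a (f a) * (f * g) := by rw [hf', mul_assoc]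
    have h2' : f * g = Equiv.swap a (f a) * (f' * g) := by
      rw [h2, ← mul_assoc, Equiv.swap_mul_self, one_mul]
    have h3 : conn f g = (conn f' g).glue a (f a) := by
      rw [hf', conn_swap_mul_glue, Setoid.glue_eq_self (cyc_le_conn_left f g hc)]
    -- `f'` has one vertex more; if this disconnects a component, then it splits a face too
    by_cases h : conn f' g a (f a)
    · rw [Setoid.glue_eq_self h] at h3
      rw [h3]
      have : numClasses (cyc (f * g)) ≤ numClasses (cyc (f' * g)) + 1 := by
        by_cases k : cyc (f' * g) a (f a)
        · rw [h2', numClasses_swap_mul ha.symm k]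
        · have := numClasses_swap_mul_of_not k
          rw [← h2'] at this; omega
      omega
    · have k : ¬ cyc (f' * g) a (f a) := fun k => h (cyc_mul_le_conn _ _ k)
      have h4 := numClasses_swap_mul_of_not k
      rw [← h2'] at h4
      have h5 := numClasses_glue h
      rw [← h3] at h5
      omega

end Orbits

/-! ### Disjoint unions of setoids and permutations -/

section Sum

variable {A B : Type}

/-- The partition of a disjoint union into the classes of its two parts. -/
def Setoid.sum (s : Setoid A) (t : Setoid B) : Setoid (A ⊕ B) where
  r u v := match u, v with
    | .inl x, .inl y => s x y
    | .inr x, .inr y => t x y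
    | _, _ => False
  iseqv := by
    refine ⟨?_, ?_, ?_⟩
    · rintro (x | x)
      · exact s.refl x
      · exact t.refl x
    · rintro (x | x) (y | y) h
      · exact s.symm h
      · exact h
      · exact h
      · exact t.symm h
    · rintro (x | x) (y | y) (z | z) h k
      · exact s.trans h k
      · exact k
      · exact h.elim
      · exact h
      · exact h
      · exact h.elim
      · exact k
      · exact t.trans h k

theorem numClasses_sum [Finite A] [Finite B] (s : Setoid A) (t : Setoid B) :
    numClasses (s.sum t) = numClasses s + numClasses t := by
  rw [numClasses, numClasses, numClasses, ← Nat.card_sum]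
  refine Nat.card_congr (Equiv.ofBijective (fun q => Sum.elim
    (Quotient.map' (s₁ := s) (s₂ := s.sum t) Sum.inl fun _ _ h => h)
    (Quotient.map' (s₁ := t) (s₂ := s.sum t) Sum.inr fun _ _ h => h) q) ⟨?_, ?_⟩).symm
  · rintro (⟨⟨x⟩⟩ | ⟨⟨x⟩⟩) (⟨⟨y⟩⟩ | ⟨⟨y⟩⟩) h
    · exact congrArg Sum.inl (Quotient.sound (Quotient.exact (s := s.sum t) h :))
    · exact (Quotient.exact (s := s.sum t) h : False).elim
    · exact (Quotient.exact (s := s.sum t) h : False).elim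
    · exact congrArg Sum.inr (Quotient.sound (Quotient.exact (s := s.sum t) h :))
  · rintro ⟨x | x⟩
    · exact ⟨Sum.inl (Quotient.mk s x), rfl⟩
    · exact ⟨Sum.inr (Quotient.mk t x), rfl⟩

theorem Setoid.sum_le {s : Setoid A} {t : Setoid B} {u : Setoid (A ⊕ B)}
    (h : s ≤ u.comap Sum.inl) (k : t ≤ u.comap Sum.inr) : s.sum t ≤ u := by
  rintro (x | x) (y | y) l
  · exact h l
  · exact l.elim
  · exact l.elim
  · exact k l

theorem cyc_sumCongr (f : Equiv.Perm A) (g : Equiv.Perm B) :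
    cyc (Equiv.Perm.sumCongr f g) = (cyc f).sum (cyc g) := by
  apply le_antisymm
  · refine cyc_le_iff.2 ?_
    rintro (x | x)
    · exact cyc_apply f x
    · exact cyc_apply g x
  · refine Setoid.sum_le (cyc_le_iff.2 fun x => ?_) (cyc_le_iff.2 fun x => ?_)
    · exact cyc_apply (Equiv.Perm.sumCongr f g) (Sum.inl x)
    · exact cyc_apply (Equiv.Perm.sumCongr f g) (Sum.inr x)

theorem conn_sumCongr (f f' : Equiv.Perm A) (g g' : Equiv.Perm B) :
    conn (Equiv.Perm.sumCongr f g) (Equiv.Perm.sumCongr f' g') =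
      (conn f f').sum (conn g g') := by
  apply le_antisymm
  · refine conn_le_iff.2 ⟨?_, ?_⟩
    · rintro (x | x)
      · exact cyc_le_conn_left f f' (cyc_apply f x)
      · exact cyc_le_conn_left g g' (cyc_apply g x)
    · rintro (x | x)
      · exact cyc_le_conn_right f f' (cyc_apply f' x)
      · exact cyc_le_conn_right g g' (cyc_apply g' x)
  · refine Setoid.sum_le (conn_le_iff.2 ⟨fun x => ?_, fun x => ?_⟩)
      (conn_le_iff.2 ⟨fun x => ?_, fun x => ?_⟩)
    · exact cyc_le_conn_left _ _ (cyc_apply (Equiv.Perm.sumCongr f g) (Sum.inl x))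
    · exact cyc_le_conn_right _ _ (cyc_apply (Equiv.Perm.sumCongr f' g') (Sum.inl x))
    · exact cyc_le_conn_left _ _ (cyc_apply (Equiv.Perm.sumCongr f g) (Sum.inr x))
    · exact cyc_le_conn_right _ _ (cyc_apply (Equiv.Perm.sumCongr f' g') (Sum.inr x))

theorem cyc_boolNot (b c : Bool) : cyc Equiv.boolNot b c := by
  by_cases h : b = c
  · exact h ▸ Setoid.refl' _ _
  · have : Equiv.boolNot b = c := by cases b <;> cases c <;> simp_all
    exact this ▸ cyc_apply _ _

theorem numClasses_boolNot : numClasses (cyc Equiv.boolNot) = 1 := by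
  rw [numClasses, Nat.card_eq_one_iff_unique]
  exact ⟨⟨by rintro ⟨x⟩ ⟨y⟩; exact Quotient.sound (cyc_boolNot x y)⟩, ⟨Quotient.mk _ true⟩⟩

theorem cyc_one {x y : A} : cyc (1 : Equiv.Perm A) x y ↔ x = y := Equiv.Perm.sameCycle_one

theorem numClasses_one_bool : numClasses (cyc (1 : Equiv.Perm Bool)) = 2 := by
  rw [numClasses, Nat.card_congr (Equiv.ofBijective (Quotient.mk (cyc (1 : Equiv.Perm Bool)))
    ⟨fun x y h => cyc_one.1 (Quotient.exact h), Quotient.mk_surjective⟩).symm]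
  simp

end Sum

/-! ### Unions of triangulated polygons -/

/-- The number of elements of the cycle of `d`. -/
noncomputable def cycDeg {D : Type} (f : Equiv.Perm D) (d : D) : ℕ := Nat.card {x // cyc f d x}

/-- `Follows f x l z`: starting at `x`, the permutation `f` runs through the list `l` and then
arrives at `z`. -/
def Follows {D : Type} (f : Equiv.Perm D) : D → List D → D → Prop
  | x, [], z => f x = z
  | x, y :: l, z => f x = y ∧ Follows f y l z

/-- The list runs once or several times through a cycle of `f`. -/
def IsBoundary {D : Type} (f : Equiv.Perm D) : List D → Prop
  | [] => False
  | a :: l => Follows f a l a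

section Follows

variable {D : Type} {f : Equiv.Perm D}

theorem follows_append {x y z : D} {l l' : List D} :
    Follows f x (l ++ y :: l') z ↔ Follows f x l y ∧ Follows f y l' z := by
  induction l generalizing x with
  | nil => simp [Follows]
  | cons a l ih => simp [Follows, ih, and_assoc]

theorem Follows.apply_mem {x z : D} {l : List D} (h : Follows f x l z) :
    ∀ y ∈ x :: l, f y ∈ l ∨ f y = z := by
  induction l generalizing x with
  | nil => simpa [Follows] using h
  | cons a l ih =>
    intro y hy
    rcases List.mem_cons.1 hy with rfl | hy
    · exact Or.inl (by rw [h.1]; exact List.mem_cons_self)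
    · rcases ih h.2 y hy with k | k
      · exact Or.inl (List.mem_cons_of_mem _ k)
      · exact Or.inr k

theorem IsBoundary.apply_mem {L : List D} (h : IsBoundary f L) {y : D} (hy : y ∈ L) : f y ∈ L := by
  cases L with
  | nil => exact h.elim
  | cons a l =>
    rcases Follows.apply_mem h y hy with k | k
    · exact List.mem_cons_of_mem _ k
    · rw [k]; exact List.mem_cons_self

theorem Follows.rel {t : Setoid D} (ht : cyc f ≤ t) {x z : D} {l : List D} (h : Follows f x l z) :
    ∀ y ∈ l, t x y := by
  induction l generalizing x with
  | nil => simp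
  | cons a l ih =>
    have h1 : t x a := ht (h.1 ▸ cyc_apply f x)
    intro y hy
    rcases List.mem_cons.1 hy with rfl | hy
    · exact h1
    · exact t.trans h1 (ih h.2 y hy)

theorem IsBoundary.rel {t : Setoid D} (ht : cyc f ≤ t) {L : List D} (h : IsBoundary f L) {x y : D}
    (hx : x ∈ L) (hy : y ∈ L) : t x y := by
  cases L with
  | nil => exact h.elim
  | cons a l =>
    have h1 : ∀ y ∈ a :: l, t a y := by
      intro y hy
      rcases List.mem_cons.1 hy with rfl | hy
      · exact t.refl _
      · exact Follows.rel ht h y hy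
    exact t.trans (t.symm (h1 x hx)) (h1 y hy)

theorem IsBoundary.ne_nil {L : List D} (h : IsBoundary f L) : L ≠ [] := by
  rintro rfl; exact h

theorem Follows.map {E : Type} {g : Equiv.Perm E} (i : D → E) {x z : D} {l : List D}
    (h : Follows f x l z) (hg : ∀ y ∈ x :: l, g (i y) = i (f y)) :
    Follows g (i x) (l.map i) (i z) := by
  induction l generalizing x with
  | nil => rw [List.map_nil, Follows, hg x (by simp)]; exact congrArg i h
  | cons a l ih =>
    exact ⟨by rw [hg x (by simp), h.1],
      ih h.2 fun y hy => hg y (List.mem_cons_of_mem _ hy)⟩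

theorem IsBoundary.map {E : Type} {g : Equiv.Perm E} (i : D → E) {L : List D}
    (h : IsBoundary f L) (hg : ∀ y ∈ L, g (i y) = i (f y)) : IsBoundary g (L.map i) := by
  cases L with
  | nil => exact h
  | cons a l => exact Follows.map i h hg

end Follows

/-- A family of polygonal maps: a combinatorial map on the set `D` of darts, with a list of the
boundary cycles of its components, each given by the list of its darts.  The boundary cycles start
with a root dart.  No laws are imposed here, so that intermediate objects are patches as well; see
`Patch.Good`. -/
structure Patch (D : Type) where
  next : Equiv.Perm D
  opp : Equiv.Perm D
  bdry : List (List D)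

namespace Patch

variable {D : Type} (S : Patch D)

/-- The permutation along the faces. -/
def face : Equiv.Perm D := S.next * S.opp

/-- The connected components. -/
abbrev comp : Setoid D := conn S.next S.opp

/-- The lists of degrees of the vertices along the boundary cycles. -/
noncomputable def degs : List (List ℕ) := S.bdry.map (List.map (cycDeg S.next))

theorem face_apply (x : D) : S.face x = S.next (S.opp x) := rfl

theorem face_le_comp : cyc S.face ≤ S.comp := cyc_mul_le_conn _ _

/-- Each component is a loopless planar map with one distinguished face, whose boundary is listed,
and all other faces are triangles.  By `cover` and `separate` the boundary cycles correspond to the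
components.  Since the Euler characteristic of a component is at most two, `euler` makes all
components planar. -/
structure IsTriangulated : Prop where
  opp_opp : ∀ d, S.opp (S.opp d) = d
  opp_ne : ∀ d, S.opp d ≠ d
  cover : ∀ d, ∃ L ∈ S.bdry, ∃ x ∈ L, S.comp x d
  separate : S.bdry.Pairwise fun L L' => ∀ x ∈ L, ∀ y ∈ L', ¬ S.comp x y
  euler : numClasses (cyc S.next) + numClasses (cyc S.face) =
    numClasses (cyc S.opp) + 2 * S.bdry.length
  cyclic : ∀ L ∈ S.bdry, IsBoundary S.face L
  nodup : S.bdry.flatten.Nodup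
  triangle : ∀ d, d ∉ S.bdry.flatten → S.face (S.face (S.face d)) = d
  loopless : ∀ d, ¬ cyc S.next d (S.opp d)

end Patch

/-- The darts in the list start at different vertices. -/
def SimpleOn {D : Type} (f : Equiv.Perm D) (B : List D) : Prop :=
  B.Pairwise fun x y => ¬ cyc f x y

/-- All vertices other than the origins of the darts in the list have degree at least 4. -/
def InnerOn {D : Type} (f : Equiv.Perm D) (B : List D) : Prop :=
  ∀ x, (∃ b ∈ B, cyc f x b) ∨ 4 ≤ cycDeg f x

namespace Patch

variable {D : Type} (S : Patch D)

/-- Each component is a triangulated polygon with simple boundary, without loops, whose inner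
vertices have degree at least 4. -/
structure Good : Prop extends S.IsTriangulated where
  simple : SimpleOn S.next S.bdry.flatten
  inner : InnerOn S.next S.bdry.flatten

variable {S}

theorem IsTriangulated.rim_closed (h : S.IsTriangulated) {x : D} (hx : x ∈ S.bdry.flatten) :
    S.face x ∈ S.bdry.flatten := by
  rw [List.mem_flatten] at hx ⊢
  obtain ⟨L, hL, hx⟩ := hx
  exact ⟨L, hL, (h.cyclic L hL).apply_mem hx⟩

theorem IsTriangulated.rim_closed_symm [Finite D] (h : S.IsTriangulated) {x : D}
    (hx : S.face x ∈ S.bdry.flatten) : x ∈ S.bdry.flatten :=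
  forward_induction (p := (· ∈ S.bdry.flatten)) (apply_cyc S.face x) hx fun _ => h.rim_closed

/-- The number of components is the number of boundary cycles. -/
theorem IsTriangulated.numClasses_comp (h : S.IsTriangulated) :
    numClasses S.comp = S.bdry.length := by
  have hne : ∀ i : Fin S.bdry.length, S.bdry.get i ≠ [] := fun i =>
    (h.cyclic _ (List.get_mem _ i)).ne_nil
  rw [numClasses, ← Nat.card_fin S.bdry.length]
  refine (Nat.card_congr (Equiv.ofBijective
    (fun i => Quotient.mk S.comp ((S.bdry.get i).head (hne i))) ⟨?_, ?_⟩)).symm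
  · intro i j hij
    have hij : S.comp _ _ := Quotient.exact hij
    by_contra hne'
    rcases lt_or_gt_of_ne hne' with hlt | hlt
    · exact List.pairwise_iff_get.1 h.separate i j hlt _ (List.head_mem _) _ (List.head_mem _) hij
    · exact List.pairwise_iff_get.1 h.separate j i hlt _ (List.head_mem _) _ (List.head_mem _)
        (S.comp.symm hij)
  · rintro ⟨d⟩
    obtain ⟨L, hL, x, hx, hxd⟩ := h.cover d
    obtain ⟨i, rfl⟩ := List.get_of_mem hL
    exact ⟨i, Quotient.sound (S.comp.trans
      ((h.cyclic _ hL).rel S.face_le_comp (List.head_mem _) hx) hxd)⟩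

end Patch

/-! ### Covering a boundary vertex by a triangle -/

namespace Patch

variable {D : Type}

open scoped Classical in
/-- The rotation after the insertion of a new edge, whose darts `inr true` and `inr false` come
just before `r` and `s`. -/
noncomputable def insertEdge (f : Equiv.Perm D) (r s : D) : Equiv.Perm (D ⊕ Bool) :=
  Equiv.swap (Sum.inr true) (Sum.inl r) * (Equiv.swap (Sum.inr false) (Sum.inl s) *
    Equiv.Perm.sumCongr f 1)

/-- Opposite darts after the addition of an edge. -/
def flipEdge (o : Equiv.Perm D) : Equiv.Perm (D ⊕ Bool) := Equiv.Perm.sumCongr o Equiv.boolNot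

/-- A dart of the old map with the same origin.  All properties of the vertices of the enlarged map
are pulled back along this map. -/
def retract (r s : D) : D ⊕ Bool → D := Sum.elim id fun b => if b then r else s

@[simp] theorem retract_inl (r s x : D) : retract r s (Sum.inl x) = x := rfl
@[simp] theorem retract_true (r s : D) : retract r s (Sum.inr true) = r := rfl
@[simp] theorem retract_false (r s : D) : retract r s (Sum.inr false) = s := rfl

theorem retract_surjective (r s : D) : Function.Surjective (retract r s) :=
  fun x => ⟨Sum.inl x, rfl⟩

section

variable {f o : Equiv.Perm D} {r s : D}

theorem insertEdge_true : insertEdge f r s (Sum.inr true) = Sum.inl r := by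
  classical
  simp only [insertEdge, Equiv.Perm.mul_apply, Equiv.Perm.sumCongr_apply, Sum.map_inr,
    Equiv.Perm.one_apply]
  rw [Equiv.swap_apply_of_ne_of_ne (a := Sum.inr false) (by simp) (by simp),
    Equiv.swap_apply_left]

theorem insertEdge_false (hrs : r ≠ s) : insertEdge f r s (Sum.inr false) = Sum.inl s := by
  classical
  simp only [insertEdge, Equiv.Perm.mul_apply, Equiv.Perm.sumCongr_apply, Sum.map_inr,
    Equiv.Perm.one_apply]
  rw [Equiv.swap_apply_left, Equiv.swap_apply_of_ne_of_ne (by simp) (by simpa using hrs.symm)]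

theorem insertEdge_inl_left (hrs : r ≠ s) {x : D} (h : f x = r) :
    insertEdge f r s (Sum.inl x) = Sum.inr true := by
  classical
  simp only [insertEdge, Equiv.Perm.mul_apply, Equiv.Perm.sumCongr_apply, Sum.map_inl, h]
  rw [Equiv.swap_apply_of_ne_of_ne (a := Sum.inr false) (by simp) (by simpa using hrs),
    Equiv.swap_apply_right]

theorem insertEdge_inl_right {x : D} (h : f x = s) :
    insertEdge f r s (Sum.inl x) = Sum.inr false := by
  classical
  simp only [insertEdge, Equiv.Perm.mul_apply, Equiv.Perm.sumCongr_apply, Sum.map_inl, h]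
  rw [Equiv.swap_apply_right, Equiv.swap_apply_of_ne_of_ne (by simp) (by simp)]

theorem insertEdge_inl {x : D} (h : f x ≠ r) (h' : f x ≠ s) :
    insertEdge f r s (Sum.inl x) = Sum.inl (f x) := by
  classical
  simp only [insertEdge, Equiv.Perm.mul_apply, Equiv.Perm.sumCongr_apply, Sum.map_inl]
  rw [Equiv.swap_apply_of_ne_of_ne (a := Sum.inr false) (by simp) (by simpa using h'),
    Equiv.swap_apply_of_ne_of_ne (by simp) (by simpa using h)]

theorem cyc_insertEdge (hrs : r ≠ s) :
    cyc (insertEdge f r s) = (cyc f).comap (retract r s) := by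
  set g := insertEdge f r s with hg
  have h1 : ∀ u, cyc g u (Sum.inl (retract r s u)) := by
    rintro (x | _ | _)
    · exact Setoid.refl' _ _
    · have := cyc_apply g (Sum.inr false)
      rwa [hg, insertEdge_false hrs] at this
    · have := cyc_apply g (Sum.inr true)
      rwa [hg, insertEdge_true] at this
  have h2 : ∀ x, cyc g (Sum.inl x) (Sum.inl (f x)) := by
    intro x
    refine Setoid.trans' _ (cyc_apply g _) ?_
    by_cases hr : f x = r
    · have h := h1 (Sum.inr true)
      rwa [hg, insertEdge_inl_left hrs hr, hr]
    by_cases hs : f x = s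
    · have h := h1 (Sum.inr false)
      rwa [hg, insertEdge_inl_right hs, hs]
    · rw [hg, insertEdge_inl hr hs]
  apply le_antisymm
  · refine cyc_le_iff.2 ?_
    rintro (x | _ | _)
    · change cyc f x (retract r s (g (Sum.inl x)))
      by_cases hr : f x = r
      · rw [hg, insertEdge_inl_left hrs hr, retract_true, ← hr]; exact cyc_apply f x
      by_cases hs : f x = s
      · rw [hg, insertEdge_inl_right hs, retract_false, ← hs]; exact cyc_apply f x
      · rw [hg, insertEdge_inl hr hs]; exact cyc_apply f x
    · change cyc f s (retract r s (g (Sum.inr false)))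
      rw [hg, insertEdge_false hrs]; exact Setoid.refl' _ _
    · change cyc f r (retract r s (g (Sum.inr true)))
      rw [hg, insertEdge_true]; exact Setoid.refl' _ _
  · have h3 : cyc f ≤ (cyc g).comap Sum.inl := cyc_le_iff.2 h2
    intro u v h
    exact Setoid.trans' _ (h1 u) (Setoid.trans' _ (h3 h) (Setoid.symm' _ (h1 v)))

theorem cyc_insertEdge_iff (hrs : r ≠ s) {u v : D ⊕ Bool} :
    cyc (insertEdge f r s) u v ↔ cyc f (retract r s u) (retract r s v) := by
  rw [cyc_insertEdge hrs]; exact Iff.rfl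

theorem conn_insertEdge (hrs : r ≠ s) (h : conn f o r s) :
    conn (insertEdge f r s) (flipEdge o) = (conn f o).comap (retract r s) := by
  apply le_antisymm
  · refine conn_le_iff.2 ⟨fun u => ?_, ?_⟩
    · exact cyc_le_conn_left f o ((cyc_insertEdge_iff hrs).1 (cyc_apply _ u))
    · rintro (x | _ | _)
      · exact cyc_le_conn_right f o (cyc_apply o x)
      · exact Setoid.symm' _ h
      · exact h
  · set t := conn (insertEdge f r s) (flipEdge o)
    have h1 : ∀ u, t u (Sum.inl (retract r s u)) := fun u =>
      cyc_le_conn_left _ _ ((cyc_insertEdge_iff hrs).2 (Setoid.refl' _ _))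
    have h3 : conn f o ≤ t.comap Sum.inl := by
      refine conn_le_iff.2 ⟨fun x => ?_, fun x => ?_⟩
      · exact cyc_le_conn_left _ _ ((cyc_insertEdge_iff hrs).2 (cyc_apply f x))
      · exact cyc_le_conn_right _ _ (cyc_apply (flipEdge o) (Sum.inl x))
    intro u v h
    exact Setoid.trans' _ (h1 u) (Setoid.trans' _ (h3 h) (Setoid.symm' _ (h1 v)))

open scoped Classical in
theorem cycDeg_insertEdge [Finite D] (hrs : r ≠ s) (u : D ⊕ Bool) :
    cycDeg (insertEdge f r s) u = cycDeg f (retract r s u) +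
      ((if cyc f (retract r s u) r then 1 else 0) + (if cyc f (retract r s u) s then 1 else 0)) := by
  rw [cycDeg, Nat.card_congr (Equiv.subtypeEquivRight fun v => cyc_insertEdge_iff hrs),
    Nat.card_congr Equiv.subtypeSum, Nat.card_sum, cycDeg]
  congr 1
  rw [Nat.card_eq_fintype_card, Fintype.card_subtype, Finset.card_filter, Fintype.sum_bool]
  rfl

theorem face_insertEdge : insertEdge f r s * flipEdge o =
    (open scoped Classical in Equiv.swap (Sum.inr true) (Sum.inl r) *
      (Equiv.swap (Sum.inr false) (Sum.inl s) *
        Equiv.Perm.sumCongr (f * o) Equiv.boolNot)) := by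
  rw [insertEdge, flipEdge, mul_assoc, mul_assoc, Equiv.Perm.sumCongr_mul, one_mul]

theorem numClasses_face_insertEdge [Finite D] (h : cyc (f * o) r s) :
    numClasses (cyc (insertEdge f r s * flipEdge o)) = numClasses (cyc (f * o)) + 1 := by
  classical
  rw [face_insertEdge]
  set g := Equiv.Perm.sumCongr (f * o) Equiv.boolNot with hg
  have hc : cyc g = _ := cyc_sumCongr _ _
  have h1 : ¬ cyc g (Sum.inr false) (Sum.inl s) := by rw [hc]; exact id
  have h2 := numClasses_swap_mul_of_not h1
  have h3 : numClasses (cyc g) = numClasses (cyc (f * o)) + 1 := by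
    rw [hc, numClasses_sum, numClasses_boolNot]
  have h4 : cyc (Equiv.swap (Sum.inr false) (Sum.inl s) * g) (Sum.inr true) (Sum.inl r) := by
    rw [cyc_swap_mul_eq_glue h1]
    refine Or.inr (Or.inl ⟨?_, ?_⟩)
    · rw [hc]; exact cyc_boolNot _ _
    · rw [hc]; exact (cyc (f * o)).symm h
  have h5 := numClasses_swap_mul (by simp) h4
  refine Eq.trans ?_ (h5.trans (by omega))
  congr!

end

/-- The patch obtained by a new edge that joins the origin of the first to the origin of the third
dart of the first boundary cycle, and so adds a triangle to the first component. -/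
noncomputable def capPatch (f o : Equiv.Perm D) (r s : D) (A : List D) (ls : List (List D)) :
    Patch (D ⊕ Bool) where
  next := insertEdge f r s
  opp := flipEdge o
  bdry := (Sum.inr true :: Sum.inl s :: A.map Sum.inl) :: ls.map (List.map Sum.inl)

section

variable {f o : Equiv.Perm D} {r x s : D} {A : List D} {ls : List (List D)}

theorem capPatch_rim : (capPatch f o r s A ls).bdry.flatten =
    Sum.inr true :: (s :: (A ++ ls.flatten)).map Sum.inl := by
  simp [capPatch, List.map_flatten]

theorem capPatch_face_inl (y : D) : (capPatch f o r s A ls).face (Sum.inl y) =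
    insertEdge f r s (Sum.inl (o y)) := rfl

theorem capPatch_face_true (hrs : r ≠ s) :
    (capPatch f o r s A ls).face (Sum.inr true) = Sum.inl s := insertEdge_false (f := f) hrs

theorem capPatch_face_false :
    (capPatch f o r s A ls).face (Sum.inr false) = Sum.inl r := insertEdge_true (f := f) (s := s)

theorem capPatch_face_eq_inl (hrs : r ≠ s) {y z : D} :
    (capPatch f o r s A ls).face (Sum.inl y) = Sum.inl z ↔
      f (o y) = z ∧ z ≠ r ∧ z ≠ s := by
  rw [capPatch_face_inl]
  by_cases h1 : f (o y) = r
  · rw [insertEdge_inl_left hrs h1]; simp; rintro rfl h; exact absurd h1 h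
  by_cases h2 : f (o y) = s
  · rw [insertEdge_inl_right h2]; simp; rintro rfl _; exact h2
  · rw [insertEdge_inl h1 h2]; simp
    rintro rfl; exact ⟨h1, h2⟩

theorem capPatch_face_eq_true (hrs : r ≠ s) {y : D} :
    (capPatch f o r s A ls).face (Sum.inl y) = Sum.inr true ↔ f (o y) = r := by
  rw [capPatch_face_inl]
  by_cases h1 : f (o y) = r
  · rw [insertEdge_inl_left hrs h1]; simp [h1]
  by_cases h2 : f (o y) = s
  · rw [insertEdge_inl_right h2]; simp [h1]
  · rw [insertEdge_inl h1 h2]; simp [h1]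

theorem capPatch_face_eq_false (hrs : r ≠ s) {y : D} :
    (capPatch f o r s A ls).face (Sum.inl y) = Sum.inr false ↔ f (o y) = s := by
  rw [capPatch_face_inl]
  by_cases h1 : f (o y) = r
  · rw [insertEdge_inl_left hrs h1]; simp; rintro h; exact hrs (h1.symm.trans h)
  by_cases h2 : f (o y) = s
  · rw [insertEdge_inl_right h2]; simp [h2]
  · rw [insertEdge_inl h1 h2]; simp [h2]

theorem follows_capPatch (hrs : r ≠ s) {y : D} {l : List D} (h : r ∉ l) (h' : s ∉ l) :
    Follows (capPatch f o r s A ls).face (Sum.inl y) (l.map Sum.inl) (Sum.inr true) ↔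
      Follows (f * o) y l r := by
  induction l generalizing y with
  | nil => exact capPatch_face_eq_true hrs
  | cons a l ih =>
    simp only [List.mem_cons, not_or] at h h'
    rw [List.map_cons, Follows, Follows, capPatch_face_eq_inl hrs, ih h.2 h'.2]
    exact and_congr_left' ⟨fun k => k.1, fun k => ⟨k, Ne.symm h.1, Ne.symm h'.1⟩⟩

theorem isBoundary_capPatch (hrs : r ≠ s) {L : List D} (h : r ∉ L) (h' : s ∉ L) :
    IsBoundary (capPatch f o r s A ls).face (L.map Sum.inl) ↔ IsBoundary (f * o) L := by
  have key : ∀ (y z : D) (l : List D), r ∉ l → s ∉ l → z ≠ r → z ≠ s →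
      (Follows (capPatch f o r s A ls).face (Sum.inl y) (l.map Sum.inl) (Sum.inl z) ↔
        Follows (f * o) y l z) := by
    intro y z l hr hs hzr hzs
    induction l generalizing y with
    | nil =>
      exact (capPatch_face_eq_inl hrs).trans ⟨fun k => k.1, fun k => ⟨k, hzr, hzs⟩⟩
    | cons a l ih =>
      simp only [List.mem_cons, not_or] at hr hs
      rw [List.map_cons, Follows, Follows, capPatch_face_eq_inl hrs, ih _ hr.2 hs.2]
      exact and_congr_left' ⟨fun k => k.1, fun k => ⟨k, Ne.symm hr.1, Ne.symm hs.1⟩⟩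
  cases L with
  | nil => exact Iff.rfl
  | cons a l =>
    simp only [List.mem_cons, not_or] at h h'
    exact key a a l h.2 h'.2 (Ne.symm h.1) (Ne.symm h'.1)

/-- Adding an edge that covers the origin of the second boundary dart `x` respects being
triangulated in both directions, as long as the new edge is not a loop. -/
theorem capPatch_isTriangulated_iff [Finite D]
    (hnd : ((r :: x :: s :: A) ++ ls.flatten).Nodup)
    (hrx : f (o r) = x) (hxs : f (o x) = s) :
    (capPatch f o r s A ls).IsTriangulated ↔
      (Patch.mk f o ((r :: x :: s :: A) :: ls)).IsTriangulated ∧ ¬ cyc f r s := by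
  set T := capPatch f o r s A ls with hT
  set S := Patch.mk f o ((r :: x :: s :: A) :: ls) with hS
  have hnd' := hnd
  simp only [List.cons_append, List.nodup_cons, List.mem_cons, not_or] at hnd'
  obtain ⟨⟨hrx', hrs, hrA⟩, ⟨hxs', hxA⟩, hsA, hA⟩ := hnd'
  have hrA' : r ∉ A := fun h => hrA (List.mem_append_left _ h)
  have hsA' : s ∉ A := fun h => hsA (List.mem_append_left _ h)
  have hc1 : conn f o r x := cyc_mul_le_conn f o (by rw [← hrx]; exact cyc_apply (f * o) r)
  have hc2 : conn f o x s := cyc_mul_le_conn f o (by rw [← hxs]; exact cyc_apply (f * o) x)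
  have hcf : cyc (f * o) r s := by
    rw [← hxs, ← hrx]
    exact Setoid.trans' _ (cyc_apply (f * o) r) (cyc_apply (f * o) (f (o r)))
  have hcomp : T.comp = S.comp.comap (retract r s) := conn_insertEdge hrs (Setoid.trans' _ hc1 hc2)
  have hcomp' : ∀ u v, T.comp u v ↔ S.comp (retract r s u) (retract r s v) := by
    intro u v; rw [hcomp]; exact Iff.rfl
  have hrimT : T.bdry.flatten = Sum.inr true :: (s :: (A ++ ls.flatten)).map Sum.inl :=
    capPatch_rim
  have hrimS : S.bdry.flatten = r :: x :: s :: (A ++ ls.flatten) := by simp [hS]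
  have hmemT : ∀ y, Sum.inl y ∈ T.bdry.flatten ↔ y ∈ s :: (A ++ ls.flatten) := by
    intro y; rw [hrimT]; simp
  -- the new triangle
  have hfr : T.face (Sum.inl r) = Sum.inl x :=
    (capPatch_face_eq_inl hrs).2 ⟨hrx, Ne.symm hrx', hxs'⟩
  have hfx : T.face (Sum.inl x) = Sum.inr false := (capPatch_face_eq_false hrs).2 hxs
  have hff : T.face (Sum.inr false) = Sum.inl r := capPatch_face_false
  have hcyc : (∀ L ∈ T.bdry, IsBoundary T.face L) ↔ ∀ L ∈ S.bdry, IsBoundary S.face L := by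
    change (∀ L ∈ _ :: _, _) ↔ (∀ L ∈ _ :: _, _)
    rw [List.forall_mem_cons, List.forall_mem_cons]
    refine and_congr ?_ ?_
    · change Follows _ _ _ _ ↔ Follows _ _ _ _
      rw [Follows, Follows, Follows, follows_capPatch hrs hrA' hsA']
      exact ⟨fun h => ⟨hrx, hxs, h.2⟩, fun h => ⟨capPatch_face_true hrs, h.2.2⟩⟩
    · rw [List.forall_mem_map]
      refine forall₂_congr fun L hL => isBoundary_capPatch hrs ?_ ?_
      · exact fun h => hrA (List.mem_append_right _ (List.mem_flatten.2 ⟨L, hL, h⟩))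
      · exact fun h => hsA (List.mem_append_right _ (List.mem_flatten.2 ⟨L, hL, h⟩))
  -- there is one edge more and one face more
  have hE : numClasses (cyc T.opp) = numClasses (cyc S.opp) + 1 := by
    change numClasses (cyc (Equiv.Perm.sumCongr o Equiv.boolNot)) = _
    rw [cyc_sumCongr, numClasses_sum, numClasses_boolNot]
  have hV : numClasses (cyc T.next) = numClasses (cyc S.next) := by
    change numClasses (cyc (insertEdge f r s)) = _
    rw [cyc_insertEdge hrs, numClasses_comap _ (retract_surjective r s)]
  have hF : numClasses (cyc T.face) = numClasses (cyc S.face) + 1 :=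
    numClasses_face_insertEdge hcf
  have hlen : T.bdry.length = S.bdry.length := by simp [hT, hS, capPatch]
  constructor
  · intro h
    refine ⟨⟨?_, ?_, ?_, ?_, ?_, hcyc.1 h.cyclic, ?_, ?_, ?_⟩, ?_⟩
    · exact fun d => Sum.inl_injective (h.opp_opp (Sum.inl d))
    · exact fun d k => h.opp_ne (Sum.inl d) (congrArg Sum.inl k)
    · intro d
      obtain ⟨L, hL, u, hu, hud⟩ := h.cover (Sum.inl d)
      rw [hcomp'] at hud
      rcases List.mem_cons.1 hL with rfl | hL
      · refine ⟨_, List.mem_cons_self, retract r s u, ?_, hud⟩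
        rcases List.mem_cons.1 hu with rfl | hu
        · simp
        · rw [← List.map_cons] at hu
          obtain ⟨y, hy, rfl⟩ := List.mem_map.1 hu
          exact List.mem_cons_of_mem _ (List.mem_cons_of_mem _ hy)
      · obtain ⟨L, hL', rfl⟩ := List.mem_map.1 hL
        obtain ⟨y, hy, rfl⟩ := List.mem_map.1 hu
        exact ⟨L, List.mem_cons_of_mem _ hL', y, hy, hud⟩
    · have k := h.separate
      simp only [hT, capPatch, List.pairwise_cons, List.pairwise_map] at k
      refine List.pairwise_cons.2 ⟨fun L hL => ?_, k.2.imp fun {L L'} m y hy z hz hyz => ?_⟩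
      · have m := k.1 _ (List.mem_map_of_mem hL)
        have m1 : ∀ z ∈ L, ¬ S.comp r z := fun z hz hrz =>
          m (Sum.inr true) (by simp) (Sum.inl z) (List.mem_map_of_mem hz) ((hcomp' _ _).2 hrz)
        intro y hy z hz hyz
        rcases List.mem_cons.1 hy with rfl | hy
        · exact m1 z hz hyz
        rcases List.mem_cons.1 hy with rfl | hy
        · exact m1 z hz (Setoid.trans' _ hc1 hyz)
        · refine m (Sum.inl y) ?_ (Sum.inl z) (List.mem_map_of_mem hz) ((hcomp' _ _).2 hyz)
          rw [← List.map_cons]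
          exact List.mem_cons_of_mem _ (List.mem_map_of_mem hy)
      · exact m (Sum.inl y) (List.mem_map_of_mem hy) (Sum.inl z) (List.mem_map_of_mem hz)
          ((hcomp' _ _).2 hyz)
    · have := h.euler; omega
    · rw [hrimS]; exact hnd
    · intro d hd
      rw [hrimS] at hd
      simp only [List.mem_cons, not_or] at hd
      have hdT : Sum.inl d ∉ T.bdry.flatten := by
        rw [hmemT]; simp only [List.mem_cons, not_or]; exact hd.2.2
      -- a face off the boundary avoids the new edge, unless it contains `r` and `x`
      have step : ∀ y, Sum.inl y ∉ T.bdry.flatten → y ≠ x →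
          T.face (Sum.inl y) = Sum.inl (S.face y) ∧ Sum.inl (S.face y) ∉ T.bdry.flatten := by
        intro y hy hyx
        have h1 : f (o y) ≠ r := by
          intro k
          have k1 : T.face (Sum.inl y) = Sum.inr true := (capPatch_face_eq_true hrs).2 k
          refine hy (h.rim_closed_symm ?_)
          rw [k1, hrimT]; exact List.mem_cons_self
        have h2 : f (o y) ≠ s := by
          intro k
          rw [← hxs] at k
          exact hyx (o.injective (f.injective k))
        have k : T.face (Sum.inl y) = Sum.inl (f (o y)) :=
          (capPatch_face_eq_inl hrs).2 ⟨rfl, h1, h2⟩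
        refine ⟨k, fun m => hy (h.rim_closed_symm ?_)⟩
        rw [k]; exact m
      have h3 := h.triangle _ hdT
      have back : ∀ y, S.face y = x → y = r := by
        intro y hy
        rw [← hrx] at hy
        exact o.injective (f.injective hy)
      obtain ⟨e1, m1⟩ := step d hdT hd.2.1
      have n1 : S.face d ≠ x := fun k => hd.1 (back _ k)
      obtain ⟨e2, m2⟩ := step _ m1 n1
      have n2 : S.face (S.face d) ≠ x := by
        intro k
        have k2 := back _ k
        rw [e1, e2, k, hfx] at h3
        exact absurd h3 (by simp)
      obtain ⟨e3, m3⟩ := step _ m2 n2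
      rw [e1, e2, e3] at h3
      exact Sum.inl_injective h3
    · intro d k
      exact h.loopless (Sum.inl d) ((cyc_insertEdge_iff hrs).2 k)
    · intro k
      exact h.loopless (Sum.inr true) ((cyc_insertEdge_iff hrs).2 k)
  · rintro ⟨h, hloop⟩
    refine ⟨?_, ?_, ?_, ?_, ?_, hcyc.2 h.cyclic, ?_, ?_, ?_⟩
    · rintro (d | _ | _)
      · exact congrArg Sum.inl (h.opp_opp d)
      · rfl
      · rfl
    · rintro (d | _ | _)
      · exact fun k => h.opp_ne d (Sum.inl_injective k)
      · exact fun k => absurd (Sum.inr_injective k) (by simp)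
      · exact fun k => absurd (Sum.inr_injective k) (by simp)
    · intro u
      obtain ⟨L, hL, y, hy, hyu⟩ := h.cover (retract r s u)
      rcases List.mem_cons.1 hL with rfl | hL
      · refine ⟨_, List.mem_cons_self, Sum.inr true, List.mem_cons_self, (hcomp' _ _).2 ?_⟩
        exact Setoid.trans' _ ((h.cyclic _ List.mem_cons_self).rel S.face_le_comp
          List.mem_cons_self hy) hyu
      · exact ⟨_, List.mem_cons_of_mem _ (List.mem_map_of_mem hL), Sum.inl y,
          List.mem_map_of_mem hy, (hcomp' _ _).2 hyu⟩
    · have k := List.pairwise_cons.1 h.separate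
      refine List.pairwise_cons.2 ⟨fun L hL => ?_, ?_⟩
      · obtain ⟨L, hL', rfl⟩ := List.mem_map.1 hL
        intro u hu v hv huv
        obtain ⟨z, hz, rfl⟩ := List.mem_map.1 hv
        rw [hcomp'] at huv
        refine k.1 L hL' _ ?_ z hz huv
        rcases List.mem_cons.1 hu with rfl | hu
        · simp
        · rw [← List.map_cons] at hu
          obtain ⟨y, hy, rfl⟩ := List.mem_map.1 hu
          exact List.mem_cons_of_mem _ (List.mem_cons_of_mem _ hy)
      · refine List.pairwise_map.2 (k.2.imp fun {L L'} m u hu v hv huv => ?_)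
        obtain ⟨y, hy, rfl⟩ := List.mem_map.1 hu
        obtain ⟨z, hz, rfl⟩ := List.mem_map.1 hv
        exact m y hy z hz ((hcomp' _ _).1 huv)
    · have := h.euler; omega
    · rw [hrimT, List.nodup_cons]
      refine ⟨by simp, List.Nodup.map Sum.inl_injective ?_⟩
      exact List.nodup_cons.2 ⟨hsA, hA⟩
    · rintro (d | _ | _) hd
      · rw [hmemT, List.mem_cons, not_or] at hd
        by_cases h1 : d = r
        · subst h1; rw [hfr, hfx, hff]
        by_cases h2 : d = x
        · subst h2; rw [hfx, hff, hfr]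
        have hdS : d ∉ S.bdry.flatten := by
          rw [hrimS]; simp only [List.mem_cons, not_or]; exact ⟨h1, h2, hd⟩
        have step : ∀ y, y ∉ S.bdry.flatten → T.face (Sum.inl y) = Sum.inl (S.face y) ∧
            S.face y ∉ S.bdry.flatten := by
          intro y hy
          have hm : S.face y ∉ S.bdry.flatten := fun m => hy (h.rim_closed_symm m)
          refine ⟨(capPatch_face_eq_inl hrs).2 ⟨rfl, ?_, ?_⟩, hm⟩
          · rintro k; apply hm; rw [hrimS, k]; simp
          · rintro k; apply hm; rw [hrimS, k]; simp
        obtain ⟨e1, m1⟩ := step d hdS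
        obtain ⟨e2, m2⟩ := step _ m1
        obtain ⟨e3, m3⟩ := step _ m2
        rw [e1, e2, e3, h.triangle d hdS]
      · rw [hff, hfr, hfx]
      · exact absurd (by rw [hrimT]; exact List.mem_cons_self) hd
    · rintro (d | _ | _) k
      · exact h.loopless d ((cyc_insertEdge_iff hrs).1 k)
      · exact hloop (Setoid.symm' _ ((cyc_insertEdge_iff hrs).1 k))
      · exact hloop ((cyc_insertEdge_iff hrs).1 k)

theorem capPatch_simpleOn_iff (hrs : r ≠ s) :
    SimpleOn (capPatch f o r s A ls).next (capPatch f o r s A ls).bdry.flatten ↔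
      SimpleOn f (r :: s :: (A ++ ls.flatten)) := by
  rw [capPatch_rim, SimpleOn, SimpleOn]
  rw [show (r :: s :: (A ++ ls.flatten)) = List.map (retract r s)
    (Sum.inr true :: (s :: (A ++ ls.flatten)).map Sum.inl) by
      simp [List.map_map, Function.comp_def], List.pairwise_map]
  refine iff_of_eq (congrArg (List.Pairwise · _) ?_)
  funext u v
  exact propext (not_congr (cyc_insertEdge_iff hrs))

theorem capPatch_innerOn_iff [Finite D] (hrs : r ≠ s) :
    InnerOn (capPatch f o r s A ls).next (capPatch f o r s A ls).bdry.flatten ↔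
      InnerOn f (r :: s :: (A ++ ls.flatten)) := by
  classical
  rw [capPatch_rim]
  have hiff : ∀ u, (∃ b ∈ (Sum.inr true :: (s :: (A ++ ls.flatten)).map Sum.inl : List (D ⊕ Bool)),
      cyc (insertEdge f r s) u b) ↔
      ∃ b ∈ r :: s :: (A ++ ls.flatten), cyc f (retract r s u) b := by
    intro u
    rw [List.exists_mem_cons_iff, List.exists_mem_cons_iff, cyc_insertEdge_iff hrs, retract_true]
    refine or_congr Iff.rfl ?_
    constructor
    · rintro ⟨b, hb, hub⟩
      obtain ⟨y, hy, rfl⟩ := List.mem_map.1 hb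
      exact ⟨y, hy, (cyc_insertEdge_iff hrs).1 hub⟩
    · rintro ⟨y, hy, k⟩
      exact ⟨Sum.inl y, List.mem_map_of_mem hy, (cyc_insertEdge_iff hrs).2 k⟩
  have key : ∀ u, ((∃ b ∈ (Sum.inr true :: (s :: (A ++ ls.flatten)).map Sum.inl : List (D ⊕ Bool)),
      cyc (insertEdge f r s) u b) ∨ 4 ≤ cycDeg (insertEdge f r s) u) ↔
      ((∃ b ∈ r :: s :: (A ++ ls.flatten), cyc f (retract r s u) b) ∨
        4 ≤ cycDeg f (retract r s u)) := by
    intro u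
    rw [hiff]
    by_cases hk : ∃ b ∈ r :: s :: (A ++ ls.flatten), cyc f (retract r s u) b
    · simp only [hk, true_or]
    · simp only [hk, false_or]
      push Not at hk
      rw [cycDeg_insertEdge hrs, if_neg (hk r (by simp)), if_neg (hk s (by simp))]
      simp
  constructor
  · exact fun h y => (key (Sum.inl y)).1 (h (Sum.inl y))
  · exact fun h u => (key u).2 (h _)

/-- The degrees along the boundary after covering a vertex. -/
theorem capPatch_degs [Finite D] (hrs : r ≠ s) (hloop : ¬ cyc f r s)
    (h : SimpleOn f (r :: s :: (A ++ ls.flatten))) :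
    (capPatch f o r s A ls).degs =
      ((cycDeg f r + 1) :: (cycDeg f s + 1) :: A.map (cycDeg f)) :: ls.map (List.map (cycDeg f)) := by
  classical
  have h1 := List.pairwise_cons.1 h
  have h2 := List.pairwise_cons.1 h1.2
  have key : ∀ y ∈ A ++ ls.flatten, cycDeg (insertEdge f r s) (Sum.inl y) = cycDeg f y := by
    intro y hy
    rw [cycDeg_insertEdge hrs, retract_inl,
      if_neg fun k => h1.1 y (List.mem_cons_of_mem _ hy) (Setoid.symm' _ k),
      if_neg fun k => h2.1 y hy (Setoid.symm' _ k)]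
    simp
  simp only [degs, capPatch, List.map_cons, List.map_map]
  refine congrArg₂ _ (congrArg₂ _ ?_ (congrArg₂ _ ?_ ?_)) ?_
  · rw [cycDeg_insertEdge hrs, retract_true, if_pos (Setoid.refl' _ _), if_neg hloop]
  · rw [cycDeg_insertEdge hrs, retract_inl, if_pos (Setoid.refl' _ _),
      if_neg fun k => hloop (Setoid.symm' _ k)]
  · exact List.map_congr_left fun y hy => key y (List.mem_append_left _ hy)
  · refine List.map_congr_left fun L hL => ?_
    simp only [Function.comp, List.map_map]
    exact List.map_congr_left fun y hy =>
      key y (List.mem_append_right _ (List.mem_flatten.2 ⟨L, hL, hy⟩))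

end

end Patch

/-! ### Gluing two polygons at a vertex -/

section Simple

variable {D : Type} {f : Equiv.Perm D}

theorem simpleOn_iff {B : List D} :
    SimpleOn f B ↔ B.Nodup ∧ ∀ x ∈ B, ∀ y ∈ B, cyc f x y → x = y := by
  constructor
  · intro h
    refine ⟨List.Pairwise.imp (by rintro x y k rfl; exact k (Setoid.refl' _ _)) h,
      fun x hx y hy hxy => ?_⟩
    by_contra hne
    have : Std.Symm fun x y => ¬ cyc f x y := ⟨fun a b k l => k (Setoid.symm' _ l)⟩
    exact List.Pairwise.forall h hx hy hne hxy
  · rintro ⟨h1, h2⟩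
    exact h1.imp_of_mem fun {x y} hx hy hne hxy => hne (h2 x hx y hy hxy)

end Simple

namespace Patch

variable {D : Type} {f o : Equiv.Perm D}

theorem cycDeg_congr {g : Equiv.Perm D} {x : D} (h : ∀ y, cyc g x y ↔ cyc f x y) :
    cycDeg g x = cycDeg f x := Nat.card_congr (Equiv.subtypeEquivRight h)

theorem cycDeg_eq_of_cyc {x y : D} (h : cyc f x y) : cycDeg f x = cycDeg f y :=
  Nat.card_congr (Equiv.subtypeEquivRight fun _ =>
    ⟨fun l => Setoid.trans' _ (Setoid.symm' _ h) l, fun l => Setoid.trans' _ h l⟩)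

section Merge

variable [DecidableEq D]

theorem follows_swap {a s y z : D} {l : List D} (ha : a ∉ l) (hs : s ∉ l) :
    Follows (Equiv.swap a s * f) y l (Equiv.swap a s z) ↔ Follows f y l z := by
  induction l generalizing y with
  | nil => exact (Equiv.swap a s).injective.eq_iff
  | cons b l ih =>
    simp only [List.mem_cons, not_or] at ha hs
    rw [Follows, Follows, ih ha.2 hs.2]
    refine and_congr_left' ?_
    rw [Equiv.Perm.mul_apply]
    nth_rewrite 1 [← Equiv.swap_apply_of_ne_of_ne (Ne.symm ha.1) (Ne.symm hs.1)]
    exact (Equiv.swap a s).injective.eq_iff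

theorem isBoundary_swap {a s : D} {L : List D} (ha : a ∉ L) (hs : s ∉ L) :
    IsBoundary (Equiv.swap a s * f) L ↔ IsBoundary f L := by
  cases L with
  | nil => exact Iff.rfl
  | cons b l =>
    simp only [List.mem_cons, not_or] at ha hs
    have := follows_swap (f := f) (y := b) (z := b) ha.2 hs.2
    rwa [Equiv.swap_apply_of_ne_of_ne (Ne.symm ha.1) (Ne.symm hs.1)] at this

theorem IsTriangulated.swap_triangle [Finite D] {S : Patch D} (h : S.IsTriangulated) {a s : D}
    (ha : a ∈ S.bdry.flatten) (hs : s ∈ S.bdry.flatten) {d : D} (hd : d ∉ S.bdry.flatten) :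
    (Equiv.swap a s * S.face) ((Equiv.swap a s * S.face) ((Equiv.swap a s * S.face) d)) = d := by
  have step : ∀ y, y ∉ S.bdry.flatten → (Equiv.swap a s * S.face) y = S.face y ∧
      S.face y ∉ S.bdry.flatten := by
    intro y hy
    have hm : S.face y ∉ S.bdry.flatten := fun m => hy (h.rim_closed_symm m)
    exact ⟨Equiv.swap_apply_of_ne_of_ne (fun k => hm (k ▸ ha)) (fun k => hm (k ▸ hs)), hm⟩
  obtain ⟨e1, m1⟩ := step d hd
  obtain ⟨e2, m2⟩ := step _ m1
  obtain ⟨e3, m3⟩ := step _ m2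
  rw [e1, e2, e3, h.triangle d hd]

variable [Finite D] {r a s : D} {A B : List D} {ls : List (List D)}

/-- Multiplication of the rotation by `swap a s` unites the origins of the darts `a` and `s` of the
first two boundary cycles, or splits a common origin.  From the right to the left, the darts lie in
different components, and the two components are united.  Conversely, Euler's inequality shows that
a vertex that occurs twice on a boundary cycle is a cut vertex. -/
theorem merge_isTriangulated_iff (hra : f (o r) = a)
    (hnd : (((r :: a :: A) :: (s :: B) :: ls).flatten).Nodup) :
    (Patch.mk (Equiv.swap a s * f) o ((r :: s :: (B ++ a :: A)) :: ls)).IsTriangulated ∧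
        cyc (Equiv.swap a s * f) a s ↔
      (Patch.mk f o ((r :: a :: A) :: (s :: B) :: ls)).IsTriangulated := by
  set T := Patch.mk (Equiv.swap a s * f) o ((r :: s :: (B ++ a :: A)) :: ls) with hT
  set S := Patch.mk f o ((r :: a :: A) :: (s :: B) :: ls) with hS
  have hnd' := hnd
  simp only [List.flatten_cons, List.cons_append, List.nodup_cons, List.mem_cons,
    List.mem_append, not_or] at hnd'
  obtain ⟨⟨hra', hrA, hrs, hrB, hrl⟩, ⟨haA, has, haB, hal⟩, hnd2⟩ := hnd'
  rw [List.nodup_append] at hnd2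
  obtain ⟨hA, hnd3, hdis⟩ := hnd2
  have hsA : s ∉ A := fun h => hdis s h s List.mem_cons_self rfl
  simp only [List.nodup_cons, List.mem_append, not_or] at hnd3
  obtain ⟨⟨hsB, hsl⟩, -⟩ := hnd3
  have hrimS : S.bdry.flatten = r :: a :: (A ++ s :: (B ++ ls.flatten)) := by simp [hS]
  have hrimT : T.bdry.flatten = r :: s :: (B ++ a :: (A ++ ls.flatten)) := by simp [hT]
  have hperm : T.bdry.flatten.Perm S.bdry.flatten := by
    rw [hrimS, hrimT]
    refine List.Perm.cons _ ?_
    have := (List.perm_append_comm (l₁ := s :: B) (l₂ := a :: A)).append_right ls.flatten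
    simpa using this
  have hmem : ∀ d, d ∈ T.bdry.flatten ↔ d ∈ S.bdry.flatten := fun d => hperm.mem_iff
  have haS : a ∈ S.bdry.flatten := by rw [hrimS]; simp
  have hsS : s ∈ S.bdry.flatten := by rw [hrimS]; simp
  have hfaceT : T.face = Equiv.swap a s * S.face := mul_assoc _ _ _
  have hfaceS : S.face = Equiv.swap a s * T.face := by
    rw [hfaceT, ← mul_assoc, Equiv.swap_mul_self, one_mul]
  have hf : S.next = Equiv.swap a s * T.next := by
    change f = Equiv.swap a s * (Equiv.swap a s * f)
    rw [← mul_assoc, Equiv.swap_mul_self, one_mul]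
  have hcyc : (∀ L ∈ T.bdry, IsBoundary T.face L) ↔ ∀ L ∈ S.bdry, IsBoundary S.face L := by
    change (∀ L ∈ _ :: _, _) ↔ (∀ L ∈ _ :: _ :: _, _)
    rw [List.forall_mem_cons, List.forall_mem_cons, List.forall_mem_cons, ← and_assoc]
    refine and_congr ?_ ?_
    · change Follows T.face r (s :: (B ++ a :: A)) r ↔
        Follows S.face r (a :: A) r ∧ Follows S.face s B s
      rw [Follows, Follows, follows_append, hfaceT]
      have e1 := follows_swap (f := S.face) (y := s) (z := s) haB hsB
      rw [Equiv.swap_apply_right] at e1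
      have e2 := follows_swap (f := S.face) (y := a) (z := r) haA hsA
      rw [Equiv.swap_apply_of_ne_of_ne hra' hrs] at e2
      rw [e1, e2]
      have e3 : (Equiv.swap a s * S.face) r = s := by
        rw [Equiv.Perm.mul_apply, face_apply]
        change Equiv.swap a s (f (o r)) = s
        rw [hra, Equiv.swap_apply_left]
      exact ⟨fun h => ⟨⟨hra, h.2.2⟩, h.2.1⟩, fun h => ⟨e3, h.2, h.1.2⟩⟩
    · refine forall₂_congr fun L hL => ?_
      rw [hfaceT]
      exact isBoundary_swap (fun h => hal (List.mem_flatten.2 ⟨L, hL, h⟩))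
        (fun h => hsl (List.mem_flatten.2 ⟨L, hL, h⟩))
  have hcomp : cyc T.next a s → T.comp = S.comp.glue a s := by
    intro h
    rw [← conn_swap_mul_glue, Setoid.glue_eq_self]
    exact cyc_le_conn_left _ _ h
  have hm1 : ∀ x, x ∈ r :: a :: A → x ∈ r :: s :: (B ++ a :: A) := by
    clear * -; intro x hx; simp only [List.mem_cons, List.mem_append] at hx ⊢; tauto
  have hm2 : ∀ x, x ∈ s :: B → x ∈ r :: s :: (B ++ a :: A) := by
    clear * -; intro x hx; simp only [List.mem_cons, List.mem_append] at hx ⊢; tauto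
  have hm3 : ∀ x, x ∈ r :: s :: (B ++ a :: A) → x ∈ r :: a :: A ∨ x ∈ s :: B := by
    clear * -; intro x hx; simp only [List.mem_cons, List.mem_append] at hx ⊢; tauto
  have haM : a ∈ r :: a :: A := by simp
  have hsM : s ∈ s :: B := by simp
  constructor
  · rintro ⟨h, hcas⟩
    have hcas' : cyc T.next a s := hcas
    have hV := numClasses_swap_mul has hcas'
    rw [← hf] at hV
    have hF := numClasses_swap_mul has ((h.cyclic _ List.mem_cons_self).rel le_rfl
      (hm1 a haM) (hm2 s hsM))
    rw [← hfaceS] at hF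
    have hE := h.euler
    have hk := h.numClasses_comp
    have hlen : S.bdry.length = T.bdry.length + 1 := by simp [hS, hT]
    have hnc : ¬ S.comp a s := by
      intro hc
      -- one vertex and one face more in the same component would make the genus negative
      rw [hcomp hcas', Setoid.glue_eq_self hc] at hk
      have := euler_inequality (g := S.opp) h.opp_opp S.next
      change numClasses (cyc S.next) + numClasses (cyc S.face) ≤
        numClasses (cyc T.opp) + 2 * numClasses S.comp at this
      omega
    have hle : S.comp ≤ T.comp := by rw [hcomp hcas']; exact Setoid.le_glue _ _ _
    have hcyc' := hcyc.1 h.cyclic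
    have hb1 := hcyc' _ List.mem_cons_self
    have hb2 := hcyc' _ (List.mem_cons_of_mem _ List.mem_cons_self)
    refine ⟨h.opp_opp, h.opp_ne, ?_, ?_, ?_, hcyc', hnd, ?_, ?_⟩
    · intro d
      obtain ⟨L, hL, x, hx, hxd⟩ := h.cover d
      rw [hcomp hcas'] at hxd
      rcases hxd with hxd | ⟨-, hxd⟩ | ⟨-, hxd⟩
      · rcases List.mem_cons.1 hL with rfl | hL
        · rcases hm3 x hx with hx | hx
          · exact ⟨_, List.mem_cons_self, x, hx, hxd⟩
          · exact ⟨_, List.mem_cons_of_mem _ List.mem_cons_self, x, hx, hxd⟩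
        · exact ⟨L, List.mem_cons_of_mem _ (List.mem_cons_of_mem _ hL), x, hx, hxd⟩
      · exact ⟨_, List.mem_cons_of_mem _ List.mem_cons_self, s, hsM, hxd⟩
      · exact ⟨_, List.mem_cons_self, a, haM, hxd⟩
    · have k := List.pairwise_cons.1 h.separate
      refine List.pairwise_cons.2 ⟨fun L hL => ?_, List.pairwise_cons.2 ⟨fun L hL => ?_, ?_⟩⟩
      · rcases List.mem_cons.1 hL with rfl | hL
        · intro x hx y hy hxy
          exact hnc (Setoid.trans' _ (hb1.rel S.face_le_comp haM hx)
            (Setoid.trans' _ hxy (hb2.rel S.face_le_comp hy hsM)))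
        · exact fun x hx y hy hxy => k.1 L hL x (hm1 x hx) y hy (hle hxy)
      · exact fun x hx y hy hxy => k.1 L hL x (hm2 x hx) y hy (hle hxy)
      · exact k.2.imp fun {L L'} m x hx y hy hxy => m x hx y hy (hle hxy)
    · change numClasses (cyc S.next) + numClasses (cyc S.face) = numClasses (cyc T.opp) + _
      omega
    · intro d hd
      rw [hfaceS]
      exact h.swap_triangle ((hmem a).2 haS) ((hmem s).2 hsS) (fun k => hd ((hmem d).1 k))
    · intro d k
      refine h.loopless d ?_
      have hl : cyc S.next ≤ cyc T.next := by
        rw [← glue_cyc_swap_mul hcas', ← hf]; exact Setoid.le_glue _ _ _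
      exact hl k
  · intro h
    have k := List.pairwise_cons.1 h.separate
    have k' := List.pairwise_cons.1 k.2
    have hnc : ¬ S.comp a s := k.1 _ List.mem_cons_self a haM s hsM
    have hnv : ¬ cyc S.next a s := fun l => hnc (cyc_le_conn_left _ _ l)
    have hnf : ¬ cyc S.face a s := fun l => hnc (S.face_le_comp l)
    have hV := numClasses_swap_mul_of_not hnv
    have hF := numClasses_swap_mul_of_not hnf
    rw [← hfaceT] at hF
    have hcas : cyc T.next a s := cyc_swap_mul_of_not hnv
    have hnext : cyc T.next = (cyc S.next).glue a s := cyc_swap_mul_eq_glue hnv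
    have hlen : S.bdry.length = T.bdry.length + 1 := by simp [hS, hT]
    have hE := h.euler
    refine ⟨⟨h.opp_opp, h.opp_ne, ?_, ?_, ?_, hcyc.2 h.cyclic, hperm.nodup_iff.2 hnd, ?_, ?_⟩, hcas⟩
    · intro d
      obtain ⟨L, hL, x, hx, hxd⟩ := h.cover d
      have hxd' : T.comp x d := by rw [hcomp hcas]; exact Or.inl hxd
      rcases List.mem_cons.1 hL with rfl | hL
      · exact ⟨_, List.mem_cons_self, x, hm1 x hx, hxd'⟩
      rcases List.mem_cons.1 hL with rfl | hL
      · exact ⟨_, List.mem_cons_self, x, hm2 x hx, hxd'⟩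
      · exact ⟨L, List.mem_cons_of_mem _ hL, x, hx, hxd'⟩
    · have hsep : ∀ L ∈ ls, (∀ x ∈ r :: a :: A, ∀ y ∈ L, ¬ S.comp x y) ∧
          ∀ x ∈ s :: B, ∀ y ∈ L, ¬ S.comp x y := fun L hL =>
        ⟨k.1 L (List.mem_cons_of_mem _ hL), k'.1 L hL⟩
      refine List.pairwise_cons.2 ⟨fun L hL x hx y hy hxy => ?_,
        k'.2.imp_of_mem fun {L L'} hL hL' m x hx y hy hxy => ?_⟩
      · rw [hcomp hcas] at hxy
        rcases hxy with hxy | ⟨-, hxy⟩ | ⟨-, hxy⟩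
        · rcases hm3 x hx with hx | hx
          · exact (hsep L hL).1 x hx y hy hxy
          · exact (hsep L hL).2 x hx y hy hxy
        · exact (hsep L hL).2 s hsM y hy hxy
        · exact (hsep L hL).1 a haM y hy hxy
      · rw [hcomp hcas] at hxy
        rcases hxy with hxy | ⟨-, hxy⟩ | ⟨-, hxy⟩
        · exact m x hx y hy hxy
        · exact (hsep L' hL').2 s hsM y hy hxy
        · exact (hsep L' hL').1 a haM y hy hxy
    · change numClasses (cyc (Equiv.swap a s * S.next)) + numClasses (cyc T.face) =
        numClasses (cyc S.opp) + _
      omega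
    · intro d hd
      rw [hfaceT]
      exact h.swap_triangle haS hsS (fun k => hd ((hmem d).2 k))
    · intro d l
      change cyc T.next d (o d) at l
      have hd : S.comp d (o d) := cyc_le_conn_right _ _ (cyc_apply o d)
      rw [hnext] at l
      rcases l with l | ⟨l, l'⟩ | ⟨l, l'⟩
      · exact h.loopless d l
      · exact hnc (Setoid.trans' _ (Setoid.symm' _ (cyc_le_conn_left _ _ l))
          (Setoid.trans' _ hd (Setoid.symm' _ (cyc_le_conn_left _ _ l'))))
      · exact hnc (Setoid.trans' _ (cyc_le_conn_left _ _ l')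
          (Setoid.trans' _ (Setoid.symm' _ hd) (cyc_le_conn_left _ _ l)))

/-- Simplicity of the boundary before and after uniting the vertices of `a` and `s`: the dart `s`
is to be covered. -/
theorem merge_simpleOn_iff {P : List D} (hnot : ¬ cyc f a s) (ha : a ∈ P) (hs : s ∉ P) :
    SimpleOn (Equiv.swap a s * f) P ↔ SimpleOn f (s :: P) := by
  rw [simpleOn_iff, simpleOn_iff, List.nodup_cons, cyc_swap_mul_eq_glue hnot]
  constructor
  · rintro ⟨h1, h2⟩
    have h3 : ∀ y ∈ P, ¬ cyc f s y := by
      intro y hy hsy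
      have : a = y := h2 a ha y hy (Or.inr (Or.inl ⟨Setoid.refl' _ _, hsy⟩))
      exact hnot (this ▸ Setoid.symm' _ hsy)
    refine ⟨⟨hs, h1⟩, fun x hx y hy hxy => ?_⟩
    rcases List.mem_cons.1 hx with hx' | hx' <;> rcases List.mem_cons.1 hy with hy' | hy'
    · rw [hx', hy']
    · exact absurd (hx' ▸ hxy) (h3 y hy')
    · exact absurd (Setoid.symm' _ (hy' ▸ hxy)) (h3 x hx')
    · exact h2 x hx' y hy' (Or.inl hxy)
  · rintro ⟨h1, h2⟩
    have h3 : ∀ y ∈ P, ¬ cyc f s y := by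
      intro y hy hsy
      exact hs (h2 s List.mem_cons_self y (List.mem_cons_of_mem _ hy) hsy ▸ hy)
    refine ⟨h1.2, fun x hx y hy hxy => ?_⟩
    rcases hxy with hxy | ⟨-, hxy⟩ | ⟨hxy, -⟩
    · exact h2 x (List.mem_cons_of_mem _ hx) y (List.mem_cons_of_mem _ hy) hxy
    · exact absurd hxy (h3 y hy)
    · exact absurd (Setoid.symm' _ hxy) (h3 x hx)

theorem cycDeg_swap_of_not (hnot : ¬ cyc f a s) {x : D} (hxa : ¬ cyc f x a) (hxs : ¬ cyc f x s) :
    cycDeg (Equiv.swap a s * f) x = cycDeg f x := by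
  apply cycDeg_congr
  intro y
  rw [cyc_swap_mul_eq_glue hnot, Setoid.glue_iff]
  simp only [hxa, hxs, false_and, or_false]

theorem cycDeg_swap (hnot : ¬ cyc f a s) :
    cycDeg (Equiv.swap a s * f) a = cycDeg f a + cycDeg f s := by
  have h : ∀ y, cyc (Equiv.swap a s * f) a y ↔ cyc f a y ∨ cyc f s y := by
    intro y
    rw [cyc_swap_mul_eq_glue hnot, Setoid.glue_iff]
    simp only [hnot, false_and, or_false]
    exact or_congr_right ⟨fun h => h.2, fun h => ⟨Setoid.refl' _ _, h⟩⟩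
  classical
  rw [cycDeg, Nat.card_congr (Equiv.subtypeEquivRight h), cycDeg, cycDeg, ← Nat.card_sum]
  refine Nat.card_congr (subtypeOrEquiv _ _ ?_)
  rw [Pi.disjoint_iff]
  intro y
  rw [Prop.disjoint_iff]
  rintro ⟨h1, h2⟩
  exact hnot (Setoid.trans' _ h1 (Setoid.symm' _ h2))

theorem merge_innerOn_iff {P : List D} (hnot : ¬ cyc f a s) (ha : a ∈ P) :
    InnerOn (Equiv.swap a s * f) P ↔ InnerOn f (s :: P) := by
  refine forall_congr' fun x => ?_
  have h1 : (∃ b ∈ P, cyc (Equiv.swap a s * f) x b) ↔ ∃ b ∈ s :: P, cyc f x b := by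
    rw [cyc_swap_mul_eq_glue hnot, List.exists_mem_cons_iff]
    constructor
    · rintro ⟨b, hb, h | ⟨h, -⟩ | ⟨h, -⟩⟩
      · exact Or.inr ⟨b, hb, h⟩
      · exact Or.inr ⟨a, ha, h⟩
      · exact Or.inl h
    · rintro (h | ⟨b, hb, h⟩)
      · exact ⟨a, ha, Or.inr (Or.inr ⟨h, Setoid.refl' _ _⟩)⟩
      · exact ⟨b, hb, Or.inl h⟩
  rw [h1]
  by_cases h : ∃ b ∈ s :: P, cyc f x b
  · simp only [h, true_or]
  · have h' := h
    push Not at h'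
    rw [cycDeg_swap_of_not hnot (h' a (List.mem_cons_of_mem _ ha)) (h' s List.mem_cons_self)]

end Merge

theorem innerOn_congr {B B' : List D} (h : ∀ x, x ∈ B ↔ x ∈ B') : InnerOn f B ↔ InnerOn f B' := by
  simp only [InnerOn, h]

/-! ### Adding a single edge -/

/-- A new component that consists of a single edge. -/
def pushPatch (S : Patch D) : Patch (D ⊕ Bool) where
  next := Equiv.Perm.sumCongr S.next 1
  opp := flipEdge S.opp
  bdry := [Sum.inr true, Sum.inr false] :: S.bdry.map (List.map Sum.inl)

end Patch

namespace Patch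

variable {D : Type}

theorem pushPatch_rim (S : Patch D) : (pushPatch S).bdry.flatten =
    Sum.inr true :: Sum.inr false :: S.bdry.flatten.map Sum.inl := by
  simp [pushPatch, List.map_flatten]

theorem cyc_pushPatch (S : Patch D) :
    cyc (pushPatch S).next = (cyc S.next).sum (cyc 1) := cyc_sumCongr _ _

theorem comp_pushPatch (S : Patch D) :
    (pushPatch S).comp = S.comp.sum (conn 1 Equiv.boolNot) := conn_sumCongr _ _ _ _

theorem face_pushPatch (S : Patch D) :
    (pushPatch S).face = Equiv.Perm.sumCongr S.face Equiv.boolNot := by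
  change Equiv.Perm.sumCongr _ _ * Equiv.Perm.sumCongr _ _ = _
  rw [Equiv.Perm.sumCongr_mul, one_mul]; rfl

theorem cycDeg_pushPatch_inl [Finite D] (S : Patch D) (x : D) :
    cycDeg (pushPatch S).next (Sum.inl x) = cycDeg S.next x := by
  rw [cycDeg, cyc_pushPatch, Nat.card_congr Equiv.subtypeSum, Nat.card_sum]
  have : IsEmpty {b : Bool // ((cyc S.next).sum (cyc 1)) (Sum.inl x) (Sum.inr b)} := ⟨fun b => b.2⟩
  rw [Nat.card_of_isEmpty (α := {b : Bool // ((cyc S.next).sum (cyc 1)) (Sum.inl x) (Sum.inr b)}),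
    add_zero]
  rfl

theorem cycDeg_pushPatch_inr [Finite D] (S : Patch D) (b : Bool) :
    cycDeg (pushPatch S).next (Sum.inr b) = 1 := by
  rw [cycDeg, cyc_pushPatch, Nat.card_eq_one_iff_unique]
  refine ⟨⟨?_⟩, ⟨⟨Sum.inr b, Setoid.refl' _ _⟩⟩⟩
  have : ∀ v : {v // ((cyc S.next).sum (cyc 1)) (Sum.inr b) v}, v.1 = Sum.inr b := by
    rintro ⟨v | v, hv⟩
    · exact (hv : False).elim
    · exact congrArg Sum.inr (cyc_one.1 hv).symm
  exact fun v w => Subtype.ext ((this v).trans (this w).symm)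

theorem pushPatch_degs [Finite D] (S : Patch D) : (pushPatch S).degs = [1, 1] :: S.degs := by
  simp only [degs]
  change List.map _ ([Sum.inr true, Sum.inr false] :: S.bdry.map (List.map Sum.inl)) = _
  simp only [List.map_cons, List.map_nil, cycDeg_pushPatch_inr, List.map_map]
  congr 1
  refine List.map_congr_left fun L _ => ?_
  simp only [Function.comp, List.map_map]
  exact List.map_congr_left fun x _ => cycDeg_pushPatch_inl S x

/-- A single edge is a polygon with two vertices. -/
theorem pushPatch_good_iff [Finite D] (S : Patch D) : (pushPatch S).Good ↔ S.Good := by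
  set T := pushPatch S with hT
  have hTb : T.bdry = [Sum.inr true, Sum.inr false] :: S.bdry.map (List.map Sum.inl) := rfl
  have hrim : T.bdry.flatten = Sum.inr true :: Sum.inr false :: S.bdry.flatten.map Sum.inl :=
    pushPatch_rim S
  have hcy : cyc T.next = (cyc S.next).sum (cyc 1) := cyc_pushPatch S
  have hco : T.comp = S.comp.sum (conn 1 Equiv.boolNot) := comp_pushPatch S
  have hfa : T.face = Equiv.Perm.sumCongr S.face Equiv.boolNot := face_pushPatch S
  have hfl : ∀ y, T.face (Sum.inl y) = Sum.inl (S.face y) := by intro y; rw [hfa]; rfl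
  have hci : ∀ x y, T.comp (Sum.inl x) (Sum.inl y) ↔ S.comp x y := by
    intro x y; rw [hco]; exact Iff.rfl
  have hmem : ∀ x, Sum.inl x ∈ T.bdry.flatten ↔ x ∈ S.bdry.flatten := by
    intro x; rw [hrim]; simp
  have hV : numClasses (cyc T.next) = numClasses (cyc S.next) + 2 := by
    rw [hcy, numClasses_sum, numClasses_one_bool]
  have hF : numClasses (cyc T.face) = numClasses (cyc S.face) + 1 := by
    rw [hfa, cyc_sumCongr, numClasses_sum, numClasses_boolNot]
  have hE : numClasses (cyc T.opp) = numClasses (cyc S.opp) + 1 := by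
    change numClasses (cyc (Equiv.Perm.sumCongr S.opp Equiv.boolNot)) = _
    rw [cyc_sumCongr, numClasses_sum, numClasses_boolNot]
  have hlen : T.bdry.length = S.bdry.length + 1 := by simp [hTb]
  have hinl : ∀ f (L : List D), IsBoundary (Equiv.Perm.sumCongr f Equiv.boolNot) (L.map Sum.inl) ↔
      IsBoundary f L := by
    intro f L
    have key : ∀ (y z : D) (l : List D), Follows (Equiv.Perm.sumCongr f Equiv.boolNot) (Sum.inl y)
        (l.map Sum.inl) (Sum.inl z) ↔ Follows f y l z := by
      intro y z l
      induction l generalizing y with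
      | nil => exact Sum.inl_injective.eq_iff
      | cons b l ih =>
        rw [List.map_cons, Follows, Follows, ih]
        exact and_congr_left' Sum.inl_injective.eq_iff
    cases L with
    | nil => exact Iff.rfl
    | cons a l => exact key a a l
  constructor
  · intro h
    refine ⟨⟨?_, ?_, ?_, ?_, ?_, ?_, ?_, ?_, ?_⟩, ?_, ?_⟩
    · exact fun d => Sum.inl_injective (h.opp_opp (Sum.inl d))
    · exact fun d k => h.opp_ne (Sum.inl d) (congrArg Sum.inl k)
    · intro d
      obtain ⟨L, hL, u, hu, hud⟩ := h.cover (Sum.inl d)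
      rw [hTb] at hL
      rcases List.mem_cons.1 hL with rfl | hL
      · rw [hco] at hud
        simp only [List.mem_cons, List.not_mem_nil, or_false] at hu
        rcases hu with rfl | rfl <;> exact (hud : False).elim
      · obtain ⟨L, hL', rfl⟩ := List.mem_map.1 hL
        obtain ⟨y, hy, rfl⟩ := List.mem_map.1 hu
        exact ⟨L, hL', y, hy, (hci _ _).1 hud⟩
    · have k := (List.pairwise_map.1 (List.pairwise_cons.1 h.separate).2)
      exact k.imp fun {L L'} m x hx y hy hxy =>
        m _ (List.mem_map_of_mem hx) _ (List.mem_map_of_mem hy) ((hci _ _).2 hxy)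
    · have := h.euler; omega
    · intro L hL
      have := h.cyclic _ (List.mem_cons_of_mem _ (List.mem_map_of_mem hL))
      rwa [hfa, hinl] at this
    · have := h.nodup
      rw [hrim] at this
      exact (List.nodup_cons.1 (List.nodup_cons.1 this).2).2.of_map
    · intro d hd
      have := h.triangle (Sum.inl d) (fun k => hd ((hmem d).1 k))
      rw [hfl, hfl, hfl] at this
      exact Sum.inl_injective this
    · intro d k
      refine h.loopless (Sum.inl d) ?_
      rw [hcy]; exact k
    · have := h.simple
      rw [hrim, SimpleOn, hcy] at this
      exact List.pairwise_map.1 (List.pairwise_cons.1 (List.pairwise_cons.1 this).2).2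
    · intro x
      rcases h.inner (Sum.inl x) with ⟨b, hb, hxb⟩ | k
      · rw [hrim] at hb
        rw [hcy] at hxb
        simp only [List.mem_cons] at hb
        rcases hb with rfl | rfl | hb
        · exact (hxb : False).elim
        · exact (hxb : False).elim
        · obtain ⟨y, hy, rfl⟩ := List.mem_map.1 hb
          exact Or.inl ⟨y, hy, hxb⟩
      · rw [cycDeg_pushPatch_inl] at k
        exact Or.inr k
  · intro h
    have hconn : ∀ b c : Bool, T.comp (Sum.inr b) (Sum.inr c) := by
      intro b c
      rw [hco]
      exact cyc_le_conn_right _ _ (cyc_boolNot b c)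
    refine ⟨⟨?_, ?_, ?_, ?_, ?_, ?_, ?_, ?_, ?_⟩, ?_, ?_⟩
    · rintro (d | b)
      · exact congrArg Sum.inl (h.opp_opp d)
      · exact congrArg Sum.inr (Bool.not_not b)
    · rintro (d | b)
      · exact fun k => h.opp_ne d (Sum.inl_injective k)
      · exact fun k => by cases b <;> exact absurd (Sum.inr_injective k) (by simp)
    · rintro (d | b)
      · obtain ⟨L, hL, x, hx, hxd⟩ := h.cover d
        exact ⟨_, List.mem_cons_of_mem _ (List.mem_map_of_mem hL), _, List.mem_map_of_mem hx,
          (hci _ _).2 hxd⟩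
      · exact ⟨_, List.mem_cons_self, _, List.mem_cons_self, hconn _ _⟩
    · refine List.pairwise_cons.2 ⟨fun L hL u hu v hv huv => ?_, List.pairwise_map.2 ?_⟩
      · obtain ⟨L, hL', rfl⟩ := List.mem_map.1 hL
        obtain ⟨y, hy, rfl⟩ := List.mem_map.1 hv
        rw [hco] at huv
        simp only [List.mem_cons, List.not_mem_nil, or_false] at hu
        rcases hu with rfl | rfl <;> exact (huv : False).elim
      · refine h.separate.imp fun {L L'} m u hu v hv huv => ?_
        obtain ⟨x, hx, rfl⟩ := List.mem_map.1 hu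
        obtain ⟨y, hy, rfl⟩ := List.mem_map.1 hv
        exact m x hx y hy ((hci _ _).1 huv)
    · have := h.euler; omega
    · intro L hL
      rw [hTb] at hL
      rcases List.mem_cons.1 hL with rfl | hL
      · rw [hfa]; exact ⟨rfl, rfl⟩
      · obtain ⟨L, hL', rfl⟩ := List.mem_map.1 hL
        rw [hfa, hinl]
        exact h.cyclic L hL'
    · rw [hrim, List.nodup_cons, List.nodup_cons]
      exact ⟨by simp, by simp, h.nodup.map Sum.inl_injective⟩
    · rintro (d | b) hd
      · rw [hmem] at hd
        rw [hfl, hfl, hfl, h.triangle d hd]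
      · rw [hrim] at hd; cases b <;> simp at hd
    · rintro (d | b) k
      · rw [hcy] at k; exact h.loopless d k
      · rw [hcy] at k
        have k : cyc (1 : Equiv.Perm Bool) b (!b) := k
        rw [cyc_one] at k; cases b <;> simp at k
    · rw [hrim, SimpleOn, hcy]
      refine List.pairwise_cons.2 ⟨?_, List.pairwise_cons.2 ⟨?_, List.pairwise_map.2 h.simple⟩⟩
      · intro v hv k
        rcases List.mem_cons.1 hv with rfl | hv
        · exact absurd (cyc_one.1 k) (by simp)
        · obtain ⟨y, hy, rfl⟩ := List.mem_map.1 hv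
          exact k
      · intro v hv k
        obtain ⟨y, hy, rfl⟩ := List.mem_map.1 hv
        exact k
    · rintro (x | b)
      · rcases h.inner x with ⟨b, hb, hxb⟩ | k
        · refine Or.inl ⟨Sum.inl b, (hmem b).2 hb, ?_⟩
          rw [hcy]; exact hxb
        · rw [cycDeg_pushPatch_inl]; exact Or.inr k
      · refine Or.inl ⟨Sum.inr b, ?_, Setoid.refl' _ _⟩
        rw [hrim]; cases b <;> simp

/-! ### Building up polygons -/

variable {f o : Equiv.Perm D} {r x a s : D} {A B : List D} {ls : List (List D)}

/-- A boundary vertex of degree at least four may be covered by a triangle, because it becomes an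
inner vertex. -/
theorem Good.cap [Finite D] (h : (Patch.mk f o ((r :: x :: s :: A) :: ls)).Good)
    (hx : 4 ≤ cycDeg f x) : (capPatch f o r s A ls).Good ∧ (capPatch f o r s A ls).degs =
      ((cycDeg f r + 1) :: (cycDeg f s + 1) :: A.map (cycDeg f)) ::
        ls.map (List.map (cycDeg f)) := by
  have hrim : (Patch.mk f o ((r :: x :: s :: A) :: ls)).bdry.flatten =
    r :: x :: s :: (A ++ ls.flatten) := by simp
  have hnd := h.nodup
  have hsi := h.simple
  have hin := h.inner
  rw [hrim] at hnd hsi hin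
  have hc := h.cyclic _ List.mem_cons_self
  have hloop : ¬ cyc f r s := (List.pairwise_cons.1 hsi).1 s (by simp)
  have hrs : r ≠ s := fun k => hloop (k ▸ Setoid.refl' _ _)
  have hsi' : SimpleOn f (r :: s :: (A ++ ls.flatten)) :=
    hsi.sublist ((List.sublist_cons_self _ _).cons_cons _)
  refine ⟨⟨(capPatch_isTriangulated_iff hnd hc.1 hc.2.1).2 ⟨h.toIsTriangulated, hloop⟩,
    (capPatch_simpleOn_iff hrs).2 hsi', (capPatch_innerOn_iff hrs).2 fun y => ?_⟩,
    capPatch_degs hrs hloop hsi'⟩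
  rcases hin y with ⟨b, hb, hyb⟩ | k
  · rcases List.mem_cons.1 hb with rfl | hb
    · exact Or.inl ⟨b, List.mem_cons_self, hyb⟩
    rcases List.mem_cons.1 hb with rfl | hb
    · right
      rwa [cycDeg_eq_of_cyc hyb]
    · exact Or.inl ⟨b, List.mem_cons_of_mem _ hb, hyb⟩
  · exact Or.inr k

open scoped Classical in
/-- Two polygons may be glued at a vertex, which is then covered by a triangle on one side.  The
common vertex stays on the boundary, so that its degree is not restricted. -/
theorem Good.join [Finite D] (h : (Patch.mk f o ((r :: a :: A) :: (s :: x :: B) :: ls)).Good) :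
    (capPatch (Equiv.swap a s * f) o r x (B ++ a :: A) ls).Good ∧
    (capPatch (Equiv.swap a s * f) o r x (B ++ a :: A) ls).degs =
      ((cycDeg f r + 1) :: (cycDeg f x + 1) ::
        (B.map (cycDeg f) ++ (cycDeg f a + cycDeg f s) :: A.map (cycDeg f))) ::
        ls.map (List.map (cycDeg f)) := by
  set P := r :: x :: ((B ++ a :: A) ++ ls.flatten) with hP
  have hrim : ((r :: a :: A) :: (s :: x :: B) :: ls).flatten =
    r :: a :: (A ++ s :: x :: (B ++ ls.flatten)) := by simp
  have hperm : ((r :: a :: A) :: (s :: x :: B) :: ls).flatten.Perm (s :: P) := by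
    have := (List.perm_append_comm (l₁ := r :: a :: A) (l₂ := s :: x :: B)).append_right ls.flatten
    have h2 := (List.perm_middle (a := r) (l₁ := x :: B) (l₂ := a :: A ++ ls.flatten)).cons s
    have h3 : (s :: P) = s :: r :: (x :: B ++ (a :: A ++ ls.flatten)) := by simp [hP]
    rw [h3]
    refine List.Perm.trans ?_ h2
    refine List.Perm.trans ?_ (this.trans (List.Perm.of_eq (by simp)))
    simp
  have hnd := h.nodup
  have hc := h.cyclic _ List.mem_cons_self
  have hc2 := h.cyclic _ (List.mem_cons_of_mem _ List.mem_cons_self)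
  have hsi := h.simple
  have hmrg := (merge_isTriangulated_iff (f := f) (o := o) hc.1 hnd).2 h.toIsTriangulated
  have hnot : ¬ cyc f a s := by
    intro k
    exact (List.pairwise_cons.1 h.separate).1 _ List.mem_cons_self a (by simp) s (by simp)
      (cyc_le_conn_left _ _ k)
  have hsi' : SimpleOn f (s :: P) := by
    rw [simpleOn_iff] at hsi ⊢
    refine ⟨hperm.nodup_iff.1 hsi.1, fun y hy z hz => hsi.2 y (hperm.mem_iff.2 hy) z
      (hperm.mem_iff.2 hz)⟩
  have haP : a ∈ P := by rw [hP]; simp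
  have hsP : s ∉ P := (List.nodup_cons.1 (simpleOn_iff.1 hsi').1).1
  have hsi2 := (merge_simpleOn_iff hnot haP hsP).2 hsi'
  have hloop : ¬ cyc (Equiv.swap a s * f) r x := (List.pairwise_cons.1 hsi2).1 x (by simp)
  have hrx : r ≠ x := fun k => hloop (k ▸ Setoid.refl' _ _)
  have hc1 := hmrg.1.cyclic _ List.mem_cons_self
  have hnd1 := hmrg.1.nodup
  refine ⟨⟨(capPatch_isTriangulated_iff (x := s) (by simpa using hnd1) hc1.1 hc1.2.1).2
    ⟨hmrg.1, hloop⟩, (capPatch_simpleOn_iff hrx).2 hsi2, (capPatch_innerOn_iff hrx).2 ?_⟩, ?_⟩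
  · refine (merge_innerOn_iff hnot haP).2 ((innerOn_congr fun y => ?_).1 h.inner)
    exact hperm.mem_iff
  · have hne := simpleOn_iff.1 hsi'
    have key : ∀ y ∈ P, y ≠ a → cycDeg (Equiv.swap a s * f) y = cycDeg f y := by
      intro y hy hya
      refine cycDeg_swap_of_not hnot (fun k => hya (hne.2 y (List.mem_cons_of_mem _ hy) a
        (List.mem_cons_of_mem _ haP) k)) (fun k => hsP ?_)
      rwa [← hne.2 y (List.mem_cons_of_mem _ hy) s List.mem_cons_self k]
    have hndP := (List.nodup_cons.1 hne.1).2
    have hmid : (a :: (r :: x :: (B ++ (A ++ ls.flatten)))).Nodup := by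
      refine (List.Perm.nodup_iff ?_).1 hndP
      have := List.perm_middle (a := a) (l₁ := r :: x :: B) (l₂ := A ++ ls.flatten)
      simpa [hP] using this
    have ha' := (List.nodup_cons.1 hmid).1
    have hl : ∀ l : List D, (∀ y ∈ l, y ∈ r :: x :: (B ++ (A ++ ls.flatten))) →
        l.map (cycDeg (Equiv.swap a s * f)) = l.map (cycDeg f) := by
      intro l hl
      refine List.map_congr_left fun y hy => key y ?_ fun k => ha' (k ▸ hl y hy)
      have := hl y hy
      rw [hP]
      simp only [List.mem_cons, List.mem_append] at this ⊢
      tauto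
    rw [capPatch_degs hrx hloop hsi2]
    have e1 := hl [r] (by simp)
    have e2 := hl [x] (by simp)
    have e3 := hl B (fun y hy => by simp [hy])
    have e4 := hl A (fun y hy => by simp [hy])
    simp only [List.map_cons, List.map_nil, List.cons.injEq, and_true] at e1 e2
    rw [List.map_append, List.map_cons, e1, e2, e3, e4, cycDeg_swap hnot]
    congr 1
    refine List.map_congr_left fun L hL => hl L fun y hy => ?_
    simp only [List.mem_cons, List.mem_append]
    exact Or.inr (Or.inr (Or.inr (Or.inr (List.mem_flatten.2 ⟨L, hL, hy⟩))))

end Patch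

/-! ### Isomorphisms -/

theorem cyc_eq_comap {D D' : Type} {f : Equiv.Perm D} {g : Equiv.Perm D'} (e : D ≃ D')
    (h : ∀ d, e (f d) = g (e d)) : cyc f = (cyc g).comap e := by
  apply le_antisymm
  · refine cyc_le_iff.2 fun x => ?_
    change cyc g (e x) (e (f x))
    rw [h]; exact cyc_apply g _
  · have : cyc g ≤ (cyc f).comap e.symm := cyc_le_iff.2 fun x => by
      change cyc f (e.symm x) (e.symm (g x))
      have := h (e.symm x)
      rw [Equiv.apply_symm_apply] at this
      rw [← this, Equiv.symm_apply_apply]; exact cyc_apply f _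
    intro x y hxy
    have := this hxy
    change cyc f (e.symm (e x)) (e.symm (e y)) at this
    simpa using this

theorem conn_eq_comap {D D' : Type} {f o : Equiv.Perm D} {g o' : Equiv.Perm D'} (e : D ≃ D')
    (h : ∀ d, e (f d) = g (e d)) (h' : ∀ d, e (o d) = o' (e d)) :
    conn f o = (conn g o').comap e := by
  apply le_antisymm
  · refine conn_le_iff.2 ⟨fun x => ?_, fun x => ?_⟩
    · change conn g o' (e x) (e (f x))
      rw [h]; exact cyc_le_conn_left _ _ (cyc_apply g _)
    · change conn g o' (e x) (e (o x))
      rw [h']; exact cyc_le_conn_right _ _ (cyc_apply o' _)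
  · have : conn g o' ≤ (conn f o).comap e.symm := by
      refine conn_le_iff.2 ⟨fun x => ?_, fun x => ?_⟩
      · change conn f o (e.symm x) (e.symm (g x))
        have := h (e.symm x)
        rw [Equiv.apply_symm_apply] at this
        rw [← this, Equiv.symm_apply_apply]; exact cyc_le_conn_left _ _ (cyc_apply f _)
      · change conn f o (e.symm x) (e.symm (o' x))
        have := h' (e.symm x)
        rw [Equiv.apply_symm_apply] at this
        rw [← this, Equiv.symm_apply_apply]; exact cyc_le_conn_right _ _ (cyc_apply o _)
    intro x y hxy
    have := this hxy
    change conn f o (e.symm (e x)) (e.symm (e y)) at this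
    simpa using this

theorem cycDeg_eq_of_equiv {D D' : Type} {f : Equiv.Perm D} {g : Equiv.Perm D'} (e : D ≃ D')
    (h : ∀ d, e (f d) = g (e d)) (d : D) : cycDeg g (e d) = cycDeg f d := by
  refine (Nat.card_congr (e.subtypeEquiv fun x => ?_)).symm
  rw [cyc_eq_comap e h]; exact Iff.rfl

namespace Patch

variable {D D' D'' : Type}

/-- The relabelling `e` of the darts carries `S` to `S'`. -/
structure IsIso (e : D ≃ D') (S : Patch D) (S' : Patch D') : Prop where
  next : ∀ d, e (S.next d) = S'.next (e d)
  opp : ∀ d, e (S.opp d) = S'.opp (e d)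
  bdry : S'.bdry = S.bdry.map (List.map e)

/-- Two patches are the same up to a relabelling of the darts. -/
def Iso (S : Patch D) (S' : Patch D') : Prop := ∃ e : D ≃ D', IsIso e S S'

theorem Iso.symm {S : Patch D} {S' : Patch D'} (h : Iso S S') : Iso S' S := by
  obtain ⟨e, h1, h2, h3⟩ := h
  refine ⟨e.symm, fun d => ?_, fun d => ?_, ?_⟩
  · rw [Equiv.symm_apply_eq, h1, Equiv.apply_symm_apply]
  · rw [Equiv.symm_apply_eq, h2, Equiv.apply_symm_apply]
  · rw [h3, List.map_map]
    have : (List.map e.symm ∘ List.map e : List D → List D) = id := by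
      funext l; simp
    rw [this, List.map_id]

theorem Iso.trans {S : Patch D} {S' : Patch D'} {S'' : Patch D''} (h : Iso S S')
    (k : Iso S' S'') : Iso S S'' := by
  obtain ⟨e, h1, h2, h3⟩ := h
  obtain ⟨e', k1, k2, k3⟩ := k
  refine ⟨e.trans e', fun d => ?_, fun d => ?_, ?_⟩
  · simp [h1, k1]
  · simp [h2, k2]
  · rw [k3, h3, List.map_map]
    congr 1
    funext l; simp

section

variable {S : Patch D} {S' : Patch D'} {e : D ≃ D'}

theorem IsIso.face (h : IsIso e S S') (d : D) : e (S.face d) = S'.face (e d) := by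
  rw [face_apply, face_apply, h.next, h.opp]

theorem IsIso.cyc_iff (h : IsIso e S S') {x y : D} :
    cyc S'.next (e x) (e y) ↔ cyc S.next x y := by
  rw [cyc_eq_comap e h.next]; exact Iff.rfl

theorem IsIso.comp_iff (h : IsIso e S S') {x y : D} : S'.comp (e x) (e y) ↔ S.comp x y := by
  change conn _ _ _ _ ↔ conn _ _ _ _
  rw [conn_eq_comap e h.next h.opp]; exact Iff.rfl

theorem IsIso.rim (h : IsIso e S S') : S'.bdry.flatten = S.bdry.flatten.map e := by
  rw [h.bdry, List.map_flatten]

theorem Iso.degs (h : Iso S S') : S'.degs = S.degs := by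
  obtain ⟨e, h⟩ := h
  rw [Patch.degs, Patch.degs, h.bdry, List.map_map]
  refine List.map_congr_left fun L _ => ?_
  rw [Function.comp, List.map_map]
  exact List.map_congr_left fun x _ => cycDeg_eq_of_equiv e h.next x

theorem Good.of_isIso (hS : S.Good) (h : IsIso e S S') : S'.Good := by
  have hrim := h.rim
  have hmem : ∀ x, e x ∈ S'.bdry.flatten ↔ x ∈ S.bdry.flatten := by
    intro x; rw [hrim, List.mem_map_of_injective e.injective]
  refine ⟨⟨?_, ?_, ?_, ?_, ?_, ?_, ?_, ?_, ?_⟩, ?_, ?_⟩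
  · exact e.surjective.forall.2 fun d => by rw [← h.opp, ← h.opp, hS.opp_opp]
  · exact e.surjective.forall.2 fun d k => by
      rw [← h.opp] at k; exact hS.opp_ne d (e.injective k)
  · refine e.surjective.forall.2 fun d => ?_
    obtain ⟨L, hL, x, hx, hxd⟩ := hS.cover d
    refine ⟨L.map e, ?_, e x, List.mem_map_of_mem hx, h.comp_iff.2 hxd⟩
    rw [h.bdry]; exact List.mem_map_of_mem hL
  · rw [h.bdry, List.pairwise_map]
    refine hS.separate.imp fun {L L'} m u hu v hv huv => ?_
    obtain ⟨x, hx, rfl⟩ := List.mem_map.1 hu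
    obtain ⟨y, hy, rfl⟩ := List.mem_map.1 hv
    exact m x hx y hy (h.comp_iff.1 huv)
  · have := hS.euler
    rw [cyc_eq_comap e h.next, cyc_eq_comap e h.face, cyc_eq_comap e h.opp,
      numClasses_comap _ e.surjective, numClasses_comap _ e.surjective,
      numClasses_comap _ e.surjective] at this
    rw [this, h.bdry, List.length_map]
  · intro L hL
    rw [h.bdry] at hL
    obtain ⟨L, hL', rfl⟩ := List.mem_map.1 hL
    exact (hS.cyclic L hL').map e fun y _ => (h.face y).symm
  · rw [hrim]; exact hS.nodup.map e.injective
  · refine e.surjective.forall.2 fun d hd => ?_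
    rw [hmem] at hd
    rw [← h.face, ← h.face, ← h.face, hS.triangle d hd]
  · refine e.surjective.forall.2 fun d k => ?_
    rw [← h.opp, h.cyc_iff] at k
    exact hS.loopless d k
  · rw [hrim, SimpleOn, List.pairwise_map]
    exact hS.simple.imp fun {x y} m k => m (h.cyc_iff.1 k)
  · refine e.surjective.forall.2 fun x => ?_
    rcases hS.inner x with ⟨b, hb, hxb⟩ | k
    · exact Or.inl ⟨e b, (hmem b).2 hb, h.cyc_iff.2 hxb⟩
    · exact Or.inr (by rwa [cycDeg_eq_of_equiv e h.next])

end

/-- The relabelling of a patch. -/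
def relabel (e : D ≃ D') (S : Patch D) : Patch D' where
  next := e.permCongr S.next
  opp := e.permCongr S.opp
  bdry := S.bdry.map (List.map e)

theorem isIso_relabel (e : D ≃ D') (S : Patch D) : IsIso e S (S.relabel e) :=
  ⟨fun d => by simp [relabel], fun d => by simp [relabel], rfl⟩

theorem Iso.push {S : Patch D} {S' : Patch D'} (h : Iso S S') :
    Iso (pushPatch S) (pushPatch S') := by
  obtain ⟨e, h⟩ := h
  refine ⟨Equiv.sumCongr e (Equiv.refl Bool), ?_, ?_, ?_⟩
  · rintro (d | b)
    · exact congrArg Sum.inl (h.next d)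
    · rfl
  · rintro (d | b)
    · exact congrArg Sum.inl (h.opp d)
    · rfl
  · simp [pushPatch, h.bdry]

theorem insertEdge_conj (e : D ≃ D') {f : Equiv.Perm D} {f' : Equiv.Perm D'}
    (h : ∀ d, e (f d) = f' (e d)) {r s : D} (hrs : r ≠ s) (u : D ⊕ Bool) :
    Equiv.sumCongr e (Equiv.refl Bool) (insertEdge f r s u) =
      insertEdge f' (e r) (e s) (Equiv.sumCongr e (Equiv.refl Bool) u) := by
  have hrs' : e r ≠ e s := e.injective.ne hrs
  rcases u with x | _ | _
  · change _ = insertEdge f' (e r) (e s) (Sum.inl (e x))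
    by_cases hr : f x = r
    · rw [insertEdge_inl_left hrs hr, insertEdge_inl_left hrs' (by rw [← h, hr])]; rfl
    by_cases hs : f x = s
    · rw [insertEdge_inl_right hs, insertEdge_inl_right (by rw [← h, hs])]; rfl
    · rw [insertEdge_inl hr hs, insertEdge_inl (by rw [← h]; exact e.injective.ne hr)
        (by rw [← h]; exact e.injective.ne hs), ← h]; rfl
  · change _ = insertEdge f' (e r) (e s) (Sum.inr false)
    rw [insertEdge_false hrs, insertEdge_false hrs']; rfl
  · change _ = insertEdge f' (e r) (e s) (Sum.inr true)
    rw [insertEdge_true, insertEdge_true]; rfl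

theorem isIso_capPatch (e : D ≃ D') {f o : Equiv.Perm D} {f' o' : Equiv.Perm D'}
    (h : ∀ d, e (f d) = f' (e d)) (h' : ∀ d, e (o d) = o' (e d)) {r s : D} (hrs : r ≠ s)
    (A : List D) (ls : List (List D)) :
    Iso (capPatch f o r s A ls)
      (capPatch f' o' (e r) (e s) (A.map e) (ls.map (List.map e))) := by
  refine ⟨Equiv.sumCongr e (Equiv.refl Bool), insertEdge_conj e h hrs, ?_, ?_⟩
  · rintro (d | b)
    · exact congrArg Sum.inl (h' d)
    · rfl
  · simp [capPatch]

theorem isIso_swap [DecidableEq D] [DecidableEq D'] (e : D ≃ D') {f : Equiv.Perm D}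
    {f' : Equiv.Perm D'} (h : ∀ d, e (f d) = f' (e d)) (a s d : D) :
    e ((Equiv.swap a s * f) d) = (Equiv.swap (e a) (e s) * f') (e d) := by
  rw [Equiv.Perm.mul_apply, Equiv.Perm.mul_apply, ← h, Equiv.swap_apply_def, Equiv.swap_apply_def]
  simp only [e.injective.eq_iff]
  split_ifs <;> rfl

/-- Covering the second vertex of the first boundary cycle.  If there are fewer than three vertices,
a single edge is added instead; this case does not occur for good trees. -/
noncomputable def capTop (T : Patch D) : Patch (D ⊕ Bool) :=
  match T.bdry with
  | (r :: _ :: s :: A) :: ls => capPatch T.next T.opp r s A ls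
  | _ => pushPatch T

open scoped Classical in
/-- Gluing the first two components at a vertex of their boundaries: the end of the first root dart
is united with the origin of the second one.  Without two such components nothing changes. -/
noncomputable def mergeTop (T : Patch D) : Patch D :=
  match T.bdry with
  | (r :: a :: A) :: (s :: B) :: ls =>
    ⟨Equiv.swap a s * T.next, T.opp, (r :: s :: (B ++ a :: A)) :: ls⟩
  | _ => T

theorem Iso.mergeTop {S : Patch D} {S' : Patch D'} (h : Iso S S') :
    Iso S.mergeTop S'.mergeTop := by
  classical
  obtain ⟨f, o, b⟩ := S
  obtain ⟨f', o', b'⟩ := S'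
  obtain ⟨e, h1, h2, h3⟩ := h
  dsimp only at h1 h2 h3
  subst h3
  match b with
  | (r :: a :: A) :: (s :: B) :: ls =>
    refine ⟨e, isIso_swap e h1 a s, h2, ?_⟩
    simp [Patch.mergeTop]
  | [] => exact ⟨e, h1, h2, rfl⟩
  | [] :: _ => exact ⟨e, h1, h2, rfl⟩
  | [_] :: _ => exact ⟨e, h1, h2, rfl⟩
  | (_ :: _ :: _) :: [] => exact ⟨e, h1, h2, rfl⟩
  | (_ :: _ :: _) :: [] :: _ => exact ⟨e, h1, h2, rfl⟩

theorem Iso.capTop {S : Patch D} {S' : Patch D'} (h : Iso S S') (hnd : S.bdry.flatten.Nodup) :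
    Iso S.capTop S'.capTop := by
  obtain ⟨f, o, b⟩ := S
  obtain ⟨f', o', b'⟩ := S'
  have h' := h
  obtain ⟨e, h1, h2, h3⟩ := h
  dsimp only at h1 h2 h3
  subst h3
  match b with
  | (r :: x :: s :: A) :: ls =>
    refine isIso_capPatch e h1 h2 ?_ A ls
    rintro rfl
    simp at hnd
  | [] => exact h'.push
  | [] :: _ => exact h'.push
  | [_] :: _ => exact h'.push
  | [_, _] :: _ => exact h'.push

/-- The shape of a patch is read off its degrees. -/
theorem exists_eq_of_degs_cap {T : Patch D} {d₀ d₁ d₂ : ℕ} {ds : List ℕ} {dl : List (List ℕ)}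
    (h : T.degs = (d₀ :: d₁ :: d₂ :: ds) :: dl) :
    ∃ f o r x s A ls, T = ⟨f, o, (r :: x :: s :: A) :: ls⟩ ∧ d₀ = cycDeg f r ∧ d₁ = cycDeg f x ∧
      d₂ = cycDeg f s ∧ ds = A.map (cycDeg f) ∧ dl = ls.map (List.map (cycDeg f)) := by
  obtain ⟨f, o, b⟩ := T
  obtain ⟨L, ls, rfl, hL, rfl⟩ := List.map_eq_cons_iff.1 h
  obtain ⟨r, L₁, rfl, rfl, hL₁⟩ := List.map_eq_cons_iff.1 hL
  obtain ⟨x, L₂, rfl, rfl, hL₂⟩ := List.map_eq_cons_iff.1 hL₁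
  obtain ⟨s, A, rfl, rfl, rfl⟩ := List.map_eq_cons_iff.1 hL₂
  exact ⟨f, o, r, x, s, A, ls, rfl, rfl, rfl, rfl, rfl, rfl⟩

theorem exists_eq_of_degs_join {T : Patch D} {d₀ d₁ e₀ e₁ : ℕ} {ds es : List ℕ}
    {dl : List (List ℕ)} (h : T.degs = (d₀ :: d₁ :: ds) :: (e₀ :: e₁ :: es) :: dl) :
    ∃ f o r a A s x B ls, T = ⟨f, o, (r :: a :: A) :: (s :: x :: B) :: ls⟩ ∧
      d₀ = cycDeg f r ∧ d₁ = cycDeg f a ∧ ds = A.map (cycDeg f) ∧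
      e₀ = cycDeg f s ∧ e₁ = cycDeg f x ∧ es = B.map (cycDeg f) ∧
      dl = ls.map (List.map (cycDeg f)) := by
  obtain ⟨f, o, b⟩ := T
  obtain ⟨L, ls₁, rfl, hL, hls₁⟩ := List.map_eq_cons_iff.1 h
  obtain ⟨L', ls, rfl, hL', rfl⟩ := List.map_eq_cons_iff.1 hls₁
  obtain ⟨r, L₁, rfl, rfl, hL₁⟩ := List.map_eq_cons_iff.1 hL
  obtain ⟨a, A, rfl, rfl, rfl⟩ := List.map_eq_cons_iff.1 hL₁
  obtain ⟨s, L₂, rfl, rfl, hL₂⟩ := List.map_eq_cons_iff.1 hL'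
  obtain ⟨x, B, rfl, rfl, rfl⟩ := List.map_eq_cons_iff.1 hL₂
  exact ⟨f, o, r, a, A, s, x, B, ls, rfl, rfl, rfl, rfl, rfl, rfl, rfl, rfl⟩

end Patch

/-! ### Construction trees -/

/-- The ways to build up a triangulated polygon: a single edge; covering a boundary vertex of a
polygon by a triangle; gluing two polygons at a vertex and covering this vertex by a triangle. -/
inductive PolygonTree
  | edge
  | cap (t : PolygonTree)
  | join (t u : PolygonTree)

namespace PolygonTree

/-- The degrees of the boundary vertices, in cyclic order, starting with the origin and the end of
the root edge. -/
def deg : PolygonTree → List ℕ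
  | edge => [1, 1]
  | cap t => match t.deg with
    | d₀ :: _ :: d₂ :: ds => (d₀ + 1) :: (d₂ + 1) :: ds
    | _ => []
  | join t u => match t.deg, u.deg with
    | d₀ :: d₁ :: ds, e₀ :: e₁ :: es => (d₀ + 1) :: (e₁ + 1) :: (es ++ (d₁ + e₀) :: ds)
    | _, _ => []

/-- Every covered vertex has degree at least 4 and is a vertex of a polygon that has at least
three vertices. -/
def Good : PolygonTree → Prop
  | edge => True
  | cap t => t.Good ∧ ∃ d₀ d₁ d₂ ds, t.deg = d₀ :: d₁ :: d₂ :: ds ∧ 4 ≤ d₁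
  | join t u => t.Good ∧ u.Good

/-- The number of triangles. -/
def size : PolygonTree → ℕ
  | edge => 0
  | cap t => t.size + 1
  | join t u => t.size + u.size + 1

/-- The darts of the polygon, together with those of a given set. -/
def darts : PolygonTree → Type → Type
  | edge, D => D ⊕ Bool
  | cap t, D => t.darts D ⊕ Bool
  | join t u, D => t.darts (u.darts D) ⊕ Bool

instance finite_darts (t : PolygonTree) (D : Type) [h : Finite D] : Finite (t.darts D) := by
  induction t generalizing D with
  | edge => exact inferInstanceAs (Finite (D ⊕ Bool))
  | cap t ih => have := ih D; exact inferInstanceAs (Finite (t.darts D ⊕ Bool))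
  | join t u ih ih' =>
    have := ih' D
    have := ih (u.darts D)
    exact inferInstanceAs (Finite (t.darts (u.darts D) ⊕ Bool))

/-- The polygon described by a tree, as a new first component. -/
noncomputable def add : (t : PolygonTree) → {D : Type} → Patch D → Patch (t.darts D)
  | edge, _, S => Patch.pushPatch S
  | cap t, _, S => (t.add S).capTop
  | join t u, _, S => (t.add (u.add S)).mergeTop.capTop

theorem Good.exists_deg {t : PolygonTree} (h : t.Good) : ∃ d₀ d₁ ds, t.deg = d₀ :: d₁ :: ds := by
  induction t with
  | edge => exact ⟨1, 1, [], rfl⟩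
  | cap t ih =>
    obtain ⟨-, d₀, d₁, d₂, ds, hd, -⟩ := h
    exact ⟨d₀ + 1, d₂ + 1, ds, by simp [deg, hd]⟩
  | join t u ih ih' =>
    obtain ⟨d₀, d₁, ds, hd⟩ := ih h.1
    obtain ⟨e₀, e₁, es, he⟩ := ih' h.2
    exact ⟨d₀ + 1, e₁ + 1, es ++ (d₁ + e₀) :: ds, by simp [deg, hd, he]⟩

theorem deg_cap {t : PolygonTree} {d₀ d₁ d₂ : ℕ} {ds : List ℕ}
    (h : t.deg = d₀ :: d₁ :: d₂ :: ds) : (cap t).deg = (d₀ + 1) :: (d₂ + 1) :: ds := by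
  simp [deg, h]

theorem deg_join {t u : PolygonTree} {d₀ d₁ e₀ e₁ : ℕ} {ds es : List ℕ}
    (h : t.deg = d₀ :: d₁ :: ds) (h' : u.deg = e₀ :: e₁ :: es) :
    (join t u).deg = (d₀ + 1) :: (e₁ + 1) :: (es ++ (d₁ + e₀) :: ds) := by
  simp [deg, h, h']

/-- A good tree describes a triangulated polygon with the degrees that are read off the tree. -/
theorem add_good {t : PolygonTree} (ht : t.Good) {D : Type} [Finite D] {S : Patch D}
    (hS : S.Good) : (t.add S).Good ∧ (t.add S).degs = t.deg :: S.degs := by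
  induction t generalizing D with
  | edge => exact ⟨(Patch.pushPatch_good_iff S).2 hS, Patch.pushPatch_degs S⟩
  | cap t ih =>
    obtain ⟨ht, d₀, d₁, d₂, ds, hd, h4⟩ := ht
    obtain ⟨h1, h2⟩ := ih ht hS
    rw [deg_cap hd]
    rw [hd] at h2
    obtain ⟨f, o, r, x, s, A, ls, hT, rfl, rfl, rfl, rfl, hls⟩ := Patch.exists_eq_of_degs_cap h2
    change (t.add S).capTop.Good ∧ (t.add S).capTop.degs = _
    rw [hT] at h1 ⊢
    rw [hls]
    exact h1.cap h4
  | join t u ih ih' =>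
    obtain ⟨k1, k2⟩ := ih' ht.2 hS
    obtain ⟨h1, h2⟩ := ih ht.1 k1
    obtain ⟨d₀, d₁, ds, hd⟩ := ht.1.exists_deg
    obtain ⟨e₀, e₁, es, he⟩ := ht.2.exists_deg
    rw [deg_join hd he]
    rw [hd, k2, he] at h2
    obtain ⟨f, o, r, a, A, s, x, B, ls, hT, rfl, rfl, rfl, rfl, rfl, rfl, hls⟩ :=
      Patch.exists_eq_of_degs_join h2
    change (t.add (u.add S)).mergeTop.capTop.Good ∧ (t.add (u.add S)).mergeTop.capTop.degs = _
    rw [hT] at h1 ⊢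
    rw [hls]
    exact h1.join

end PolygonTree

/-! ### Uniqueness of construction trees -/

theorem exists_eq_sumCongr {D D' : Type} (e : D ⊕ Bool ≃ D' ⊕ Bool) (h : Bool ≃ Bool)
    (he : ∀ b, e (Sum.inr b) = Sum.inr (h b)) : ∃ e₀ : D ≃ D', e = Equiv.sumCongr e₀ h := by
  have h1 : ∀ x, ∃ y, e (Sum.inl x) = Sum.inl y := by
    intro x
    rcases hx : e (Sum.inl x) with y | b
    · exact ⟨y, rfl⟩
    · have := he (h.symm b)
      rw [h.apply_symm_apply, ← hx] at this
      exact absurd (e.injective this) (by simp)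
  have h2 : ∀ y, ∃ x, e.symm (Sum.inl y) = Sum.inl x := by
    intro y
    rcases hy : e.symm (Sum.inl y) with x | b
    · exact ⟨x, rfl⟩
    · rw [Equiv.symm_apply_eq, he] at hy
      exact absurd hy (by simp)
  choose g hg using h1
  choose g' hg' using h2
  refine ⟨⟨g, g', fun x => ?_, fun y => ?_⟩, ?_⟩
  · apply Sum.inl_injective (β := Bool)
    rw [← hg', ← hg, e.symm_apply_apply]
  · apply Sum.inl_injective (β := Bool)
    rw [← hg, ← hg', e.apply_symm_apply]
  · ext1 u
    rcases u with x | b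
    · exact hg x
    · exact he b

theorem append_cons_inj_of_notMem {α : Type} {a : α} {B A B' A' : List α}
    (h : B ++ a :: A = B' ++ a :: A') (hB : a ∉ B) (hB' : a ∉ B') : B = B' ∧ A = A' := by
  induction B generalizing B' with
  | nil =>
    cases B' with
    | nil => simpa using h
    | cons b B' =>
      simp only [List.nil_append, List.cons_append, List.cons.injEq] at h
      exact absurd h.1 (by simp at hB'; exact hB'.1)
  | cons b B ih =>
    cases B' with
    | nil =>
      simp only [List.nil_append, List.cons_append, List.cons.injEq] at h
      exact absurd h.1.symm (by simp at hB; exact hB.1)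
    | cons b' B' =>
      simp only [List.cons_append, List.cons.injEq] at h
      simp only [List.mem_cons, not_or] at hB hB'
      obtain ⟨rfl, rfl⟩ := ih h.2 hB.2 hB'.2
      exact ⟨by rw [h.1], rfl⟩

namespace Patch

variable {D D' : Type}

theorem Iso.of_push {S : Patch D} {S' : Patch D'} (h : Iso (pushPatch S) (pushPatch S')) :
    Iso S S' := by
  obtain ⟨e, h1, h2, h3⟩ := h
  simp only [pushPatch, List.map_cons, List.map_nil, List.cons.injEq, and_true] at h3
  obtain ⟨e, rfl⟩ := exists_eq_sumCongr e (Equiv.refl Bool) (by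
    rintro (_ | _)
    · exact h3.1.2.symm
    · exact h3.1.1.symm)
  refine ⟨e, fun d => Sum.inl_injective (h1 (Sum.inl d)), fun d => Sum.inl_injective (h2 (Sum.inl d)),
    ?_⟩
  have h4 := h3.2
  rw [List.map_map] at h4
  have h5 : List.map (Equiv.sumCongr e (Equiv.refl Bool)) ∘ List.map Sum.inl =
      (List.map Sum.inl ∘ List.map e : List D → List (D' ⊕ Bool)) := by
    funext l; simp
  rw [h5, ← List.map_map] at h4
  exact (List.map_injective_iff.2 (List.map_injective_iff.2 Sum.inl_injective)) h4

/-- The smaller rotation system can be recovered after a covering, because the new edge is the root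
edge. -/
theorem exists_equiv_of_capPatch {f o : Equiv.Perm D} {f' o' : Equiv.Perm D'} {r s : D} {r' s' : D'}
    {A : List D} {A' : List D'} {ls : List (List D)} {ls' : List (List D')} (hrs : r ≠ s)
    (hrs' : r' ≠ s') (h : Iso (capPatch f o r s A ls) (capPatch f' o' r' s' A' ls')) :
    ∃ e : D ≃ D', (∀ d, e (f d) = f' (e d)) ∧ (∀ d, e (o d) = o' (e d)) ∧ e r = r' ∧ e s = s' ∧
      A' = A.map e ∧ ls' = ls.map (List.map e) := by
  obtain ⟨e, h⟩ := h
  have h3 := h.bdry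
  simp only [capPatch, List.map_cons, List.cons.injEq] at h3
  obtain ⟨⟨ht, hs, hA⟩, hls⟩ := h3
  have hf : e (Sum.inr false) = Sum.inr false := by
    have := h.opp (Sum.inr true)
    rw [← ht] at this; exact this
  obtain ⟨e, rfl⟩ := exists_eq_sumCongr e (Equiv.refl Bool) (by
    rintro (_ | _)
    · exact hf
    · exact ht.symm)
  have hs' : e s = s' := (Sum.inl_injective hs).symm
  have ho : ∀ d, e (o d) = o' (e d) := fun d => Sum.inl_injective (h.opp (Sum.inl d))
  have hr : e r = r' := by
    have := h.face (Sum.inr false)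
    rw [capPatch_face_false] at this
    change _ = (capPatch f' o' r' s' A' ls').face (Sum.inr false) at this
    rw [capPatch_face_false] at this
    exact Sum.inl_injective this
  have hfo : ∀ d, e (f (o d)) = f' (o' (e d)) := by
    intro d
    have := h.face (Sum.inl d)
    change _ = (capPatch f' o' r' s' A' ls').face (Sum.inl (e d)) at this
    by_cases h1 : f (o d) = r
    · rw [(capPatch_face_eq_true hrs).2 h1] at this
      rw [h1, hr, (capPatch_face_eq_true hrs').1 this.symm]
    by_cases h2 : f (o d) = s
    · rw [(capPatch_face_eq_false hrs).2 h2] at this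
      rw [h2, hs', (capPatch_face_eq_false hrs').1 this.symm]
    · rw [(capPatch_face_eq_inl hrs).2 ⟨rfl, h1, h2⟩] at this
      exact ((capPatch_face_eq_inl hrs').1 this.symm).1.symm
  refine ⟨e, fun d => ?_, ho, hr, hs', ?_, ?_⟩
  · obtain ⟨d, rfl⟩ := o.surjective d
    rw [hfo, ho]
  · rw [List.map_map] at hA
    refine List.map_injective_iff.2 Sum.inl_injective (hA.trans ?_)
    rw [List.map_map]; rfl
  · refine List.map_injective_iff.2 (List.map_injective_iff.2 Sum.inl_injective) (hls.trans ?_)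
    rw [List.map_map, List.map_map]
    congr 1
    funext l; simp

/-- Whether both sides of the root edge lie on the boundary distinguishes single edges from other
polygons. -/
theorem Iso.opp_mem_iff {S : Patch D} {S' : Patch D'} (h : Iso S S') {n : D} {n' : D'}
    {L : List D} {L' : List D'} {ls : List (List D)} {ls' : List (List D')}
    (hb : S.bdry = (n :: L) :: ls) (hb' : S'.bdry = (n' :: L') :: ls') :
    S'.opp n' ∈ S'.bdry.flatten ↔ S.opp n ∈ S.bdry.flatten := by
  obtain ⟨e, h⟩ := h
  have h1 := h.bdry
  rw [hb, hb'] at h1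
  simp only [List.map_cons, List.cons.injEq] at h1
  rw [h1.1.1, ← h.opp, h.rim, List.mem_map_of_injective e.injective]

theorem opp_mem_pushPatch (S : Patch D) :
    (pushPatch S).opp (Sum.inr true) ∈ (pushPatch S).bdry.flatten := by
  rw [pushPatch_rim]
  exact List.mem_cons_of_mem _ List.mem_cons_self

theorem opp_notMem_capPatch (f o : Equiv.Perm D) (r s : D) (A : List D) (ls : List (List D)) :
    (capPatch f o r s A ls).opp (Sum.inr true) ∉ (capPatch f o r s A ls).bdry.flatten := by
  rw [capPatch_rim]
  change Sum.inr false ∉ _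
  simp

open scoped Classical in
/-- After gluing, the origins of `a` and `s` coincide, and after covering, the boundary is simple. -/
theorem Good.cyc_swap [Finite D] {f o : Equiv.Perm D} {r a s x : D} {A B : List D}
    {ls : List (List D)} (h : (Patch.mk f o ((r :: a :: A) :: (s :: x :: B) :: ls)).Good) :
    cyc (Equiv.swap a s * f) a s ∧ (Equiv.swap a s * f) (o r) = s ∧
      SimpleOn (Equiv.swap a s * f) (r :: x :: ((B ++ a :: A) ++ ls.flatten)) ∧ r ≠ x := by
  have hra : f (o r) = a := (h.cyclic _ List.mem_cons_self).1
  have hrx : r ≠ x := by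
    rintro rfl
    have := h.nodup
    simp at this
  refine ⟨((merge_isTriangulated_iff hra h.nodup).2 h.toIsTriangulated).2, ?_,
    (capPatch_simpleOn_iff hrx).1 h.join.1.simple, hrx⟩
  rw [Equiv.Perm.mul_apply, hra, Equiv.swap_apply_left]

/-- Covering and gluing lead to different results: after the removal of the root edge, the third
vertex of its triangle occurs once on the boundary in the first case and twice in the second. -/
theorem not_iso_cap_join [Finite D] [Finite D'] {f o : Equiv.Perm D} {f' o' : Equiv.Perm D'}
    {r x s : D} {A : List D} {ls : List (List D)} {r' a' s' x' : D'} {A' B' : List D'}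
    {ls' : List (List D')} (h : (Patch.mk f o ((r :: x :: s :: A) :: ls)).Good)
    (h' : (Patch.mk f' o' ((r' :: a' :: A') :: (s' :: x' :: B') :: ls')).Good) :
    ¬ Iso (Patch.mk f o ((r :: x :: s :: A) :: ls)).capTop
      (Patch.mk f' o' ((r' :: a' :: A') :: (s' :: x' :: B') :: ls')).mergeTop.capTop := by
  classical
  intro hI
  obtain ⟨h1, h2, h3, h4⟩ := h'.cyc_swap
  have hnd := h.nodup
  have hrs : r ≠ s := by rintro rfl; simp at hnd
  have hI' : Iso (capPatch f o r s A ls)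
    (capPatch (Equiv.swap a' s' * f') o' r' x' (B' ++ a' :: A') ls') := hI
  obtain ⟨e, k1, k2, k3, k4, k5, k6⟩ := exists_equiv_of_capPatch hrs h4 hI'
  obtain ⟨y, hy, hya⟩ : ∃ y ∈ A, e y = a' := List.mem_map.1 (k5 ▸ (by simp))
  have hx : e x = s' := by
    rw [← (h.cyclic _ List.mem_cons_self).1, face_apply]
    dsimp only
    rw [k1, k2, k3, h2]
  have h5 : cyc f y x := by
    rw [cyc_eq_comap e k1]
    change cyc _ (e y) (e x)
    rw [hya, hx]; exact h1
  have h6 := (simpleOn_iff.1 h.simple).2 y (by simp [hy]) x (by simp) h5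
  subst h6
  simp [hy] at hnd

theorem Iso.of_cap [Finite D] [Finite D'] {f o : Equiv.Perm D} {f' o' : Equiv.Perm D'}
    {r x s : D} {A : List D} {ls : List (List D)} {r' x' s' : D'} {A' : List D'}
    {ls' : List (List D')} (h : (Patch.mk f o ((r :: x :: s :: A) :: ls)).Good)
    (h' : (Patch.mk f' o' ((r' :: x' :: s' :: A') :: ls')).Good)
    (hI : Iso (Patch.mk f o ((r :: x :: s :: A) :: ls)).capTop
      (Patch.mk f' o' ((r' :: x' :: s' :: A') :: ls')).capTop) :
    Iso (Patch.mk f o ((r :: x :: s :: A) :: ls))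
      (Patch.mk f' o' ((r' :: x' :: s' :: A') :: ls')) := by
  have hrs : r ≠ s := by rintro rfl; have := h.nodup; simp at this
  have hrs' : r' ≠ s' := by rintro rfl; have := h'.nodup; simp at this
  obtain ⟨e, k1, k2, k3, k4, k5, k6⟩ := exists_equiv_of_capPatch hrs hrs' hI
  have hx : e x = x' := by
    rw [← (h.cyclic _ List.mem_cons_self).1, ← (h'.cyclic _ List.mem_cons_self).1,
      face_apply, face_apply]
    dsimp only
    rw [k1, k2, k3]
  exact ⟨e, k1, k2, by simp [k3, k4, k5, k6, hx]⟩

theorem Iso.of_join [Finite D] [Finite D'] {f o : Equiv.Perm D} {f' o' : Equiv.Perm D'}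
    {r a s x : D} {A B : List D} {ls : List (List D)} {r' a' s' x' : D'} {A' B' : List D'}
    {ls' : List (List D')}
    (h : (Patch.mk f o ((r :: a :: A) :: (s :: x :: B) :: ls)).Good)
    (h' : (Patch.mk f' o' ((r' :: a' :: A') :: (s' :: x' :: B') :: ls')).Good)
    (hI : Iso (Patch.mk f o ((r :: a :: A) :: (s :: x :: B) :: ls)).mergeTop.capTop
      (Patch.mk f' o' ((r' :: a' :: A') :: (s' :: x' :: B') :: ls')).mergeTop.capTop) :
    Iso (Patch.mk f o ((r :: a :: A) :: (s :: x :: B) :: ls))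
      (Patch.mk f' o' ((r' :: a' :: A') :: (s' :: x' :: B') :: ls')) := by
  classical
  obtain ⟨h1, h2, h3, h4⟩ := h.cyc_swap
  obtain ⟨h1', h2', h3', h4'⟩ := h'.cyc_swap
  have hI' : Iso (capPatch (Equiv.swap a s * f) o r x (B ++ a :: A) ls)
    (capPatch (Equiv.swap a' s' * f') o' r' x' (B' ++ a' :: A') ls') := hI
  obtain ⟨e, k1, k2, k3, k4, k5, k6⟩ := exists_equiv_of_capPatch h4 h4' hI'
  have hs : e s = s' := by rw [← h2, k1, k2, k3, h2']
  -- the covered vertex occurs at a unique place of the remaining boundary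
  have ha : e a = a' := by
    refine (simpleOn_iff.1 h3').2 (e a) ?_ a' (by simp) ?_
    · rw [k5]; simp
    · refine Setoid.trans' _ (y := s') ?_ (Setoid.symm' _ h1')
      rw [cyc_eq_comap e k1] at h1
      have h5 : cyc (Equiv.swap a' s' * f') (e a) (e s) := h1
      rwa [hs] at h5
  have hnd : (B ++ a :: A).Nodup := by
    have := (simpleOn_iff.1 h3).1
    simp only [List.nodup_cons] at this
    exact this.2.2.of_append_left
  have hnd' : (B' ++ a' :: A').Nodup := by
    have := (simpleOn_iff.1 h3').1
    simp only [List.nodup_cons] at this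
    exact this.2.2.of_append_left
  have hm : ∀ {E : Type} {b : E} {l l' : List E}, (l ++ b :: l').Nodup → b ∉ l := by
    intro E b l l' hn hb
    rw [List.nodup_append] at hn
    exact hn.2.2 b hb b List.mem_cons_self rfl
  rw [List.map_append, List.map_cons, ha] at k5
  obtain ⟨hB, hA⟩ := append_cons_inj_of_notMem k5 (hm hnd') (by
    rw [← ha, List.mem_map_of_injective e.injective]; exact hm hnd)
  refine ⟨e, fun d => ?_, k2, by simp [k3, k4, k6, hs, ha, hA, hB]⟩
  have := isIso_swap e k1 a s d
  rw [← mul_assoc, Equiv.swap_mul_self, one_mul, ha, hs, ← mul_assoc, Equiv.swap_mul_self,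
    one_mul] at this
  exact this

end Patch

namespace PolygonTree

theorem exists_add_eq_cap {t : PolygonTree} (ht : (cap t).Good) {D : Type} [Finite D] {S : Patch D}
    (hS : S.Good) : ∃ f o r x s A ls, t.add S = ⟨f, o, (r :: x :: s :: A) :: ls⟩ := by
  obtain ⟨ht, d₀, d₁, d₂, ds, hd, h4⟩ := ht
  have h2 := (add_good ht hS).2
  rw [hd] at h2
  obtain ⟨f, o, r, x, s, A, ls, hT, -⟩ := Patch.exists_eq_of_degs_cap h2
  exact ⟨f, o, r, x, s, A, ls, hT⟩

theorem exists_add_eq_join {t u : PolygonTree} (ht : (join t u).Good) {D : Type} [Finite D]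
    {S : Patch D} (hS : S.Good) : ∃ f o r a A s x B ls,
      t.add (u.add S) = ⟨f, o, (r :: a :: A) :: (s :: x :: B) :: ls⟩ := by
  obtain ⟨k1, k2⟩ := add_good ht.2 hS
  obtain ⟨h1, h2⟩ := add_good ht.1 k1
  obtain ⟨d₀, d₁, ds, hd⟩ := ht.1.exists_deg
  obtain ⟨e₀, e₁, es, he⟩ := ht.2.exists_deg
  rw [hd, k2, he] at h2
  obtain ⟨f, o, r, a, A, s, x, B, ls, hT, -⟩ := Patch.exists_eq_of_degs_join h2
  exact ⟨f, o, r, a, A, s, x, B, ls, hT⟩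

theorem not_iso_edge_cap {t : PolygonTree} (ht : (cap t).Good) {D D' : Type} [Finite D']
    {S : Patch D} {S' : Patch D'} (hS' : S'.Good) :
    ¬ Patch.Iso (edge.add S) ((cap t).add S') := by
  obtain ⟨f, o, r, x, s, A, ls, hT⟩ := exists_add_eq_cap ht hS'
  intro h
  change Patch.Iso _ (t.add S').capTop at h
  rw [hT] at h
  exact Patch.opp_notMem_capPatch f o r s A ls
    ((h.opp_mem_iff (n := Sum.inr true) rfl rfl).2 (Patch.opp_mem_pushPatch S))

theorem not_iso_edge_join {t u : PolygonTree} (ht : (join t u).Good) {D D' : Type} [Finite D']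
    {S : Patch D} {S' : Patch D'} (hS' : S'.Good) :
    ¬ Patch.Iso (edge.add S) ((join t u).add S') := by
  classical
  obtain ⟨f, o, r, a, A, s, x, B, ls, hT⟩ := exists_add_eq_join ht hS'
  intro h
  change Patch.Iso _ (t.add (u.add S')).mergeTop.capTop at h
  rw [hT] at h
  exact Patch.opp_notMem_capPatch (Equiv.swap a s * f) o r x (B ++ a :: A) ls
    ((h.opp_mem_iff (n := Sum.inr true) rfl rfl).2 (Patch.opp_mem_pushPatch S))

theorem not_iso_cap_join {t t' u' : PolygonTree} (ht : (cap t).Good) (ht' : (join t' u').Good)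
    {D D' : Type} [Finite D] [Finite D'] {S : Patch D} {S' : Patch D'} (hS : S.Good)
    (hS' : S'.Good) : ¬ Patch.Iso ((cap t).add S) ((join t' u').add S') := by
  obtain ⟨f, o, r, x, s, A, ls, hT⟩ := exists_add_eq_cap ht hS
  obtain ⟨f', o', r', a', A', s', x', B', ls', hT'⟩ := exists_add_eq_join ht' hS'
  have h1 := (add_good ht.1 hS).1
  have h2 := (add_good ht'.1 (add_good ht'.2 hS').1).1
  intro h
  change Patch.Iso (t.add S).capTop (t'.add (u'.add S')).mergeTop.capTop at h
  rw [hT] at h h1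
  rw [hT'] at h h2
  exact Patch.not_iso_cap_join h1 h2 h

/-- The tree is determined by the isomorphism class of the polygon. -/
theorem add_injective {t t' : PolygonTree} (ht : t.Good) (ht' : t'.Good) {D D' : Type} [Finite D]
    [Finite D'] {S : Patch D} {S' : Patch D'} (hS : S.Good) (hS' : S'.Good)
    (h : Patch.Iso (t.add S) (t'.add S')) : t = t' ∧ Patch.Iso S S' := by
  induction t generalizing t' D D' with
  | edge =>
    cases t' with
    | edge => exact ⟨rfl, h.of_push⟩
    | cap t' => exact absurd h (not_iso_edge_cap ht' hS')
    | join t' u' => exact absurd h (not_iso_edge_join ht' hS')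
  | cap t ih =>
    cases t' with
    | edge => exact absurd h.symm (not_iso_edge_cap ht hS)
    | cap t' =>
      obtain ⟨f, o, r, x, s, A, ls, hT⟩ := exists_add_eq_cap ht hS
      obtain ⟨f', o', r', x', s', A', ls', hT'⟩ := exists_add_eq_cap ht' hS'
      have h1 := (add_good ht.1 hS).1
      have h2 := (add_good ht'.1 hS').1
      change Patch.Iso (t.add S).capTop (t'.add S').capTop at h
      have ih := ih ht.1 ht'.1 hS hS'
      rw [hT, hT'] at ih h
      rw [hT] at h1
      rw [hT'] at h2
      obtain ⟨rfl, k⟩ := ih (h.of_cap h1 h2)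
      exact ⟨rfl, k⟩
    | join t' u' => exact absurd h (not_iso_cap_join ht ht' hS hS')
  | join t u ih ih' =>
    cases t' with
    | edge => exact absurd h.symm (not_iso_edge_join ht hS)
    | cap t' => exact absurd h.symm (not_iso_cap_join ht' ht hS' hS)
    | join t' u' =>
      obtain ⟨f, o, r, a, A, s, x, B, ls, hT⟩ := exists_add_eq_join ht hS
      obtain ⟨f', o', r', a', A', s', x', B', ls', hT'⟩ := exists_add_eq_join ht' hS'
      have k1 := (add_good ht.2 hS).1
      have k2 := (add_good ht'.2 hS').1
      have h1 := (add_good ht.1 k1).1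
      have h2 := (add_good ht'.1 k2).1
      change Patch.Iso (t.add (u.add S)).mergeTop.capTop
        (t'.add (u'.add S')).mergeTop.capTop at h
      have ih := ih ht.1 ht'.1 k1 k2
      rw [hT, hT'] at ih h
      rw [hT] at h1
      rw [hT'] at h2
      obtain ⟨rfl, k⟩ := ih (h.of_join h1 h2)
      obtain ⟨rfl, k'⟩ := ih' ht.2 ht'.2 hS hS' k
      exact ⟨rfl, k'⟩

end PolygonTree

/-! ### Existence of construction trees -/

theorem exists_map_inl {D : Type} {L : List (D ⊕ Bool)} (h : ∀ b, Sum.inr b ∉ L) :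
    ∃ A : List D, L = A.map Sum.inl := by
  have : L ∈ Set.range (List.map (Sum.inl : D → D ⊕ Bool)) := by
    rw [Set.range_list_map]
    rintro (x | b) hx
    · exact ⟨x, rfl⟩
    · exact absurd hx (h b)
  obtain ⟨A, hA⟩ := this
  exact ⟨A, hA.symm⟩

theorem exists_map_map_inl {D : Type} {ls : List (List (D ⊕ Bool))}
    (h : ∀ b, Sum.inr b ∉ ls.flatten) : ∃ ms : List (List D), ls = ms.map (List.map Sum.inl) := by
  have : ls ∈ Set.range (List.map (List.map (Sum.inl : D → D ⊕ Bool))) := by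
    rw [Set.range_list_map]
    intro L hL
    obtain ⟨A, hA⟩ := exists_map_inl (L := L) fun b hb => h b (List.mem_flatten.2 ⟨L, hL, hb⟩)
    exact ⟨A, hA.symm⟩
  obtain ⟨A, hA⟩ := this
  exact ⟨A, hA.symm⟩

namespace Patch

/-- The removal of the root edge, whose darts are `inr true` and `inr false`: either it is a
component of its own, or a triangle is uncovered. -/
theorem Good.push_or_cap {D : Type} [Finite D] {T : Patch (D ⊕ Bool)} (hT : T.Good)
    {L : List (D ⊕ Bool)} {ls : List (List (D ⊕ Bool))} (hb : T.bdry = (Sum.inr true :: L) :: ls)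
    (hopp : T.opp (Sum.inr true) = Sum.inr false) :
    (∃ S, T = pushPatch S) ∨ ∃ f o r x s A ls', T = capPatch f o r s A ls' ∧ f (o r) = x ∧
      f (o x) = s ∧ ((r :: x :: s :: A) ++ ls'.flatten).Nodup := by
  classical
  have hopp' : T.opp (Sum.inr false) = Sum.inr true := by rw [← hopp, hT.opp_opp]
  obtain ⟨o, ho⟩ := exists_eq_sumCongr T.opp Equiv.boolNot (by
    rintro (_ | _)
    · exact hopp'
    · exact hopp)
  have hft : T.face (Sum.inr true) = T.next (Sum.inr false) := by rw [face_apply, hopp]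
  have hff : T.face (Sum.inr false) = T.next (Sum.inr true) := by rw [face_apply, hopp']
  have hrim : T.bdry.flatten = Sum.inr true :: (L ++ ls.flatten) := by rw [hb]; simp
  have hnt : Sum.inr true ∈ T.bdry.flatten := by rw [hrim]; exact List.mem_cons_self
  have hnd := hT.nodup
  rw [hrim, List.nodup_cons] at hnd
  have hcyc : Follows T.face (Sum.inr true) L (Sum.inr true) :=
    hT.cyclic (Sum.inr true :: L) (by rw [hb]; exact List.mem_cons_self)
  have hsimple := (simpleOn_iff.1 hT.simple).2
  by_cases hn : Sum.inr false ∈ T.bdry.flatten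
  · left
    have e1 : Sum.inr false = T.next (Sum.inr false) :=
      hsimple _ hn _ (hft ▸ hT.rim_closed hnt) (cyc_apply _ _)
    have e2 : Sum.inr true = T.next (Sum.inr true) :=
      hsimple _ hnt _ (hff ▸ hT.rim_closed hn) (cyc_apply _ _)
    obtain ⟨f, hf⟩ := exists_eq_sumCongr T.next (Equiv.refl Bool) (by
      rintro (_ | _)
      · exact e1.symm
      · exact e2.symm)
    rw [← e1] at hft
    rw [← e2] at hff
    have hL : L = [Sum.inr false] := by
      match L, hcyc, hnd with
      | [], hc, _ => rw [Follows, hft] at hc; exact absurd hc (by simp)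
      | [y], hc, _ => rw [Follows, hft] at hc; rw [← hc.1]
      | y :: z :: L', hc, hnd =>
        rw [Follows, Follows, hft] at hc
        obtain ⟨rfl, hz, -⟩ := hc
        rw [hff] at hz
        exact absurd (by simp [hz]) hnd.1
    subst hL
    obtain ⟨ms, rfl⟩ := exists_map_map_inl (ls := ls) (by
      rintro (_ | _) hm
      · exact (List.nodup_cons.1 hnd.2).1 (by simpa using hm)
      · exact hnd.1 (List.mem_append_right _ hm))
    refine ⟨⟨f, o, ms⟩, ?_⟩
    obtain ⟨g, q, b⟩ := T
    dsimp only at hb hf ho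
    subst hb hf ho
    rfl
  · right
    have h3 := hT.triangle _ hn
    have hloop := hT.loopless (Sum.inr true)
    rw [hopp] at hloop
    have hout : T.face (Sum.inr false) ∉ T.bdry.flatten := fun h => hn (hT.rim_closed_symm h)
    obtain ⟨r, hr⟩ : ∃ r, T.next (Sum.inr true) = Sum.inl r := by
      rcases h : T.next (Sum.inr true) with r | (_ | _)
      · exact ⟨r, rfl⟩
      · exact absurd (h ▸ cyc_apply T.next (Sum.inr true)) hloop
      · rw [hff, h] at hout; exact absurd hnt hout
    obtain ⟨s, hs⟩ : ∃ s, T.next (Sum.inr false) = Sum.inl s := by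
      rcases h : T.next (Sum.inr false) with r | (_ | _)
      · exact ⟨r, rfl⟩
      · rw [h] at hft; exact absurd (hft ▸ hT.rim_closed hnt) hn
      · exact absurd (Setoid.symm' _ (h ▸ cyc_apply T.next (Sum.inr false))) hloop
    have hrs : r ≠ s := by
      rintro rfl
      exact absurd (T.next.injective (hr.trans hs.symm)) (by simp)
    -- taking the two darts of the root edge out of the rotation
    obtain ⟨f, hf⟩ := exists_eq_sumCongr (Equiv.swap (Sum.inr false) (Sum.inl s) *
        (Equiv.swap (Sum.inr true) (Sum.inl r) * T.next)) (Equiv.refl Bool) (by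
      rintro (_ | _)
      · rw [Equiv.Perm.mul_apply, Equiv.Perm.mul_apply, hs,
          Equiv.swap_apply_of_ne_of_ne (a := Sum.inr true) (by simp) (by simpa using hrs.symm),
          Equiv.swap_apply_right]; rfl
      · rw [Equiv.Perm.mul_apply, Equiv.Perm.mul_apply, hr, Equiv.swap_apply_right,
          Equiv.swap_apply_of_ne_of_ne (by simp) (by simp)]; rfl)
    have hnext : T.next = insertEdge f r s := by
      have h4 : insertEdge f r s = Equiv.swap (Sum.inr true) (Sum.inl r) *
          (Equiv.swap (Sum.inr false) (Sum.inl s) * Equiv.sumCongr f (Equiv.refl Bool)) := by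
        rw [insertEdge]; congr!
      rw [h4, ← hf, ← mul_assoc (Equiv.swap (Sum.inr false) (Sum.inl s)), Equiv.swap_mul_self,
        one_mul, ← mul_assoc, Equiv.swap_mul_self, one_mul]
    obtain ⟨A, hA⟩ : ∃ A : List D, L = Sum.inl s :: A.map Sum.inl := by
      cases L with
      | nil =>
        rw [Follows, hft, hs] at hcyc
        exact absurd hcyc (by simp)
      | cons y L =>
        rw [Follows, hft, hs] at hcyc
        obtain ⟨A, rfl⟩ := exists_map_inl (L := L) (by
          rintro (_ | _) hm
          · exact hn (by rw [hrim]; simp [hm])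
          · exact hnd.1 (by simp [hm]))
        exact ⟨A, by rw [hcyc.1]⟩
    obtain ⟨ms, hms⟩ := exists_map_map_inl (ls := ls) (by
      rintro (_ | _) hm
      · exact hn (by rw [hrim]; exact List.mem_cons_of_mem _ (List.mem_append_right _ hm))
      · exact hnd.1 (List.mem_append_right _ hm))
    have hTeq : T = capPatch f o r s A ms := by
      obtain ⟨g, q, b⟩ := T
      dsimp only at hb hnext ho
      subst hA hms hb hnext ho
      rfl
    rw [hff, hr] at h3 hout
    have hmem : ∀ y, y ∈ s :: (A ++ ms.flatten) → Sum.inl y ∈ T.bdry.flatten := by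
      intro y hy
      rw [hTeq, capPatch_rim]
      exact List.mem_cons_of_mem _ (List.mem_map_of_mem hy)
    have hout' : T.face (Sum.inl r) ∉ T.bdry.flatten := fun h => hout (hT.rim_closed_symm h)
    obtain ⟨x, hx⟩ : ∃ x, T.face (Sum.inl r) = Sum.inl x := by
      rcases h : T.face (Sum.inl r) with x | (_ | _)
      · exact ⟨x, rfl⟩
      · rw [h, hff, hr] at h3; exact absurd h3 (by simp)
      · rw [h] at hout'; exact absurd hnt hout'
    rw [hx] at h3 hout'
    have h4 := hx
    have h5 := h3
    rw [hTeq] at h4 h5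
    obtain ⟨h6, h7, h8⟩ := (capPatch_face_eq_inl hrs).1 h4
    refine ⟨f, o, r, x, s, A, ms, hTeq, h6, (capPatch_face_eq_false hrs).1 h5, ?_⟩
    have hrm : r ∉ s :: (A ++ ms.flatten) := fun h => hout (hmem r h)
    have hxm : x ∉ s :: (A ++ ms.flatten) := fun h => hout' (hmem x h)
    have hnd2 : (s :: (A ++ ms.flatten)).Nodup := by
      have := hT.nodup
      rw [hTeq, capPatch_rim, List.nodup_cons] at this
      exact this.2.of_map
    change (r :: x :: s :: (A ++ ms.flatten)).Nodup
    rw [List.nodup_cons, List.nodup_cons, List.mem_cons, not_or]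
    exact ⟨⟨Ne.symm h7, hrm⟩, hxm, hnd2⟩

/-- If the vertex under the root edge is an inner vertex, then the removal of the root edge leaves a
polygon. -/
theorem Good.of_cap {D : Type} [Finite D] {f o : Equiv.Perm D} {r x s : D} {A : List D}
    {ls : List (List D)} (h : (capPatch f o r s A ls).Good)
    (hnd : ((r :: x :: s :: A) ++ ls.flatten).Nodup) (hrx : f (o r) = x) (hxs : f (o x) = s)
    (hx : ∀ b ∈ r :: s :: (A ++ ls.flatten), ¬ cyc f x b) :
    (Patch.mk f o ((r :: x :: s :: A) :: ls)).Good ∧ 4 ≤ cycDeg f x := by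
  have hrs : r ≠ s := by rintro rfl; simp at hnd
  have h1 := ((capPatch_isTriangulated_iff hnd hrx hxs).1 h.toIsTriangulated).1
  have h2 := (capPatch_simpleOn_iff hrs).1 h.simple
  have h3 := (capPatch_innerOn_iff hrs).1 h.inner
  have hrim : (Patch.mk f o ((r :: x :: s :: A) :: ls)).bdry.flatten =
    r :: x :: s :: (A ++ ls.flatten) := by simp
  have h2' := List.pairwise_cons.1 h2
  refine ⟨⟨h1, ?_, ?_⟩, ?_⟩
  · rw [hrim]
    refine List.pairwise_cons.2 ⟨fun b hb => ?_, List.pairwise_cons.2 ⟨fun b hb =>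
      hx b (List.mem_cons_of_mem _ hb), h2'.2⟩⟩
    rcases List.mem_cons.1 hb with rfl | hb
    · exact fun k => hx r List.mem_cons_self (Setoid.symm' _ k)
    · exact h2'.1 b hb
  · rw [hrim]
    intro y
    rcases h3 y with ⟨b, hb, hyb⟩ | k
    · refine Or.inl ⟨b, ?_, hyb⟩
      rcases List.mem_cons.1 hb with rfl | hb
      · exact List.mem_cons_self
      · exact List.mem_cons_of_mem _ (List.mem_cons_of_mem _ hb)
    · exact Or.inr k
  · rcases h3 x with ⟨b, hb, hxb⟩ | k
    · exact absurd hxb (hx b hb)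
    · exact k

open scoped Classical in
/-- If the third vertex of the triangle at the root edge lies on the boundary, then the removal of
the root edge leaves two polygons that are glued at this vertex. -/
theorem Good.of_join {D : Type} [Finite D] {f o : Equiv.Perm D} {r b x s : D} {A B : List D}
    {ls : List (List D)} (h : (capPatch f o r s (B ++ b :: A) ls).Good)
    (hnd : ((r :: x :: s :: (B ++ b :: A)) ++ ls.flatten).Nodup) (hrx : f (o r) = x)
    (hxs : f (o x) = s) (hxb : cyc f x b) :
    ∃ g, f = Equiv.swap b x * g ∧
      (Patch.mk g o ((r :: b :: A) :: (x :: s :: B) :: ls)).Good := by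
  have hrs : r ≠ s := by rintro rfl; simp at hnd
  have hbx : b ≠ x := by rintro rfl; simp at hnd
  have h1 := ((capPatch_isTriangulated_iff hnd hrx hxs).1 h.toIsTriangulated).1
  have h2 := (capPatch_simpleOn_iff hrs).1 h.simple
  have h3 := (capPatch_innerOn_iff hrs).1 h.inner
  set g := Equiv.swap b x * f with hg
  have hfg : f = Equiv.swap b x * g := by
    rw [hg, ← mul_assoc, Equiv.swap_mul_self, one_mul]
  have hgr : g (o r) = b := by rw [hg, Equiv.Perm.mul_apply, hrx, Equiv.swap_apply_right]
  set P := r :: s :: ((B ++ b :: A) ++ ls.flatten) with hP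
  have hbP : b ∈ P := by rw [hP]; simp
  have hxP : x ∉ P := by
    intro hx
    simp only [List.cons_append, List.nodup_cons] at hnd
    rcases List.mem_cons.1 hx with rfl | hx
    · exact hnd.1 List.mem_cons_self
    · exact hnd.2.1 (by simpa using hx)
  have hperm : ((r :: b :: A) :: (x :: s :: B) :: ls).flatten.Perm (x :: P) := by
    have h4 := (List.perm_append_comm (l₁ := r :: b :: A) (l₂ := x :: s :: B)).append_right
      ls.flatten
    have h5 := (List.perm_middle (a := r) (l₁ := s :: B) (l₂ := b :: A ++ ls.flatten)).cons x
    have h6 : (x :: P) = x :: r :: (s :: B ++ (b :: A ++ ls.flatten)) := by simp [hP]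
    rw [h6]
    refine List.Perm.trans ?_ h5
    refine List.Perm.trans ?_ (h4.trans (List.Perm.of_eq (by simp)))
    simp
  have hnd' : ((r :: b :: A) :: (x :: s :: B) :: ls).flatten.Nodup := by
    rw [hperm.nodup_iff, List.nodup_cons]
    exact ⟨hxP, (simpleOn_iff.1 h2).1⟩
  have hnot : ¬ cyc g b x := not_cyc_swap_mul hbx (Setoid.symm' _ hxb)
  rw [hfg] at h1 h2 h3 hxb
  have h7 := (merge_isTriangulated_iff hgr hnd').1 ⟨h1, Setoid.symm' _ hxb⟩
  have h8 := (merge_simpleOn_iff hnot hbP hxP).1 h2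
  refine ⟨g, hfg, h7, ?_, ?_⟩
  · rw [simpleOn_iff] at h8 ⊢
    exact ⟨hnd', fun y hy z hz => h8.2 y (hperm.mem_iff.1 hy) z (hperm.mem_iff.1 hz)⟩
  · exact (innerOn_congr fun y => hperm.mem_iff.symm).1 ((merge_innerOn_iff hnot hbP).1 h3)

/-- Every union of triangulated polygons arises from a smaller one by the addition of a single edge,
by a covering, or by a gluing followed by a covering. -/
theorem Good.cases {D : Type} [Finite D] {T : Patch (D ⊕ Bool)} (hT : T.Good)
    {L : List (D ⊕ Bool)} {ls : List (List (D ⊕ Bool))} (hb : T.bdry = (Sum.inr true :: L) :: ls)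
    (hopp : T.opp (Sum.inr true) = Sum.inr false) :
    (∃ S : Patch D, S.Good ∧ T = pushPatch S) ∨
    (∃ f o r x s A ls', (Patch.mk f o ((r :: x :: s :: A) :: ls') : Patch D).Good ∧
      4 ≤ cycDeg f x ∧ T = (Patch.mk f o ((r :: x :: s :: A) :: ls')).capTop) ∨
    ∃ f o r a A s x B ls', (Patch.mk f o ((r :: a :: A) :: (s :: x :: B) :: ls') : Patch D).Good ∧
      T = (Patch.mk f o ((r :: a :: A) :: (s :: x :: B) :: ls')).mergeTop.capTop := by
  classical
  rcases hT.push_or_cap hb hopp with ⟨S, rfl⟩ | ⟨f, o, r, x, s, A, ls', rfl, hrx, hxs, hnd⟩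
  · exact Or.inl ⟨S, (pushPatch_good_iff S).1 hT, rfl⟩
  right
  by_cases hx : ∀ b ∈ r :: s :: (A ++ ls'.flatten), ¬ cyc f x b
  · obtain ⟨h1, h2⟩ := hT.of_cap hnd hrx hxs hx
    exact Or.inl ⟨f, o, r, x, s, A, ls', h1, h2, rfl⟩
  · right
    push Not at hx
    obtain ⟨b, hb', hxb⟩ := hx
    have h1 := ((capPatch_isTriangulated_iff hnd hrx hxs).1 hT.toIsTriangulated).1
    -- the triangle has no loops, and other components are not involved
    have hbA : b ∈ A := by
      rcases List.mem_cons.1 hb' with rfl | hb'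
      · exfalso
        have k := h1.loopless b
        exact k (Setoid.trans' _ (Setoid.symm' _ hxb)
          (Setoid.symm' _ (hrx ▸ cyc_apply f (o b))))
      rcases List.mem_cons.1 hb' with rfl | hb'
      · exfalso
        have k := h1.loopless x
        exact k (Setoid.trans' _ hxb (Setoid.symm' _ (hxs ▸ cyc_apply f (o x))))
      rcases List.mem_append.1 hb' with hb' | hb'
      · exact hb'
      · exfalso
        obtain ⟨M, hM, hbM⟩ := List.mem_flatten.1 hb'
        exact (List.pairwise_cons.1 h1.separate).1 M hM x (by simp) b hbM
          (cyc_le_conn_left _ _ hxb)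
    obtain ⟨B, A, rfl⟩ := List.append_of_mem hbA
    obtain ⟨g, rfl, hg⟩ := hT.of_join hnd hrx hxs hxb
    exact ⟨g, o, r, b, A, x, s, B, ls', hg, rfl⟩

/-- A relabelling of the darts in which a given edge comes last. -/
theorem exists_equiv_sum_bool {D : Type} [Finite D] {n n' : D} (h : n' ≠ n) :
    ∃ (E : Type) (_ : Finite E) (e : D ≃ E ⊕ Bool), e n = Sum.inr true ∧
      e n' = Sum.inr false := by
  classical
  let g : {d : D // d ≠ n ∧ d ≠ n'} ⊕ Bool → D := Sum.elim Subtype.val fun b => if b then n else n'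
  have hg : Function.Bijective g := by
    constructor
    · rintro (⟨x, hx⟩ | (_ | _)) (⟨y, hy⟩ | (_ | _)) k <;> simp [g] at k ⊢
      · exact k
      · exact absurd k hx.2
      · exact absurd k hx.1
      · exact absurd k.symm hy.2
      · exact absurd k h
      · exact absurd k.symm hy.1
      · exact absurd k.symm h
    · intro d
      by_cases h1 : d = n
      · exact ⟨Sum.inr true, h1.symm⟩
      by_cases h2 : d = n'
      · exact ⟨Sum.inr false, h2.symm⟩
      · exact ⟨Sum.inl ⟨d, h1, h2⟩, rfl⟩
  refine ⟨{d : D // d ≠ n ∧ d ≠ n'}, inferInstance, (Equiv.ofBijective g hg).symm, ?_, ?_⟩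
  · rw [Equiv.symm_apply_eq]; rfl
  · rw [Equiv.symm_apply_eq]; rfl

end Patch

namespace PolygonTree

theorem add_congr {t : PolygonTree} (ht : t.Good) {D D' : Type} [Finite D] [Finite D']
    {S : Patch D} {S' : Patch D'} (hS : S.Good) (h : Patch.Iso S S') :
    Patch.Iso (t.add S) (t.add S') := by
  induction t generalizing D D' with
  | edge => exact h.push
  | cap t ih => exact (ih ht.1 hS h).capTop (add_good ht.1 hS).1.nodup
  | join t u ih ih' =>
    classical
    have k1 := (add_good ht.2 hS).1
    have k2 := (add_good ht.1 k1).1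
    obtain ⟨f, o, r, a, A, s, x, B, ls, hT⟩ := exists_add_eq_join ht hS
    refine (ih ht.1 k1 (ih' ht.2 hS h)).mergeTop.capTop ?_
    rw [hT] at k2 ⊢
    exact ((Patch.merge_isTriangulated_iff (k2.cyclic _ List.mem_cons_self).1 k2.nodup).2
      k2.toIsTriangulated).1.nodup

/-- The first component of a union of triangulated polygons is described by a tree. -/
theorem exists_iso_add {D : Type} [Finite D] {S : Patch D} (hS : S.Good) (hb : S.bdry ≠ []) :
    ∃ t : PolygonTree, t.Good ∧ ∃ (D' : Type) (_ : Finite D') (S' : Patch D'), S'.Good ∧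
      Nat.card D' < Nat.card D ∧ Patch.Iso S (t.add S') := by
  classical
  induction hn : Nat.card D using Nat.strong_induction_on generalizing D with
  | _ n ih =>
  subst hn
  obtain ⟨L₀, ls₀, hL₀⟩ := List.exists_cons_of_ne_nil hb
  obtain ⟨d, L₁, rfl⟩ := List.exists_cons_of_ne_nil
    (hS.cyclic L₀ (by rw [hL₀]; exact List.mem_cons_self)).ne_nil
  obtain ⟨E, _, e, he, he'⟩ := Patch.exists_equiv_sum_bool (hS.opp_ne d)
  have hI := Patch.isIso_relabel e S
  have hST : Patch.Iso S (S.relabel e) := ⟨e, hI⟩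
  have hT : (S.relabel e).Good := hS.of_isIso hI
  have hcard : Nat.card E < Nat.card D := by
    rw [Nat.card_congr e, Nat.card_sum]
    simp
  have hTb : (S.relabel e).bdry = (Sum.inr true :: L₁.map e) :: ls₀.map (List.map e) := by
    rw [hI.bdry, hL₀, List.map_cons, List.map_cons, he]
  have hTo : (S.relabel e).opp (Sum.inr true) = Sum.inr false := by
    rw [← he, ← hI.opp, he']
  generalize S.relabel e = T at hT hTb hTo hST
  rcases hT.cases hTb hTo with ⟨S', hS', rfl⟩ | ⟨f, o, r, x, s, A, ls, hU, h4, rfl⟩ |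
    ⟨f, o, r, a, A, s, x, B, ls, hU, rfl⟩
  · exact ⟨edge, trivial, E, inferInstance, S', hS', hcard, hST⟩
  · obtain ⟨t, ht, D', _, S', hS', hlt, hI'⟩ := ih _ hcard hU (by simp) rfl
    have hdeg := hI'.degs
    rw [(add_good ht hS').2] at hdeg
    refine ⟨cap t, ⟨ht, cycDeg f r, cycDeg f x, cycDeg f s, A.map (cycDeg f),
      (List.cons.inj hdeg).1, h4⟩, D', inferInstance, S', hS', hlt.trans hcard, ?_⟩
    exact hST.trans (hI'.capTop hU.nodup)
  · obtain ⟨t, ht, D', _, S', hS', hlt, hI'⟩ := ih _ hcard hU (by simp) rfl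
    have hdeg := hI'.degs
    rw [(add_good ht hS').2] at hdeg
    have hne : S'.bdry ≠ [] := by
      intro h
      have := congrArg List.length hdeg
      simp [Patch.degs, h] at this
    obtain ⟨u, hu, D'', _, S'', hS'', hlt', hI''⟩ := ih _ (hlt.trans hcard) hS' hne rfl
    refine ⟨join t u, ⟨ht, hu⟩, D'', inferInstance, S'', hS'', (hlt'.trans hlt).trans hcard, ?_⟩
    refine hST.trans (((hI'.trans (add_congr ht hS' hI'')).mergeTop).capTop ?_)
    exact ((Patch.merge_isTriangulated_iff (hU.cyclic _ List.mem_cons_self).1 hU.nodup).2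
      hU.toIsTriangulated).1.nodup

end PolygonTree

/-! ### Polygons with a marked edge -/

namespace Patch

/-- The patch without darts. -/
def empty : Patch Empty := ⟨1, 1, []⟩

theorem empty_good : empty.Good where
  opp_opp d := d.elim
  opp_ne d := d.elim
  cover d := d.elim
  separate := List.Pairwise.nil
  euler := by
    have : ∀ s : Setoid Empty, numClasses s = 0 := fun s => by
      have : IsEmpty (Quotient s) := ⟨fun q => q.out.elim⟩
      exact Nat.card_of_isEmpty
    simp [this, empty]
  cyclic := by simp [empty]
  nodup := List.nodup_nil
  triangle d := d.elim
  loopless d := d.elim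
  simple := List.Pairwise.nil
  inner d := d.elim

theorem Good.iso_empty {D : Type} {S : Patch D} (hS : S.Good) (hb : S.bdry = []) :
    Iso S empty := by
  have : IsEmpty D := ⟨fun d => by
    obtain ⟨L, hL, -⟩ := hS.cover d
    rw [hb] at hL
    exact absurd hL (by simp)⟩
  exact ⟨Equiv.equivOfIsEmpty D Empty, fun d => isEmptyElim d, fun d => isEmptyElim d,
    by simp [hb, empty]⟩

/-- The same polygon with the next boundary edge as the root. -/
theorem Good.rotate {D : Type} {S : Patch D} (hS : S.Good) {L : List D} (hb : S.bdry = [L]) :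
    (Patch.mk S.next S.opp [L.rotate 1]).Good := by
  have hr1 : S.bdry.flatten = L := by simp [hb]
  have hr2 : (Patch.mk S.next S.opp [L.rotate 1]).bdry.flatten = L.rotate 1 := by simp
  have hmem : ∀ d, d ∈ L.rotate 1 ↔ d ∈ L := fun d => List.mem_rotate
  have hnd := hS.nodup
  rw [hr1] at hnd
  refine ⟨⟨hS.opp_opp, hS.opp_ne, fun d => ?_, List.pairwise_singleton _ _, ?_, ?_, ?_, ?_,
    hS.loopless⟩, ?_, ?_⟩
  · obtain ⟨M, hM, x, hx, hxd⟩ := hS.cover d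
    rw [hb, List.mem_singleton] at hM
    subst hM
    exact ⟨_, List.mem_singleton_self _, x, (hmem x).2 hx, hxd⟩
  · have := hS.euler
    rw [hb] at this
    exact this
  · intro M hM
    rw [List.mem_singleton] at hM
    subst hM
    have hc := hS.cyclic L (by rw [hb]; exact List.mem_singleton_self _)
    match L, hc with
    | [a], hc =>
      rw [List.rotate_singleton]
      exact hc
    | a :: b :: l, hc =>
      rw [show (a :: b :: l).rotate 1 = b :: (l ++ [a]) by simp]
      exact follows_append.2 ⟨hc.2, hc.1⟩
  · rw [hr2]; exact List.nodup_rotate.2 hnd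
  · intro d hd
    rw [hr2, hmem, ← hr1] at hd
    exact hS.triangle d hd
  · rw [hr2]
    have := hS.simple
    rw [hr1, simpleOn_iff] at this
    exact simpleOn_iff.2 ⟨List.nodup_rotate.2 hnd, fun x hx y hy =>
      this.2 x ((hmem x).1 hx) y ((hmem y).1 hy)⟩
  · rw [hr2]
    have := hS.inner
    rw [hr1] at this
    exact (innerOn_congr fun x => (hmem x).symm).1 this

end Patch

namespace PolygonTree

/-- The polygon described by a tree. -/
noncomputable def poly (t : PolygonTree) : Patch (t.darts Empty) := t.add Patch.empty

theorem poly_good {t : PolygonTree} (ht : t.Good) : t.poly.Good :=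
  (add_good ht Patch.empty_good).1

theorem poly_degs {t : PolygonTree} (ht : t.Good) : t.poly.degs = [t.deg] :=
  (add_good ht Patch.empty_good).2

theorem poly_injective {t t' : PolygonTree} (ht : t.Good) (ht' : t'.Good)
    (h : Patch.Iso t.poly t'.poly) : t = t' :=
  (add_injective ht ht' Patch.empty_good Patch.empty_good h).1

theorem exists_iso_poly {D : Type} [Finite D] {S : Patch D} (hS : S.Good) {L : List D}
    (hb : S.bdry = [L]) : ∃ t : PolygonTree, t.Good ∧ Patch.Iso S t.poly := by
  obtain ⟨t, ht, D', _, S', hS', -, hI⟩ := exists_iso_add hS (by simp [hb])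
  refine ⟨t, ht, hI.trans (add_congr ht hS' (hS'.iso_empty ?_))⟩
  have := hI.degs
  rw [(add_good ht hS').2, Patch.degs, Patch.degs, hb] at this
  simp only [List.map_cons, List.map_nil, List.cons.injEq, List.map_eq_nil_iff] at this
  exact this.2

theorem exists_bdry_poly {t : PolygonTree} (ht : t.Good) : ∃ L, t.poly.bdry = [L] := by
  have := poly_degs ht
  rw [Patch.degs, List.map_eq_singleton_iff] at this
  obtain ⟨L, hL, -⟩ := this
  exact ⟨L, hL⟩

/-- Every edge has two darts, and every dart belongs to a triangle or to the boundary. -/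
theorem card_darts {t : PolygonTree} (ht : t.Good) (D : Type) [Finite D] :
    Nat.card (t.darts D) = Nat.card D + 3 * t.size + t.deg.length := by
  induction t generalizing D with
  | edge =>
    change Nat.card (D ⊕ Bool) = _
    rw [Nat.card_sum]; simp [size, deg]
  | cap t ih =>
    obtain ⟨ht, d₀, d₁, d₂, ds, hd, -⟩ := ht
    change Nat.card (t.darts D ⊕ Bool) = _
    rw [Nat.card_sum, ih ht D, deg_cap hd, hd]
    simp [size]; ring
  | join t u ih ih' =>
    obtain ⟨d₀, d₁, ds, hd⟩ := ht.1.exists_deg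
    obtain ⟨e₀, e₁, es, he⟩ := ht.2.exists_deg
    change Nat.card (t.darts (u.darts D) ⊕ Bool) = _
    rw [Nat.card_sum, ih ht.1, ih' ht.2, deg_join hd he, hd, he]
    simp [size]; ring

/-- The next boundary edge may be taken as the root edge. -/
theorem exists_rotate {t : PolygonTree} (ht : t.Good) : ∃ t' : PolygonTree, t'.Good ∧
    t'.size = t.size ∧ t'.deg = t.deg.rotate 1 ∧
    ∀ L, t.poly.bdry = [L] →
      Patch.Iso ⟨t.poly.next, t.poly.opp, [L.rotate 1]⟩ t'.poly := by
  obtain ⟨L, hL⟩ := exists_bdry_poly ht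
  have hg := (poly_good ht).rotate hL
  obtain ⟨t', ht', hI⟩ := exists_iso_poly hg rfl
  have hd : t'.deg = t.deg.rotate 1 := by
    have h1 := hI.degs
    have h2 := poly_degs ht
    rw [poly_degs ht'] at h1
    rw [Patch.degs, hL] at h2
    simp only [Patch.degs, List.map_cons, List.map_nil, List.cons.injEq, and_true] at h1 h2
    rw [h1, ← h2, List.map_rotate]
  refine ⟨t', ht', ?_, hd, fun L' hL' => ?_⟩
  · obtain ⟨e, -⟩ := hI
    have h1 := Nat.card_congr e
    rw [card_darts ht, card_darts ht', hd, List.length_rotate] at h1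
    omega
  · rw [hL] at hL'
    simp only [List.cons.injEq, and_true] at hL'
    rw [← hL']; exact hI

/-! ### Generating functions -/

theorem finite_trees (k : ℕ) : {t : PolygonTree | t.Good ∧ t.size = k}.Finite := by
  induction k using Nat.strong_induction_on with
  | _ k ih =>
  have h1 : (⋃ i ∈ Finset.range k, {t : PolygonTree | t.Good ∧ t.size = i}).Finite :=
    Set.Finite.biUnion (Finset.finite_toSet _) fun i hi => ih i (Finset.mem_range.1 hi)
  refine (((Set.finite_singleton edge).union (h1.image cap)).union
    (Set.Finite.image2 join h1 h1)).subset ?_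
  rintro t ⟨ht, rfl⟩
  have hm : ∀ {u : PolygonTree}, u.Good → u.size < t.size →
      u ∈ ⋃ i ∈ Finset.range t.size, {t : PolygonTree | t.Good ∧ t.size = i} := by
    intro u hu hlt
    simp only [Set.mem_iUnion]
    exact ⟨u.size, Finset.mem_range.2 hlt, hu, rfl⟩
  cases t with
  | edge => exact Or.inl (Or.inl rfl)
  | cap t => exact Or.inl (Or.inr ⟨t, hm ht.1 (by simp [size]), rfl⟩)
  | join t u =>
    exact Or.inr ⟨t, hm ht.1 (by simp only [size]; omega), u, hm ht.2 (by simp only [size]; omega), rfl⟩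

/-- The good trees with `k` triangles. -/
noncomputable def trees (k : ℕ) : Finset PolygonTree := (finite_trees k).toFinset

theorem mem_trees {k : ℕ} {t : PolygonTree} : t ∈ trees k ↔ t.Good ∧ t.size = k := by
  simp [trees]

/-- The number of boundary vertices. -/
def len (t : PolygonTree) : ℕ := t.deg.length

/-- The degree of the `i`-th boundary vertex, or zero if there is no such vertex. -/
def dg (t : PolygonTree) (i : ℕ) : ℕ := t.deg.getD i 0

/-- The second boundary vertex can be covered: it is not a vertex of a digon, and its degree is at
least four. -/
def Capable (t : PolygonTree) : Prop := 3 ≤ t.len ∧ 4 ≤ t.dg 1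

theorem good_cap_iff {t : PolygonTree} : (cap t).Good ↔ t.Good ∧ t.Capable := by
  refine and_congr_right fun ht => ?_
  constructor
  · rintro ⟨d₀, d₁, d₂, ds, hd, h4⟩
    exact ⟨by simp [len, hd], by simpa [dg, hd] using h4⟩
  · rintro ⟨h1, h2⟩
    simp only [len, dg] at h1 h2
    match hd : t.deg, h1, h2 with
    | d₀ :: d₁ :: d₂ :: ds, _, h2 => exact ⟨d₀, d₁, d₂, ds, rfl, by simpa using h2⟩

open scoped Classical in
/-- The decomposition at the root edge of the polygons with a given number of triangles. -/
theorem sum_trees_succ {M : Type*} [AddCommMonoid M] (w : PolygonTree → M) (k : ℕ) :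
    ∑ t ∈ trees (k + 1), w t = (∑ t ∈ trees k, if t.Capable then w (cap t) else 0) +
      ∑ p ∈ Finset.HasAntidiagonal.antidiagonal k, ∑ t ∈ trees p.1, ∑ u ∈ trees p.2, w (join t u) := by
  have h : trees (k + 1) = ((trees k).filter Capable).image cap ∪
      (Finset.HasAntidiagonal.antidiagonal k).biUnion fun p => (trees p.1 ×ˢ trees p.2).image
        fun q => join q.1 q.2 := by
    ext t
    simp only [Finset.mem_union, Finset.mem_image, Finset.mem_filter, Finset.mem_biUnion,
      Finset.mem_product, mem_trees, Finset.HasAntidiagonal.mem_antidiagonal]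
    constructor
    · rintro ⟨ht, hk⟩
      cases t with
      | edge => simp [size] at hk
      | cap t =>
        rw [good_cap_iff] at ht
        exact Or.inl ⟨t, ⟨⟨ht.1, by simpa [size] using hk⟩, ht.2⟩, rfl⟩
      | join t u =>
        exact Or.inr ⟨(t.size, u.size), by simpa [size] using hk, (t, u), ⟨⟨ht.1, rfl⟩, ht.2, rfl⟩,
          rfl⟩
    · rintro (⟨t, ⟨⟨ht, rfl⟩, hc⟩, rfl⟩ | ⟨p, hp, ⟨t, u⟩, ⟨⟨ht, h1⟩, hu, h2⟩, rfl⟩)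
      · exact ⟨good_cap_iff.2 ⟨ht, hc⟩, rfl⟩
      · refine ⟨⟨ht, hu⟩, ?_⟩
        simp only [size]
        simp only at h1 h2
        omega
  rw [h, Finset.sum_union, Finset.sum_image, Finset.sum_filter, Finset.sum_biUnion]
  · congr 1
    refine Finset.sum_congr rfl fun p _ => ?_
    rw [Finset.sum_image, Finset.sum_product]
    rintro ⟨t, u⟩ - ⟨t', u'⟩ - h
    simpa using h
  · rintro ⟨i, j⟩ - ⟨i', j'⟩ - hne
    refine Finset.disjoint_left.2 fun t h1 h2 => hne ?_
    simp only [Finset.mem_image, Finset.mem_product, mem_trees] at h1 h2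
    obtain ⟨⟨t, u⟩, ⟨⟨-, rfl⟩, -, rfl⟩, rfl⟩ := h1
    obtain ⟨⟨t', u'⟩, ⟨⟨-, h3⟩, -, h4⟩, h5⟩ := h2
    simp only [join.injEq] at h5
    rw [← h3, ← h4, ← h5.1, ← h5.2]
  · intro t _ u _ h
    simpa using h
  · refine Finset.disjoint_left.2 fun t h1 h2 => ?_
    simp only [Finset.mem_image, Finset.mem_biUnion] at h1 h2
    obtain ⟨t, -, rfl⟩ := h1
    obtain ⟨_, -, ⟨q, -, h⟩⟩ := h2
    cases h

/-- Sums over the trees of a given size do not depend on the choice of the root edge. -/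
theorem sum_trees_rotate {M : Type*} [AddCommMonoid M] (w : List ℕ → M) (k : ℕ) :
    ∑ t ∈ trees k, w (t.deg.rotate 1) = ∑ t ∈ trees k, w t.deg := by
  classical
  choose! ρ h1 h2 h3 h4 using fun t : PolygonTree => exists_rotate (t := t)
  have hmem : ∀ t ∈ trees k, ρ t ∈ trees k := by
    intro t ht
    rw [mem_trees] at ht ⊢
    exact ⟨h1 t ht.1, (h2 t ht.1).trans ht.2⟩
  have hinj : Set.InjOn ρ (trees k) := by
    intro t ht u hu htu
    have ht := (mem_trees.1 ht).1
    have hu := (mem_trees.1 hu).1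
    obtain ⟨L, hL⟩ := exists_bdry_poly ht
    obtain ⟨M, hM⟩ := exists_bdry_poly hu
    have k1 := h4 t ht L hL
    have k2 := h4 u hu M hM
    rw [← htu] at k2
    obtain ⟨e, k3, k4, k5⟩ := k1.trans k2.symm
    refine poly_injective ht hu ⟨e, k3, k4, ?_⟩
    simp only [List.map_cons, List.map_nil, List.cons.injEq, and_true, List.map_rotate] at k5
    rw [hL, hM, List.map_singleton, List.rotate_injective 1 k5]
  have himg : (trees k).image ρ = trees k := by
    refine Finset.eq_of_subset_of_card_le (Finset.image_subset_iff.2 hmem) ?_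
    rw [Finset.card_image_of_injOn hinj]
  calc ∑ t ∈ trees k, w (t.deg.rotate 1) = ∑ t ∈ trees k, w (ρ t).deg :=
        Finset.sum_congr rfl fun t ht => by rw [h3 t (mem_trees.1 ht).1]
    _ = ∑ t ∈ (trees k).image ρ, w t.deg := (Finset.sum_image (f := fun t => w t.deg) hinj).symm
    _ = _ := by rw [himg]

theorem trees_zero : trees 0 = {edge} := by
  ext t
  rw [mem_trees, Finset.mem_singleton]
  constructor
  · rintro ⟨-, h⟩
    cases t with
    | edge => rfl
    | cap t => simp [size] at h
    | join t u => simp [size] at h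
  · rintro rfl; exact ⟨trivial, rfl⟩

section GF

variable {R : Type*} [CommRing R]

/-- The generating function of the good trees by the number of triangles, with weights. -/
noncomputable def gf (w : PolygonTree → R) : R⟦X⟧ := PowerSeries.mk fun k => ∑ t ∈ trees k, w t

/-- The generating function of the pairs of good trees, with weights. -/
noncomputable def gf₂ (w : PolygonTree → PolygonTree → R) : R⟦X⟧ :=
  PowerSeries.mk fun k => ∑ p ∈ Finset.HasAntidiagonal.antidiagonal k, ∑ t ∈ trees p.1, ∑ u ∈ trees p.2, w t u

theorem gf_congr {w w' : PolygonTree → R} (h : ∀ t, t.Good → w t = w' t) : gf w = gf w' := by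
  ext k
  simp only [gf, PowerSeries.coeff_mk]
  exact Finset.sum_congr rfl fun t ht => h t (mem_trees.1 ht).1

theorem gf₂_congr {w w' : PolygonTree → PolygonTree → R}
    (h : ∀ t u, t.Good → u.Good → w t u = w' t u) : gf₂ w = gf₂ w' := by
  ext k
  simp only [gf₂, PowerSeries.coeff_mk]
  exact Finset.sum_congr rfl fun p _ => Finset.sum_congr rfl fun t ht =>
    Finset.sum_congr rfl fun u hu => h t u (mem_trees.1 ht).1 (mem_trees.1 hu).1

theorem gf_zero : gf (fun _ => (0 : R)) = 0 := by
  ext k; simp [gf]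

theorem gf₂_zero : gf₂ (fun _ _ => (0 : R)) = 0 := by
  ext k; simp [gf₂]

theorem gf_add (w w' : PolygonTree → R) : gf (fun t => w t + w' t) = gf w + gf w' := by
  ext k; simp [gf, Finset.sum_add_distrib]

theorem gf_sub (w w' : PolygonTree → R) : gf (fun t => w t - w' t) = gf w - gf w' := by
  ext k; simp [gf, Finset.sum_sub_distrib]

theorem gf₂_mul (w w' : PolygonTree → R) : gf₂ (fun t u => w t * w' u) = gf w * gf w' := by
  ext k
  simp only [gf, gf₂, PowerSeries.coeff_mul, PowerSeries.coeff_mk, Finset.sum_mul_sum]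

theorem gf_const_mul (a : R) (w : PolygonTree → R) :
    gf (fun t => a * w t) = PowerSeries.C a * gf w := by
  ext k
  simp only [gf, PowerSeries.coeff_C_mul, PowerSeries.coeff_mk, Finset.mul_sum]

theorem map_gf {S : Type*} [CommRing S] (φ : R →+* S) (w : PolygonTree → R) :
    PowerSeries.map φ (gf w) = gf fun t => φ (w t) := by
  ext k; simp [gf]

theorem gf_rotate (w : List ℕ → R) : gf (fun t => w (t.deg.rotate 1)) = gf fun t => w t.deg := by
  ext k
  simp only [gf, PowerSeries.coeff_mk, sum_trees_rotate]

open scoped Classical in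
/-- The decomposition of polygons at the root edge. -/
theorem gf_eq (w : PolygonTree → R) : gf w = PowerSeries.C (w edge) +
    PowerSeries.X * gf (fun t => if t.Capable then w (cap t) else 0) +
      PowerSeries.X * gf₂ fun t u => w (join t u) := by
  ext k
  cases k with
  | zero => simp [gf, trees_zero]
  | succ k =>
    rw [map_add, map_add, PowerSeries.coeff_succ_X_mul, PowerSeries.coeff_succ_X_mul,
      PowerSeries.coeff_C, if_neg (Nat.succ_ne_zero k), zero_add]
    simp only [gf, gf₂, PowerSeries.coeff_mk]
    exact sum_trees_succ w k

end GF

end PolygonTree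

namespace PolygonTree

/-! ### Polygons by the degrees at the root edge -/

theorem two_le_len {t : PolygonTree} (ht : t.Good) : 2 ≤ t.len := by
  obtain ⟨d₀, d₁, ds, hd⟩ := ht.exists_deg
  simp [len, hd]

theorem le_of_mem_deg {t : PolygonTree} (ht : t.Good) :
    ∀ d ∈ t.deg, 1 ≤ d ∧ (t ≠ edge → 2 ≤ d) := by
  induction t with
  | edge => simp [deg]
  | cap t ih =>
    obtain ⟨ht, d₀, d₁, d₂, ds, hd, -⟩ := ht
    have hne : t ≠ edge := by rintro rfl; simp [deg] at hd
    have ih := fun d h => (ih ht d h).2 hne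
    rw [hd] at ih
    rw [deg_cap hd]
    simp only [List.mem_cons, forall_eq_or_imp] at ih ⊢
    refine ⟨by omega, by omega, fun d h => ?_⟩
    have := ih.2.2.2 d h
    omega
  | join t u ih ih' =>
    obtain ⟨d₀, d₁, ds, hd⟩ := ht.1.exists_deg
    obtain ⟨e₀, e₁, es, he⟩ := ht.2.exists_deg
    have h1 := ih ht.1
    have h2 := ih' ht.2
    have h3 : ∀ d ∈ ds, 2 ≤ d := by
      intro d h
      by_cases hne : t = edge
      · subst hne; simp only [deg, List.cons.injEq] at hd; rw [← hd.2.2] at h; simp at h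
      · exact (h1 d (by simp [hd, h])).2 hne
    have h4 : ∀ d ∈ es, 2 ≤ d := by
      intro d h
      by_cases hne : u = edge
      · subst hne; simp only [deg, List.cons.injEq] at he; rw [← he.2.2] at h; simp at h
      · exact (h2 d (by simp [he, h])).2 hne
    rw [hd] at h1
    rw [he] at h2
    rw [deg_join hd he]
    simp only [List.mem_cons, List.mem_append, forall_eq_or_imp] at h1 h2 ⊢
    refine ⟨by omega, by omega, ?_⟩
    rintro d (h | rfl | h)
    · have := h4 d h; omega
    · omega
    · have := h3 d h; omega

theorem two_le_dg {t : PolygonTree} (ht : t.Good) (hne : t ≠ edge) {i : ℕ} (hi : i < t.len) :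
    2 ≤ t.dg i := by
  refine (le_of_mem_deg ht _ ?_).2 hne
  rw [dg, List.getD_eq_getElem _ _ hi]
  exact List.getElem_mem hi

theorem ne_edge_of_len {t : PolygonTree} (h : 3 ≤ t.len) : t ≠ edge := by
  rintro rfl; simp [len, deg] at h

section Cap

variable {t : PolygonTree}

theorem len_cap (ht : (cap t).Good) : (cap t).len + 1 = t.len := by
  obtain ⟨ht, d₀, d₁, d₂, ds, hd, -⟩ := ht
  simp [len, deg_cap hd, hd]

theorem dg_cap_zero (ht : (cap t).Good) : (cap t).dg 0 = t.dg 0 + 1 := by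
  obtain ⟨ht, d₀, d₁, d₂, ds, hd, -⟩ := ht
  simp [dg, deg_cap hd, hd]

theorem dg_cap_one (ht : (cap t).Good) : (cap t).dg 1 = t.dg 2 + 1 := by
  obtain ⟨ht, d₀, d₁, d₂, ds, hd, -⟩ := ht
  simp [dg, deg_cap hd, hd]

theorem dg_cap_two (ht : (cap t).Good) : (cap t).dg 2 = t.dg 3 := by
  obtain ⟨ht, d₀, d₁, d₂, ds, hd, -⟩ := ht
  simp [dg, deg_cap hd, hd]

/-- A vertex with two boundary edges to the same vertex sees a third edge. -/
theorem three_le_dg (ht : t.Good) (hne : t ≠ edge) (h2 : t.len = 2) :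
    3 ≤ t.dg 0 ∧ 3 ≤ t.dg 1 := by
  cases t with
  | edge => exact absurd rfl hne
  | cap t =>
    have h := len_cap ht
    have hne := ne_edge_of_len (t := t) (by omega)
    have h1 := two_le_dg ht.1 hne (i := 0) (by omega)
    have h2 := two_le_dg ht.1 hne (i := 2) (by omega)
    rw [dg_cap_zero ht, dg_cap_one ht]
    omega
  | join t u =>
    obtain ⟨d₀, d₁, ds, hd⟩ := ht.1.exists_deg
    obtain ⟨e₀, e₁, es, he⟩ := ht.2.exists_deg
    simp [len, deg_join hd he] at h2

end Cap

section Join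

variable {t u : PolygonTree}

theorem len_join (ht : t.Good) (hu : u.Good) : (join t u).len + 1 = t.len + u.len := by
  obtain ⟨d₀, d₁, ds, hd⟩ := ht.exists_deg
  obtain ⟨e₀, e₁, es, he⟩ := hu.exists_deg
  simp [len, deg_join hd he, hd, he]; omega

theorem dg_join_zero (ht : t.Good) (hu : u.Good) : (join t u).dg 0 = t.dg 0 + 1 := by
  obtain ⟨d₀, d₁, ds, hd⟩ := ht.exists_deg
  obtain ⟨e₀, e₁, es, he⟩ := hu.exists_deg
  simp [dg, deg_join hd he, hd]

theorem dg_join_one (ht : t.Good) (hu : u.Good) : (join t u).dg 1 = u.dg 1 + 1 := by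
  obtain ⟨d₀, d₁, ds, hd⟩ := ht.exists_deg
  obtain ⟨e₀, e₁, es, he⟩ := hu.exists_deg
  simp [dg, deg_join hd he, he]

theorem dg_join_two (ht : t.Good) (hu : u.Good) (h : u.len = 2) :
    (join t u).dg 2 = t.dg 1 + u.dg 0 := by
  obtain ⟨d₀, d₁, ds, hd⟩ := ht.exists_deg
  obtain ⟨e₀, e₁, es, he⟩ := hu.exists_deg
  obtain rfl : es = [] := by simpa [len, he] using h
  simp [dg, deg_join hd he, he, hd]

theorem dg_join_two_of_len (ht : t.Good) (hu : u.Good) (h : u.len = 3) :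
    (join t u).dg 2 = u.dg 2 := by
  obtain ⟨d₀, d₁, ds, hd⟩ := ht.exists_deg
  obtain ⟨e₀, e₁, es, he⟩ := hu.exists_deg
  obtain ⟨e₂, rfl⟩ : ∃ e₂, es = [e₂] := by
    rw [← List.length_eq_one_iff]; simpa [len, he] using h
  simp [dg, deg_join hd he, he]

theorem dg_join_three (ht : t.Good) (hu : u.Good) (h : u.len = 3) :
    (join t u).dg 3 = t.dg 1 + u.dg 0 := by
  obtain ⟨d₀, d₁, ds, hd⟩ := ht.exists_deg
  obtain ⟨e₀, e₁, es, he⟩ := hu.exists_deg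
  obtain ⟨e₂, rfl⟩ : ∃ e₂, es = [e₂] := by
    rw [← List.length_eq_one_iff]; simpa [len, he] using h
  simp [dg, deg_join hd he, he, hd]

end Join

@[simp] theorem len_edge : edge.len = 2 := rfl
@[simp] theorem dg_edge_zero : edge.dg 0 = 1 := rfl
@[simp] theorem dg_edge_one : edge.dg 1 = 1 := rfl

/-- The edge is the only polygon with a boundary vertex of degree one. -/
theorem dg_zero_eq_one_iff {t : PolygonTree} (ht : t.Good) : t.dg 0 = 1 ↔ t = edge := by
  constructor
  · intro h
    by_contra hne
    have := two_le_dg ht hne (i := 0) (by have := two_le_len ht; omega)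
    omega
  · rintro rfl; rfl

section GF

variable {R : Type*} [CommRing R]

open scoped Classical

theorem gf_edge (a : R) : gf (fun t => if t = edge then a else 0) = PowerSeries.C a := by
  ext k
  rw [PowerSeries.coeff_C]
  simp only [gf, PowerSeries.coeff_mk, Finset.sum_ite_eq', mem_trees]
  simp only [size, show edge.Good from trivial, true_and, eq_comm]

/-- The decomposition at the root edge, for weights that vanish on polygons in which the origin of
the root edge has degree other than two. -/
theorem gf_two (w : PolygonTree → R) (h : ∀ t, t.Good → t.dg 0 ≠ 2 → w t = 0) :
    gf w = PowerSeries.X * gf fun u => w (join edge u) := by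
  have h1 : gf (fun t => if t.Capable then w (cap t) else 0) = 0 := by
    rw [← gf_zero]
    refine gf_congr fun t ht => ?_
    split_ifs with hc
    · refine h _ (good_cap_iff.2 ⟨ht, hc⟩) ?_
      rw [dg_cap_zero (good_cap_iff.2 ⟨ht, hc⟩)]
      have := two_le_dg ht (ne_edge_of_len hc.1) (i := 0) (by have := hc.1; omega)
      omega
    · rfl
  have h2 : gf₂ (fun t u => w (join t u)) = gf fun u => w (join edge u) := by
    have : gf₂ (fun t u => w (join t u)) =
        gf₂ fun t u => (if t = edge then 1 else 0) * w (join edge u) := by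
      refine gf₂_congr fun t u ht hu => ?_
      split_ifs with he
      · rw [he, one_mul]
      · rw [zero_mul]
        refine h _ ⟨ht, hu⟩ ?_
        rw [dg_join_zero ht hu]
        have := mt (dg_zero_eq_one_iff ht).1 he
        omega
    rw [this, gf₂_mul, gf_edge, map_one, one_mul]
  rw [gf_eq, h1, h2, h edge trivial (by simp)]
  simp

theorem gf_dg_one (w : ℕ → ℕ → R) :
    gf (fun t => w t.len (t.dg 1)) = gf fun t => w t.len (t.dg 0) := by
  refine Eq.trans ?_ (gf_rotate fun l => w l.length (l.getD 0 0))
  refine gf_congr fun t ht => ?_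
  obtain ⟨d₀, d₁, ds, hd⟩ := ht.exists_deg
  simp [len, dg, hd]

theorem gf_rotate_three (w : ℕ → ℕ → ℕ → R) :
    gf (fun t => if t.len = 3 then w (t.dg 1) (t.dg 2) (t.dg 0) else 0) =
      gf fun t => if t.len = 3 then w (t.dg 0) (t.dg 1) (t.dg 2) else 0 := by
  refine Eq.trans ?_ (gf_rotate fun l => if l.length = 3 then
    w (l.getD 0 0) (l.getD 1 0) (l.getD 2 0) else 0)
  refine gf_congr fun t ht => ?_
  rw [List.length_rotate]
  refine ite_congr rfl (fun h => ?_) fun _ => rfl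
  obtain ⟨a, b, c, h⟩ := List.length_eq_three.1 h
  simp [dg, h]

/-- Polygons in which the origin of the root edge has degree two: the root edge belongs to a
triangle that can be cut off there. -/
theorem gf_dg_two (g : ℕ → R) :
    gf (fun t => if 3 ≤ t.len ∧ t.dg 0 = 2 then g t.len else 0) =
      PowerSeries.X * gf fun t => g (t.len + 1) := by
  rw [gf_two _ fun t _ h => if_neg fun h' => h h'.2]
  congr 1
  refine gf_congr fun u hu => ?_
  have h1 := len_join (t := edge) trivial hu
  have h2 := dg_join_zero (t := edge) trivial hu
  have h3 := two_le_len hu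
  simp only [len_edge, dg_edge_zero] at h1 h2
  rw [if_pos ⟨by omega, by omega⟩, show (join edge u).len = u.len + 1 by omega]

/-- Polygons in which the origin of the root edge has degree three. -/
theorem gf_dg_three (g : ℕ → R) :
    gf (fun t => if 3 ≤ t.len ∧ t.dg 0 = 3 then g t.len else 0) =
      PowerSeries.X ^ 2 * (gf (fun t => if 3 ≤ t.len then g t.len else 0) -
          gf fun t => if 3 ≤ t.len ∧ t.dg 0 = 2 then g t.len else 0) +
        PowerSeries.X * gf₂ fun t u =>
          if 3 ≤ t.len ∧ t.dg 0 = 2 then g (t.len + u.len - 1) else 0 := by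
  rw [gf_eq, if_neg (by simp), map_zero, zero_add, sq, mul_assoc]
  congr 2
  · have h1 : gf (fun t => if t.Capable then
        if 3 ≤ (cap t).len ∧ (cap t).dg 0 = 3 then g (cap t).len else 0 else 0) =
        gf fun t => if 4 ≤ t.len ∧ t.dg 0 = 2 ∧ 4 ≤ t.dg 1 then g (t.len - 1) else 0 := by
      refine gf_congr fun t ht => ?_
      by_cases hc : t.Capable
      · have hg := good_cap_iff.2 ⟨ht, hc⟩
        have h1 := len_cap hg
        rw [if_pos hc, dg_cap_zero hg, show (cap t).len = t.len - 1 by omega]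
        refine if_congr ?_ rfl rfl
        have := hc.2
        omega
      · rw [if_neg hc, if_neg]
        exact fun h => hc ⟨by omega, h.2.2⟩
    have h2 : gf (fun t => if 3 ≤ t.len ∧ t.dg 0 = 2 then g t.len else 0) =
        gf fun t => if 3 ≤ t.len ∧ t.dg 1 = 2 then g t.len else 0 :=
      (gf_dg_one fun n d => if 3 ≤ n ∧ d = 2 then g n else 0).symm
    rw [h1, gf_two _ fun t _ h => if_neg fun h' => h h'.2.1, h2, ← gf_sub]
    congr 1
    refine gf_congr fun u hu => ?_
    have h1 := len_join (t := edge) trivial hu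
    rw [dg_join_zero (t := edge) trivial hu, dg_join_one (t := edge) trivial hu,
      show (join edge u).len = u.len + 1 by simp at h1; omega]
    by_cases hl : 3 ≤ u.len
    · have := two_le_dg hu (ne_edge_of_len hl) (i := 1) (by omega)
      by_cases h4 : u.dg 1 = 2
      · rw [if_neg (by omega), if_pos hl, if_pos ⟨hl, h4⟩, sub_self]
      · rw [if_pos ⟨by omega, by simp, by omega⟩, if_pos hl, if_neg (by omega), sub_zero,
          Nat.add_sub_cancel]
    · rw [if_neg (by omega), if_neg hl, if_neg (by omega), sub_self]
  · refine gf₂_congr fun t u ht hu => ?_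
    have h1 := len_join ht hu
    have h2 := two_le_len hu
    have h3 := two_le_len ht
    rw [dg_join_zero ht hu, show (join t u).len = t.len + u.len - 1 by omega]
    refine if_congr ⟨fun h => ⟨?_, by omega⟩, fun h => by omega⟩ rfl rfl
    by_contra h4
    rcases eq_or_ne t edge with rfl | hne
    · simp at h
    · have := three_le_dg ht hne (by omega)
      omega

end GF

end PolygonTree

namespace PolygonTree

open scoped Classical

/-! ### The equations between the generating functions -/

section Kernel

variable {R : Type*} [CommRing R]

/-- The generating function of the digons. -/
noncomputable def digons (R : Type*) [CommRing R] : R⟦X⟧ := gf fun t => if t.len = 2 then 1 else 0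

/-- The functional equation for the polygons, counted by the number of triangles and, with the
weight `x`, by the number of boundary vertices. -/
theorem gf_len_eq (x : R) {K : R⟦X⟧} (hK : K = gf fun t => x ^ (t.len - 2)) :
    PowerSeries.C x * K = PowerSeries.C x + (PowerSeries.X - PowerSeries.X ^ 3) *
      (K - digons R - PowerSeries.X * PowerSeries.C x * K + PowerSeries.C x ^ 2 * K ^ 2) := by
  have hP : gf (fun t => if 3 ≤ t.len then x ^ (t.len - 2) else 0) = K - digons R := by
    rw [hK, digons, ← gf_sub]
    refine gf_congr fun t ht => ?_
    have := two_le_len ht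
    by_cases h : t.len = 2
    · simp [h]
    · rw [if_pos (by omega), if_neg h, sub_zero]
  have h2 : gf (fun t => if 3 ≤ t.len ∧ t.dg 0 = 2 then x ^ (t.len - 2) else 0) =
      PowerSeries.X * (PowerSeries.C x * K) := by
    rw [gf_dg_two fun n => x ^ (n - 2), hK, ← gf_const_mul]
    congr 1
    refine gf_congr fun t ht => ?_
    have := two_le_len ht
    rw [← pow_succ', show t.len + 1 - 2 = t.len - 2 + 1 by omega]
  have h3 := gf_dg_three fun n => x ^ (n - 2)
  have h4 : gf₂ (fun t u : PolygonTree =>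
      if 3 ≤ t.len ∧ t.dg 0 = 2 then x ^ (t.len + u.len - 1 - 2) else 0) =
      PowerSeries.X * (PowerSeries.C x * K) * (PowerSeries.C x * K) := by
    rw [← h2, hK, ← gf_const_mul, ← gf₂_mul]
    refine gf₂_congr fun t u ht hu => ?_
    have := two_le_len hu
    rw [ite_mul, zero_mul]
    refine ite_congr rfl (fun h => ?_) fun _ => rfl
    rw [← pow_succ', ← pow_add]
    congr 1
    omega
  have h5 : PowerSeries.C x *
      gf (fun t => if t.Capable then x ^ ((cap t).len - 2) else 0) =
      gf (fun t => if 3 ≤ t.len then x ^ (t.len - 2) else 0) -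
        gf (fun t => if 3 ≤ t.len ∧ t.dg 0 = 2 then x ^ (t.len - 2) else 0) -
        gf (fun t => if 3 ≤ t.len ∧ t.dg 0 = 3 then x ^ (t.len - 2) else 0) := by
    rw [← gf_const_mul, ← gf_sub, ← gf_sub]
    refine Eq.trans ?_ (gf_dg_one fun n d => (if 3 ≤ n then x ^ (n - 2) else 0) -
      (if 3 ≤ n ∧ d = 2 then x ^ (n - 2) else 0) - (if 3 ≤ n ∧ d = 3 then x ^ (n - 2) else 0))
    refine gf_congr fun t ht => ?_
    by_cases h : 3 ≤ t.len
    · have h0 := two_le_dg ht (ne_edge_of_len h) (i := 1) (by omega)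
      by_cases hc : 4 ≤ t.dg 1
      · have h1 := len_cap (good_cap_iff.2 ⟨ht, h, hc⟩)
        rw [if_pos ⟨h, hc⟩, if_pos h, if_neg (by omega), if_neg (by omega), sub_zero, sub_zero,
          ← pow_succ']
        congr 1
        omega
      · rw [if_neg fun k => hc k.2, if_pos h]
        rcases (show t.dg 1 = 2 ∨ t.dg 1 = 3 by omega) with hd | hd <;> simp [hd, h]
    · rw [if_neg fun k => h k.1, if_neg h, if_neg fun k => h k.1, if_neg fun k => h k.1]
      simp
  have h6 : gf₂ (fun t u => x ^ ((join t u).len - 2)) = PowerSeries.C x * K * K := by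
    rw [hK, ← gf_const_mul, ← gf₂_mul]
    refine gf₂_congr fun t u ht hu => ?_
    have h0 := len_join ht hu
    have h1 := two_le_len ht
    have h2 := two_le_len hu
    rw [← pow_succ', ← pow_add]
    congr 1
    omega
  have h7 := gf_eq fun t => x ^ (t.len - 2)
  rw [← hK, h6] at h7
  rw [hP, h2, h4] at h3
  rw [hP, h2, h3] at h5
  simp only [len_edge, Nat.sub_self, pow_zero, map_one] at h7
  linear_combination PowerSeries.C x * h7 + PowerSeries.X * h5

end Kernel

section Triangles

/-- The generating function of the triangles with a weight on the degrees of their vertices. -/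
noncomputable def triangles (w : ℕ → ℕ → ℕ → ℚ) : ℚ⟦X⟧ :=
  gf fun t => if t.len = 3 then w (t.dg 0) (t.dg 1) (t.dg 2) else 0

theorem triangles_rotate (w : ℕ → ℕ → ℕ → ℚ) :
    triangles (fun a b c => w b c a) = triangles w := gf_rotate_three w

/-- Digons are capped triangles, or the edge. -/
theorem digons_eq :
    digons ℚ = 1 + PowerSeries.X * triangles fun _ b _ => if 4 ≤ b then 1 else 0 := by
  have h1 : gf₂ (fun t u => if (join t u).len = 2 then (1 : ℚ) else 0) = 0 := by
    rw [← gf₂_zero]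
    refine gf₂_congr fun t u ht hu => if_neg ?_
    have h0 := len_join ht hu
    have h1 := two_le_len ht
    have h2 := two_le_len hu
    omega
  rw [digons, gf_eq, h1, triangles]
  simp only [len_edge, if_true, map_one, mul_zero, add_zero]
  congr 2
  refine gf_congr fun t ht => ?_
  by_cases hc : t.Capable
  · have := len_cap (good_cap_iff.2 ⟨ht, hc⟩)
    have h4 := hc.2
    rw [if_pos hc, if_pos h4]
    exact if_congr (by omega) rfl rfl
  · rw [if_neg hc, ← ite_and, if_neg fun h => hc ⟨by omega, h.2⟩]

theorem triangles_dg_two :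
    triangles (fun a _ _ => if a = 2 then 1 else 0) = PowerSeries.X * digons ℚ := by
  have h := gf_dg_two fun n => if n = 3 then (1 : ℚ) else 0
  rw [digons, triangles]
  refine Eq.trans (gf_congr fun t _ => ?_) (h.trans ?_)
  · rw [← ite_and, ← ite_and]
    exact if_congr (by omega) rfl rfl
  · congr 1
    exact gf_congr fun t _ => if_congr (by omega) rfl rfl

theorem triangles_dg_three :
    triangles (fun a _ _ => if a = 3 then 1 else 0) =
      PowerSeries.X ^ 2 * (triangles (fun _ _ _ => 1) - PowerSeries.X * digons ℚ) := by
  have h := gf_dg_three fun n => if n = 3 then (1 : ℚ) else 0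
  have h1 : gf₂ (fun t u : PolygonTree => if 3 ≤ t.len ∧ t.dg 0 = 2 then
      if t.len + u.len - 1 = 3 then (1 : ℚ) else 0 else 0) = 0 := by
    rw [← gf₂_zero]
    refine gf₂_congr fun t u ht hu => ?_
    have h2 := two_le_len hu
    rw [← ite_and, if_neg (by omega)]
  rw [h1, mul_zero, add_zero] at h
  rw [← triangles_dg_two]
  refine Eq.trans (gf_congr fun t _ => ?_) (h.trans ?_)
  · rw [← ite_and, ← ite_and]
    exact if_congr (by omega) rfl rfl
  · congr 2
    · exact gf_congr fun t _ => by rw [← ite_and]; exact if_congr (by omega) rfl rfl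
    · exact gf_congr fun t _ => by rw [← ite_and, ← ite_and]; exact if_congr (by omega) rfl rfl

/-- Triangles in which the first and the third vertex have degree at most three.  Either there is
nothing inside the triangle, or both vertices have degree three.  In the latter case the removal of
three triangles leaves a digon other than the edge, and the second vertex has degree at least four,
where the condition `P` is assumed to be constant. -/
theorem triangles_le_three (P : ℕ → Prop) (ε : ℚ) (h2 : P 2)
    (hε : ∀ d, 3 ≤ d → (if P (d + 1) then 1 else 0) = ε) :
    triangles (fun a b c => if a ≤ 3 ∧ c ≤ 3 ∧ P b then 1 else 0) =
      PowerSeries.X + PowerSeries.C ε * PowerSeries.X ^ 3 * (digons ℚ - 1) := by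
  have h1 : gf₂ (fun t u => if (join t u).len = 3 then
      if (join t u).dg 0 ≤ 3 ∧ (join t u).dg 2 ≤ 3 ∧ P ((join t u).dg 1) then (1 : ℚ) else 0
      else 0) = 1 := by
    have : (1 : ℚ⟦X⟧) = gf₂ fun t u =>
        (if t = edge then (1 : ℚ) else 0) * (if u = edge then 1 else 0) := by
      rw [gf₂_mul, gf_edge, map_one, mul_one]
    rw [this]
    refine gf₂_congr fun t u ht hu => ?_
    have h0 := len_join ht hu
    have k1 := two_le_len ht
    have k2 := two_le_len hu
    by_cases hl : t.len = 2 ∧ u.len = 2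
    · rw [if_pos (by omega), dg_join_zero ht hu, dg_join_one ht hu, dg_join_two ht hu hl.2]
      by_cases h3 : t = edge
      · subst h3
        by_cases h4 : u = edge
        · subst h4; simpa using h2
        · have := three_le_dg hu h4 hl.2
          rw [if_neg (by simp; omega), if_neg h4, mul_zero]
      · have := three_le_dg ht h3 hl.1
        rw [if_neg (by omega), if_neg h3, zero_mul]
    · rw [if_neg (by omega)]
      by_cases h3 : t = edge
      · by_cases h4 : u = edge
        · exact absurd (by simp [h3, h4]) hl
        · rw [if_neg h4, mul_zero]
      · rw [if_neg h3, zero_mul]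
  have h3 : gf (fun t => if t.Capable then if (cap t).len = 3 then
      if (cap t).dg 0 ≤ 3 ∧ (cap t).dg 2 ≤ 3 ∧ P ((cap t).dg 1) then (1 : ℚ) else 0 else 0 else 0)
      = PowerSeries.X * (PowerSeries.X * (PowerSeries.C ε * (digons ℚ - 1))) := by
    have he : edge.Good := trivial
    have e1 : ∀ t : PolygonTree, t.Good → (if t.Capable then if (cap t).len = 3 then
        if (cap t).dg 0 ≤ 3 ∧ (cap t).dg 2 ≤ 3 ∧ P ((cap t).dg 1) then (1 : ℚ) else 0 else 0 else 0)
        = if t.len = 4 ∧ t.dg 0 = 2 ∧ 4 ≤ t.dg 1 ∧ t.dg 3 ≤ 3 ∧ P (t.dg 2 + 1) then 1 else 0 := by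
      intro t ht
      by_cases hc : t.Capable
      · have hg := good_cap_iff.2 ⟨ht, hc⟩
        have := len_cap hg
        have k1 := two_le_dg ht (ne_edge_of_len hc.1) (i := 0) (by have := hc.1; omega)
        have := hc.2
        rw [if_pos hc, ← ite_and, dg_cap_zero hg, dg_cap_one hg, dg_cap_two hg]
        refine if_congr ⟨fun h => ?_, fun h => ?_⟩ rfl rfl
        · exact ⟨by omega, by omega, by omega, h.2.2.1, h.2.2.2⟩
        · exact ⟨by omega, by omega, h.2.2.2⟩
      · rw [if_neg hc, if_neg fun h => hc ⟨by omega, h.2.2.1⟩]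
    have e2 : ∀ u : PolygonTree, u.Good → (if (join edge u).len = 4 ∧ (join edge u).dg 0 = 2 ∧
        4 ≤ (join edge u).dg 1 ∧ (join edge u).dg 3 ≤ 3 ∧ P ((join edge u).dg 2 + 1) then (1 : ℚ)
        else 0) = if u.len = 3 ∧ u.dg 0 = 2 ∧ 3 ≤ u.dg 1 ∧ P (u.dg 2 + 1) then 1 else 0 := by
      intro u hu
      have k0 := len_join (t := edge) trivial hu
      rw [len_edge] at k0
      by_cases h3 : u.len = 3
      · have k1 := two_le_dg hu (ne_edge_of_len h3.ge) (i := 0) (by omega)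
        rw [dg_join_zero he hu, dg_join_one he hu, dg_join_two_of_len he hu h3,
          dg_join_three he hu h3, dg_edge_zero, dg_edge_one]
        refine if_congr ⟨fun h => ?_, fun h => ?_⟩ rfl rfl
        · exact ⟨h3, by omega, by omega, h.2.2.2.2⟩
        · exact ⟨by omega, rfl, by omega, by omega, h.2.2.2⟩
      · rw [if_neg (by omega), if_neg (by omega)]
    have e3 : ∀ u : PolygonTree, u.Good → (if (join edge u).len = 3 ∧ (join edge u).dg 0 = 2 ∧
        3 ≤ (join edge u).dg 1 ∧ P ((join edge u).dg 2 + 1) then (1 : ℚ) else 0) =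
        ε * ((if u.len = 2 then 1 else 0) - if u = edge then 1 else 0) := by
      intro u hu
      have k0 := len_join (t := edge) trivial hu
      rw [len_edge] at k0
      by_cases h3 : u.len = 2
      · rw [dg_join_zero he hu, dg_join_one he hu, dg_join_two he hu h3,
          dg_edge_zero, dg_edge_one, if_pos h3]
        by_cases h4 : u = edge
        · subst h4; simp
        · have := three_le_dg hu h4 h3
          rw [if_neg h4, sub_zero, mul_one, ← hε (1 + u.dg 0) (by omega)]
          refine if_congr ⟨fun h => h.2.2.2, fun h => ⟨by omega, rfl, by omega, h⟩⟩ rfl rfl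
      · rw [if_neg (by omega), if_neg h3, if_neg (by rintro rfl; exact h3 rfl), sub_zero, mul_zero]
    rw [gf_congr e1, gf_two _ fun t _ h => if_neg fun h' => h h'.2.1, gf_congr e2,
      gf_two _ fun t _ h => if_neg fun h' => h h'.2.1, gf_congr e3, gf_const_mul, gf_sub, gf_edge,
      digons, map_one]
  rw [triangles, gf_eq, h1, h3, if_neg (by simp), map_zero]
  ring

/-- Inclusion and exclusion over the vertices of degree at most three. -/
theorem triangles_four_le :
    (1 - PowerSeries.X ^ 2) * (PowerSeries.X *
      triangles fun a b c => if 4 ≤ a ∧ 4 ≤ b ∧ 4 ≤ c then 1 else 0) =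
    (1 - 5 * PowerSeries.X ^ 2 + 5 * PowerSeries.X ^ 4 - 3 * PowerSeries.X ^ 6) *
      (digons ℚ - 1) := by
  set A := triangles fun _ _ _ => 1 with hA
  set s₁ := triangles fun a _ _ => if a ≤ 3 then 1 else 0 with hs₁
  set s₂ := triangles fun a b c => if a ≤ 3 ∧ c ≤ 3 ∧ True then 1 else 0 with hs₂
  set s₃ := triangles fun a b c => if a ≤ 3 ∧ c ≤ 3 ∧ b ≤ 3 then 1 else 0 with hs₃
  have h₁ : s₁ = PowerSeries.X * digons ℚ +
      PowerSeries.X ^ 2 * (A - PowerSeries.X * digons ℚ) := by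
    rw [hA, ← triangles_dg_three, ← triangles_dg_two, hs₁, triangles, triangles, triangles,
      ← gf_add]
    refine gf_congr fun t ht => ?_
    by_cases h : t.len = 3
    · have := two_le_dg ht (ne_edge_of_len h.ge) (i := 0) (by omega)
      simp only [if_pos h]
      by_cases h3 : t.dg 0 ≤ 3
      · rcases (show t.dg 0 = 2 ∨ t.dg 0 = 3 by omega) with hd | hd <;> simp [hd]
      · rw [if_neg h3, if_neg (by omega), if_neg (by omega), add_zero]
    · simp [h]
  have h₂ : s₂ = PowerSeries.X + PowerSeries.X ^ 3 * (digons ℚ - 1) := by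
    have h := triangles_le_three (fun _ => True) 1 trivial (by simp)
    rw [map_one, one_mul] at h
    rw [← h, hs₂]
    congr! 5
  have h₃ : s₃ = PowerSeries.X := by
    have h := triangles_le_three (fun b => b ≤ 3) 0 (by norm_num) fun d hd => if_neg (by omega)
    rw [map_zero, zero_mul, zero_mul, add_zero] at h
    rw [← h, hs₃]
    congr! 5
  have hd : digons ℚ = 1 + PowerSeries.X * (A - s₁) := by
    have : triangles (fun _ b _ => if 4 ≤ b then 1 else 0) = A - s₁ := by
      rw [hs₁, ← triangles_rotate fun a _ _ => if a ≤ 3 then 1 else 0, hA, triangles, triangles,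
        triangles, ← gf_sub]
      refine gf_congr fun t ht => ?_
      by_cases h : t.len = 3
      · simp only [if_pos h]
        by_cases h4 : 4 ≤ t.dg 1
        · rw [if_pos h4, if_neg (by omega), sub_zero]
        · rw [if_neg h4, if_pos (by omega), sub_self]
      · simp [h]
    rw [← this]
    exact digons_eq
  have hi : triangles (fun a b c => if 4 ≤ a ∧ 4 ≤ b ∧ 4 ≤ c then 1 else 0) =
      A - s₁ - s₁ - s₁ + s₂ + s₂ + s₂ - s₃ := by
    have r₁ := triangles_rotate fun a _ _ => if a ≤ 3 then 1 else 0
    have r₁' := triangles_rotate fun _ b _ => if b ≤ 3 then 1 else 0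
    have r₂ := triangles_rotate fun a b c => if a ≤ 3 ∧ c ≤ 3 ∧ True then 1 else 0
    have r₂' := triangles_rotate fun a b c => if b ≤ 3 ∧ a ≤ 3 ∧ True then 1 else 0
    rw [r₁, ← hs₁] at r₁'
    rw [r₂, ← hs₂] at r₂'
    rw [← hs₁] at r₁
    rw [← hs₂] at r₂
    calc _ = A - s₁ - triangles (fun _ b _ => if b ≤ 3 then 1 else 0) -
          triangles (fun _ _ c => if c ≤ 3 then 1 else 0) + s₂ +
          triangles (fun a b c => if b ≤ 3 ∧ a ≤ 3 ∧ True then 1 else 0) +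
          triangles (fun a b c => if c ≤ 3 ∧ b ≤ 3 ∧ True then 1 else 0) - s₃ := ?_
      _ = _ := by rw [r₁, r₁', r₂, r₂']
    simp only [hA, hs₁, hs₂, hs₃, triangles, ← gf_sub, ← gf_add]
    refine gf_congr fun t _ => ?_
    by_cases hl : t.len = 3
    · simp only [if_pos hl, ← not_lt (b := 4), Nat.lt_succ_iff]
      by_cases ha : t.dg 0 ≤ 3 <;> by_cases hb : t.dg 1 ≤ 3 <;> by_cases hc : t.dg 2 ≤ 3 <;>
        norm_num [ha, hb, hc]
    · simp [hl]
  rw [hi]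
  linear_combination (3 * PowerSeries.X ^ 2 - 1) * hd - 2 * PowerSeries.X * h₁ +
    3 * PowerSeries.X * (1 - PowerSeries.X ^ 2) * h₂ - PowerSeries.X * (1 - PowerSeries.X ^ 2) * h₃

end Triangles

end PolygonTree

namespace PowerSeries

/-! ### Solving the functional equation -/

/-- A contraction of the ring of formal power series has a fixed point. -/
theorem exists_fixed_point {R : Type*} [CommRing R] (Φ : R⟦X⟧ → R⟦X⟧)
    (hΦ : ∀ (n : ℕ) (a b : R⟦X⟧), X ^ n ∣ a - b → X ^ (n + 1) ∣ Φ a - Φ b) : ∃ a, Φ a = a := by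
  have h1 : ∀ n k, (X : R⟦X⟧) ^ n ∣ Φ^[n + k] 0 - Φ^[n] 0 := by
    intro n k
    induction n with
    | zero => simp
    | succ n ih =>
      rw [show n + 1 + k = (n + k) + 1 by omega, Function.iterate_succ_apply',
        Function.iterate_succ_apply']
      exact hΦ n _ _ ih
  have h2 : ∀ n, X ^ n ∣ (mk fun m => coeff m (Φ^[m + 1] 0)) - Φ^[n] 0 := by
    intro n
    rw [X_pow_dvd_iff]
    intro m hm
    have h := X_pow_dvd_iff.1 (h1 (m + 1) (n - (m + 1))) m m.lt_succ_self
    rw [map_sub, show m + 1 + (n - (m + 1)) = n by omega] at h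
    rw [map_sub, coeff_mk, ← neg_sub, h, neg_zero]
  refine ⟨mk fun m => coeff m (Φ^[m + 1] 0), ?_⟩
  ext n
  have h3 := hΦ n _ _ (h2 n)
  rw [← Function.iterate_succ_apply' Φ] at h3
  have h4 := X_pow_dvd_iff.1 (dvd_sub h3 (h2 (n + 1))) n n.lt_succ_self
  rw [sub_sub_sub_cancel_right, map_sub, sub_eq_zero] at h4
  exact h4

/-- The functional equation determines the series together with its value at `x = 0`, because the
factor `x` can be cancelled. -/
theorem kernel_unique {e e' : ℚ⟦X⟧} {K K' : (Polynomial ℚ)⟦X⟧}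
    (h : C Polynomial.X * K = C Polynomial.X + (X - X ^ 3) *
      (K - map Polynomial.C e - X * C Polynomial.X * K + C Polynomial.X ^ 2 * K ^ 2))
    (h' : C Polynomial.X * K' = C Polynomial.X + (X - X ^ 3) *
      (K' - map Polynomial.C e' - X * C Polynomial.X * K' + C Polynomial.X ^ 2 * K' ^ 2))
    (he : map (Polynomial.evalRingHom 0) K = e) (he' : map (Polynomial.evalRingHom 0) K' = e') :
    e = e' := by
  have hx : ∀ n (D : (Polynomial ℚ)⟦X⟧), X ^ n ∣ C Polynomial.X * D → X ^ n ∣ D := by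
    intro n D hD
    rw [X_pow_dvd_iff] at hD ⊢
    intro m hm
    have := hD m hm
    rw [coeff_C_mul] at this
    exact (mul_eq_zero.1 this).resolve_left Polynomial.X_ne_zero
  have hmap : ∀ {A B : Type} [CommRing A] [CommRing B] (φ : A →+* B) (n : ℕ) (a : A⟦X⟧),
      X ^ n ∣ a → X ^ n ∣ map φ a := by
    intro A B _ _ φ n a ha
    have := map_dvd (map φ) ha
    rwa [map_pow, map_X] at this
  -- the right-hand side of the difference gains a factor `X`
  have key : ∀ n, X ^ n ∣ K - K' := by
    intro n
    induction n with
    | zero => simp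
    | succ n ih =>
      refine hx _ _ ?_
      have h1 : X ^ n ∣ map Polynomial.C e - map Polynomial.C e' := by
        rw [← map_sub, ← he, ← he', ← map_sub]
        exact hmap _ _ _ (hmap _ _ _ ih)
      have h2 : X ^ n ∣ (K - K') - (map Polynomial.C e - map Polynomial.C e') -
          X * C Polynomial.X * (K - K') + C Polynomial.X ^ 2 * (K + K') * (K - K') :=
        dvd_add (dvd_sub (dvd_sub ih h1) (ih.mul_left _)) (ih.mul_left _)
      have h3 := mul_dvd_mul (dvd_refl (X : (Polynomial ℚ)⟦X⟧)) h2
      rw [pow_succ']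
      refine (h3.mul_left (1 - X ^ 2)).trans (dvd_of_eq ?_)
      linear_combination h' - h
  have : K = K' := by
    ext1 n
    have := X_pow_dvd_iff.1 (key (n + 1)) n n.lt_succ_self
    rwa [map_sub, sub_eq_zero] at this
  rw [← he, ← he', this]

/-- The value at `x = 0` of the solution of the functional equation.  The solution is
`v * (G - θ * v * G ^ 2)`, where `θ = s ^ 2`, `v = (κ - 2 * θ)⁻¹` and `G` is the generating
function of the Catalan numbers at `s * v * x`. -/
theorem exists_kernel_solution : ∃ (s v : ℚ⟦X⟧) (K : (Polynomial ℚ)⟦X⟧),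
    (1 + X ^ 2 - X ^ 4 - 2 * s ^ 2) * v = 1 ∧ s * (1 + X ^ 2 - X ^ 4 - 2 * s ^ 2) = X - X ^ 3 ∧
    C Polynomial.X * K = C Polynomial.X + (X - X ^ 3) *
      (K - map Polynomial.C (v * (1 - s ^ 2 * v)) - X * C Polynomial.X * K +
        C Polynomial.X ^ 2 * K ^ 2) ∧
    map (Polynomial.evalRingHom 0) K = v * (1 - s ^ 2 * v) := by
  have hunit : ∀ a : ℚ⟦X⟧, IsUnit (1 + X * a) := fun a => isUnit_iff_constantCoeff.2 (by simp)
  obtain ⟨μ, hμ⟩ := (hunit (X - X ^ 3)).exists_left_inv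
  -- with `s = X * b`, the equation for `s` says that `b` is a fixed point of a contraction
  obtain ⟨b, hb⟩ := exists_fixed_point (fun b : ℚ⟦X⟧ => μ * (1 - X ^ 2 + 2 * X ^ 2 * b ^ 3)) <| by
    rintro n a b ⟨d, hd⟩
    refine ⟨μ * 2 * X * (a ^ 2 + a * b + b ^ 2) * d, ?_⟩
    linear_combination μ * 2 * X ^ 2 * (a ^ 2 + a * b + b ^ 2) * hd
  obtain ⟨v, hv⟩ := (hunit (X - X ^ 3 - 2 * X * b ^ 2)).exists_right_inv
  have hs : (X * b) * (1 + X ^ 2 - X ^ 4 - 2 * (X * b) ^ 2) = X - X ^ 3 := by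
    linear_combination (1 - X ^ 2 + 2 * X ^ 2 * b ^ 3) * X * hμ -
      X * (1 + X ^ 2 - X ^ 4) * hb
  obtain ⟨G, hG⟩ := exists_fixed_point (fun G : (Polynomial ℚ)⟦X⟧ =>
      1 + map Polynomial.C (X * b * v) * C Polynomial.X * G ^ 2) <| by
    rintro n a c ⟨d, hd⟩
    rw [map_mul, map_mul, map_X]
    refine ⟨map Polynomial.C b * map Polynomial.C v * C Polynomial.X * (a + c) * d, ?_⟩
    linear_combination X * map Polynomial.C b * map Polynomial.C v * C Polynomial.X * (a + c) * hd
  obtain ⟨s, hs'⟩ : ∃ s : ℚ⟦X⟧, s = X * b := ⟨_, rfl⟩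
  rw [← hs'] at hs hG
  have hv : (1 + X ^ 2 - X ^ 4 - 2 * s ^ 2) * v = 1 := by
    rw [hs']; linear_combination hv
  refine ⟨s, v, map Polynomial.C v * (G - map Polynomial.C (s ^ 2 * v) * G ^ 2), hv, hs, ?_, ?_⟩
  · have hu : (X - X ^ 3) * v = s := by linear_combination s * hv - v * hs
    replace hv := congrArg (map Polynomial.C) hv
    replace hu := congrArg (map Polynomial.C) hu
    simp only [map_mul, map_sub, map_add, map_pow, map_one, map_X, map_ofNat] at hv hu hG ⊢
    generalize map Polynomial.C s = σ at *
    generalize map Polynomial.C v = ν at *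
    generalize C (Polynomial.X : Polynomial ℚ) = x at *
    have hK : x * (ν * (G - σ ^ 2 * ν * G ^ 2)) = ν * (G * (x - σ) + σ) := by
      linear_combination -ν * σ * hG
    linear_combination ((1 + X ^ 2 - X ^ 4) - (X - X ^ 3) *
        (x * (ν * (G - σ ^ 2 * ν * G ^ 2)) + ν * (G * (x - σ) + σ))) * hK -
      ((G - σ ^ 2 * ν * G ^ 2 - 1 + σ ^ 2 * ν) + ν * (G * (x - σ) + σ) ^ 2) * hu +
      (G * (x - σ) + σ) * hv - (x - 2 * σ) * hG
  · have h0 : map (Polynomial.evalRingHom 0) (C (Polynomial.X : Polynomial ℚ)) = 0 := by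
      rw [map_C]; simp
    have hc : ∀ a : ℚ⟦X⟧, map (Polynomial.evalRingHom 0) (map Polynomial.C a) = a := by
      intro a; ext n; simp
    have h1 : map (Polynomial.evalRingHom 0) G = 1 := by
      rw [← hG]
      simp only [map_add, map_mul, h0, map_one, mul_zero, zero_mul, add_zero]
    rw [map_mul, map_sub, map_mul, map_pow, h1, hc, hc]
    ring

/-- The elimination of the parameter `θ`: the value `Y + 1` of the kernel solution is a rational
function of `θ`, which is itself a root of a cubic polynomial. -/
theorem cubic_of_parameter {R : Type*} [CommRing R] {T θ w Y : R} (hw : w = 1 + T - T ^ 2 - 2 * θ)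
    (hY : (Y + 1) * w ^ 2 = 1 + T - T ^ 2 - 3 * θ) (hθ : θ * w ^ 2 = T * (1 - T) ^ 2) :
    w ^ 6 * (16 * T ^ 2 * (T - 1) ^ 4 * Y ^ 3
      + (T ^ 8 + 12 * T ^ 7 - 14 * T ^ 6 - 84 * T ^ 5 + 207 * T ^ 4 - 192 * T ^ 3
          + 86 * T ^ 2 - 16 * T + 1) * Y
      + 8 * T * (T - 1) ^ 2 * (T ^ 4 + 4 * T ^ 3 - 13 * T ^ 2 + 8 * T + 1) * Y ^ 2
      + T ^ 4 * (T - 1) * (T ^ 3 + 5 * T ^ 2 - 8 * T + 1)) = 0 := by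
  have h : Y * w ^ 2 = 1 + T - T ^ 2 - 3 * θ - w ^ 2 := by linear_combination hY
  calc _ = 16 * T ^ 2 * (T - 1) ^ 4 * (Y * w ^ 2) ^ 3
      + (T ^ 8 + 12 * T ^ 7 - 14 * T ^ 6 - 84 * T ^ 5 + 207 * T ^ 4 - 192 * T ^ 3
          + 86 * T ^ 2 - 16 * T + 1) * (Y * w ^ 2) * w ^ 4
      + 8 * T * (T - 1) ^ 2 * (T ^ 4 + 4 * T ^ 3 - 13 * T ^ 2 + 8 * T + 1) * (Y * w ^ 2) ^ 2 * w ^ 2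
      + T ^ 4 * (T - 1) * (T ^ 3 + 5 * T ^ 2 - 8 * T + 1) * w ^ 6 := by ring
    _ = 0 := by
      rw [h]
      subst hw
      -- the cofactor is the quotient in the division by `4 * θ ^ 3 + ⋯` with respect to `θ`
      linear_combination (
        (1 - 10 * T - 7 * T ^ 2 + 70 * T ^ 3 + 2 * T ^ 4 - 154 * T ^ 5 + 73 * T ^ 6 + 106 * T ^ 7
          - 110 * T ^ 8 + 26 * T ^ 9 + 9 * T ^ 10 - 6 * T ^ 11 + T ^ 12)
        + θ * (-8 + 104 * T - 40 * T ^ 2 - 496 * T ^ 3 + 408 * T ^ 4 + 488 * T ^ 5 - 696 * T ^ 6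
          + 224 * T ^ 7 + 40 * T ^ 8 - 40 * T ^ 9 + 8 * T ^ 10)
        + θ ^ 2 * (20 - 352 * T + 472 * T ^ 2 + 704 * T ^ 3 - 1396 * T ^ 4 + 592 * T ^ 5
          + 40 * T ^ 6 - 80 * T ^ 7 + 20 * T ^ 8)
        + θ ^ 3 * (-16 + 384 * T - 864 * T ^ 2 + 512 * T ^ 3 - 48 * T ^ 5 + 16 * T ^ 6)) * hθ

end PowerSeries

namespace PolygonTree

open PowerSeries

/-- The digons other than the edge satisfy a cubic equation in `T = X ^ 2`. -/
theorem cubic_digons {T Y : ℚ⟦X⟧} (hT : T = X ^ 2) (hY : Y = digons ℚ - 1) :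
    16 * T ^ 2 * (T - 1) ^ 4 * Y ^ 3
      + (T ^ 8 + 12 * T ^ 7 - 14 * T ^ 6 - 84 * T ^ 5 + 207 * T ^ 4 - 192 * T ^ 3
          + 86 * T ^ 2 - 16 * T + 1) * Y
      + 8 * T * (T - 1) ^ 2 * (T ^ 4 + 4 * T ^ 3 - 13 * T ^ 2 + 8 * T + 1) * Y ^ 2
      + T ^ 4 * (T - 1) * (T ^ 3 + 5 * T ^ 2 - 8 * T + 1) = 0 := by
  obtain ⟨s, v, K, hv, hs, hK, hK0⟩ := exists_kernel_solution
  have hd : digons (Polynomial ℚ) = map Polynomial.C (digons ℚ) := by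
    rw [digons, digons, map_gf]
    congr 1
    funext t
    split_ifs <;> simp
  have h := gf_len_eq (Polynomial.X : Polynomial ℚ) rfl
  rw [hd] at h
  have h0 : map (Polynomial.evalRingHom 0) (gf fun t => (Polynomial.X : Polynomial ℚ) ^ (t.len - 2))
      = digons ℚ := by
    rw [map_gf, digons]
    refine gf_congr fun t ht => ?_
    have := two_le_len ht
    by_cases hl : t.len = 2
    · simp [hl]
    · rw [if_neg hl]
      simp; omega
  have hE : digons ℚ = v * (1 - s ^ 2 * v) := kernel_unique h hK h0 hK0
  obtain ⟨w, hw⟩ : ∃ w, w = 1 + X ^ 2 - X ^ 4 - 2 * s ^ 2 := ⟨_, rfl⟩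
  rw [← hw] at hv hs
  have hc := cubic_of_parameter (T := T) (θ := s ^ 2) (w := w) (Y := Y) (by rw [hw, hT]; ring) ?_ ?_
  · have := congrArg (v ^ 6 * ·) hc
    simp only [← mul_assoc, mul_zero] at this
    rwa [← mul_pow, mul_comm v, hv, one_pow, one_mul] at this
  · have h3 : (1 + T - T ^ 2 - 3 * s ^ 2 : ℚ⟦X⟧) = w - s ^ 2 := by rw [hw, hT]; ring
    rw [h3, hY, hE]
    linear_combination (w - s ^ 2 * (w * v + 1)) * hv
  · rw [hT]
    linear_combination (s * w + X - X ^ 3) * hs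

end PolygonTree

namespace PowerSeries

/-! ### The cubic equations -/

/-- The cubic equation has at most one solution, because its linear coefficient is invertible and
the other coefficients of the unknown vanish at zero. -/
theorem cubic_unique {t Y Z : ℚ⟦X⟧} (ht : t = X)
    (hY : 16 * t ^ 2 * (t - 1) ^ 4 * Y ^ 3
      + (t ^ 8 + 12 * t ^ 7 - 14 * t ^ 6 - 84 * t ^ 5 + 207 * t ^ 4 - 192 * t ^ 3
          + 86 * t ^ 2 - 16 * t + 1) * Y
      + 8 * t * (t - 1) ^ 2 * (t ^ 4 + 4 * t ^ 3 - 13 * t ^ 2 + 8 * t + 1) * Y ^ 2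
      + t ^ 4 * (t - 1) * (t ^ 3 + 5 * t ^ 2 - 8 * t + 1) = 0)
    (hZ : 16 * t ^ 2 * (t - 1) ^ 4 * Z ^ 3
      + (t ^ 8 + 12 * t ^ 7 - 14 * t ^ 6 - 84 * t ^ 5 + 207 * t ^ 4 - 192 * t ^ 3
          + 86 * t ^ 2 - 16 * t + 1) * Z
      + 8 * t * (t - 1) ^ 2 * (t ^ 4 + 4 * t ^ 3 - 13 * t ^ 2 + 8 * t + 1) * Z ^ 2
      + t ^ 4 * (t - 1) * (t ^ 3 + 5 * t ^ 2 - 8 * t + 1) = 0) : Y = Z := by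
  have h : (Y - Z) * (16 * t ^ 2 * (t - 1) ^ 4 * (Y ^ 2 + Y * Z + Z ^ 2)
      + (t ^ 8 + 12 * t ^ 7 - 14 * t ^ 6 - 84 * t ^ 5 + 207 * t ^ 4 - 192 * t ^ 3
          + 86 * t ^ 2 - 16 * t + 1)
      + 8 * t * (t - 1) ^ 2 * (t ^ 4 + 4 * t ^ 3 - 13 * t ^ 2 + 8 * t + 1) * (Y + Z)) = 0 := by
    linear_combination hY - hZ
  rw [IsUnit.mul_left_eq_zero (isUnit_iff_constantCoeff.2 (by simp [ht])), sub_eq_zero] at h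
  exact h

/-- The relation between the two series and the cubic equations that determine them.  The generating
functions of polygons by the number of triangles are obtained from them by `t = X ^ 2`. -/
theorem cubic_of_expand {H H' : ℚ⟦X⟧} (hH : H.expand 2 two_ne_zero = PolygonTree.digons ℚ - 1)
    (hH' : H'.expand 2 two_ne_zero =
      X * PolygonTree.triangles fun a b c => if 4 ≤ a ∧ 4 ≤ b ∧ 4 ≤ c then 1 else 0)
    (t p : ℚ⟦X⟧) (ht : t = X) (hp : p = 1 - 5 * t + 5 * t ^ 2 - 3 * t ^ 3) :
    H' = p * (1 - t)⁻¹ * H ∧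
    (∀ Y : ℚ⟦X⟧, Y = H ↔
      16 * t ^ 2 * (t - 1) ^ 4 * Y ^ 3
      + (t ^ 8 + 12 * t ^ 7 - 14 * t ^ 6 - 84 * t ^ 5 + 207 * t ^ 4 - 192 * t ^ 3
          + 86 * t ^ 2 - 16 * t + 1) * Y
      + 8 * t * (t - 1) ^ 2 * (t ^ 4 + 4 * t ^ 3 - 13 * t ^ 2 + 8 * t + 1) * Y ^ 2
      + t ^ 4 * (t - 1) * (t ^ 3 + 5 * t ^ 2 - 8 * t + 1) = 0) ∧
    (∀ Y : ℚ⟦X⟧, Y = H' ↔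
      16 * t ^ 2 * (1 - t) ^ 6 * Y ^ 3
      + 8 * t * (1 - t) ^ 3 * (t ^ 4 + 4 * t ^ 3 - 13 * t ^ 2 + 8 * t + 1) * p * Y ^ 2
      + (t ^ 8 + 12 * t ^ 7 - 14 * t ^ 6 - 84 * t ^ 5 + 207 * t ^ 4 - 192 * t ^ 3
          + 86 * t ^ 2 - 16 * t + 1) * p ^ 2 * Y
      - t ^ 4 * (t ^ 3 + 5 * t ^ 2 - 8 * t + 1) * p ^ 3 = 0) := by
  have hinj : Function.Injective (PowerSeries.expand (R := ℚ) 2 two_ne_zero) := by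
    intro a b h
    ext n
    rw [← coeff_expand_mul 2 two_ne_zero a, h, coeff_expand_mul]
  have hr : (1 - t) * (1 - t)⁻¹ = 1 := PowerSeries.mul_inv_cancel _ (by simp [ht])
  have hq : p * p⁻¹ = 1 := PowerSeries.mul_inv_cancel _ (by simp [hp, ht])
  generalize (1 - t)⁻¹ = r at *
  generalize p⁻¹ = q at *
  have hrel : H' = p * r * H := by
    have h : (1 - t) * H' = p * H := by
      refine hinj ?_
      rw [map_mul, map_mul, hH, hH', hp, ht]
      simp only [map_sub, map_add, map_mul, map_pow, map_one, expand_X, map_ofNat]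
      linear_combination PolygonTree.triangles_four_le
    linear_combination r * h - H' * hr
  have hcub : 16 * t ^ 2 * (t - 1) ^ 4 * H ^ 3
      + (t ^ 8 + 12 * t ^ 7 - 14 * t ^ 6 - 84 * t ^ 5 + 207 * t ^ 4 - 192 * t ^ 3
          + 86 * t ^ 2 - 16 * t + 1) * H
      + 8 * t * (t - 1) ^ 2 * (t ^ 4 + 4 * t ^ 3 - 13 * t ^ 2 + 8 * t + 1) * H ^ 2
      + t ^ 4 * (t - 1) * (t ^ 3 + 5 * t ^ 2 - 8 * t + 1) = 0 := by
    refine hinj ?_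
    rw [map_zero, ← PolygonTree.cubic_digons (T := X ^ 2) rfl hH, ht]
    simp only [map_sub, map_add, map_mul, map_pow, map_one, expand_X, map_ofNat]
  have h1 : ∀ Y : ℚ⟦X⟧, Y = H ↔ _ := fun Y =>
    ⟨fun h => h ▸ hcub, fun h => cubic_unique ht h hcub⟩
  refine ⟨hrel, h1, fun Y => ?_⟩
  -- the substitution `Y = p * (1 - t)⁻¹ * Z` turns the second equation into the first one
  obtain ⟨Z, rfl⟩ : ∃ Z, Y = p * r * Z :=
    ⟨(1 - t) * q * Y, by linear_combination -Y * hr - r * (1 - t) * Y * hq⟩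
  have hu : IsUnit (p ^ 3 * r) :=
    ((IsUnit.of_mul_eq_one _ hq).pow 3).mul (IsUnit.of_mul_eq_one_right _ hr)
  have hur : IsUnit (p * r) := (IsUnit.of_mul_eq_one _ hq).mul (IsUnit.of_mul_eq_one_right _ hr)
  rw [hrel, hur.mul_right_inj, h1, ← hu.mul_right_eq_zero]
  refine Eq.congr ?_ rfl
  have h2 : (1 - t) ^ 2 * r ^ 2 = 1 := by rw [← mul_pow, hr, one_pow]
  linear_combination
    -16 * t ^ 2 * p ^ 3 * Z ^ 3 * (1 - t) ^ 4 * r * h2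
    - 8 * t * (1 - t) ^ 2 * (t ^ 4 + 4 * t ^ 3 - 13 * t ^ 2 + 8 * t + 1) * p ^ 3 * Z ^ 2 * r * hr
    - t ^ 4 * (t ^ 3 + 5 * t ^ 2 - 8 * t + 1) * p ^ 3 * hr

end PowerSeries

namespace CombMap

/-! ### Rooted triangulations as polygons -/

variable {D : Type} (M : CombMap D)

theorem origin_eq_iff {x y : D} : M.origin x = M.origin y ↔ cyc M.next x y := Quotient.eq

theorem rightFace_eq_iff {x y : D} : M.rightFace x = M.rightFace y ↔ cyc M.facePerm x y :=
  Quotient.eq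

theorem vertexDegree_origin (x : D) : M.vertexDegree (M.origin x) = cycDeg M.next x :=
  Nat.card_congr (Equiv.subtypeEquivRight fun _ => by rw [eq_comm, origin_eq_iff])

theorem faceDegree_rightFace (x : D) : M.faceDegree (M.rightFace x) = cycDeg M.facePerm x :=
  Nat.card_congr (Equiv.subtypeEquivRight fun _ => by rw [eq_comm, rightFace_eq_iff])

theorem origin_next (x : D) : M.origin (M.next x) = M.origin x :=
  M.origin_eq_iff.2 (apply_cyc _ _)

theorem origin_facePerm (x : D) : M.origin (M.facePerm x) = M.target x := M.origin_next _

theorem target_opp (x : D) : M.target (M.opp x) = M.origin x := by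
  rw [target, M.opp_opp]

theorem cyc_of_cube {f : Equiv.Perm D} [Finite D] {x y : D} (h : f (f (f x)) = x)
    (hy : cyc f x y) : y = x ∨ y = f x ∨ y = f (f x) := by
  refine forward_induction (p := fun y => y = x ∨ y = f x ∨ y = f (f x)) hy (Or.inl rfl) ?_
  rintro z (rfl | rfl | rfl)
  · exact Or.inr (Or.inl rfl)
  · exact Or.inr (Or.inr rfl)
  · exact Or.inl h

/-- A point lies on a cycle of length three. -/
theorem cycDeg_eq_three_iff {f : Equiv.Perm D} [Finite D] {x : D} :
    cycDeg f x = 3 ↔ f (f (f x)) = x ∧ f x ≠ x := by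
  have h1 : cyc f x (f x) := cyc_apply f x
  have h2 : cyc f x (f (f x)) := Setoid.trans' _ h1 (cyc_apply f _)
  have h3 : cyc f x (f (f (f x))) := Setoid.trans' _ h2 (cyc_apply f _)
  constructor
  · intro h
    by_cases hxx : f (f x) = x
    · have hle : Nat.card {y // cyc f x y} ≤ 2 := by
        have hs : {y | cyc f x y} ⊆ {x, f x} := by
          intro y hy
          refine forward_induction (p := fun y => y ∈ ({x, f x} : Set D)) hy (by simp) ?_
          rintro z (rfl | rfl)
          · simp
          · rw [hxx]; simp
        exact (Set.ncard_le_ncard hs).trans ((Set.ncard_insert_le _ _).trans (by simp))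
      rw [cycDeg] at h
      omega
    · have hx : f x ≠ x := fun h => hxx (by rw [h, h])
      refine ⟨?_, hx⟩
      have hs : ({x, f x, f (f x)} : Set D) ⊆ {y | cyc f x y} := by
        rintro y (rfl | rfl | rfl)
        · exact Setoid.refl' (cyc f) _
        · exact h1
        · exact h2
      have hcard : ({x, f x, f (f x)} : Set D).ncard = 3 :=
        Set.ncard_eq_three.2 ⟨x, f x, f (f x), hx.symm, fun h => hxx h.symm,
          fun h => hx (f.injective h).symm, rfl⟩
      have he := Set.eq_of_subset_of_ncard_le hs (by rw [hcard]; exact h.le)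
      have h3 : f (f (f x)) ∈ ({x, f x, f (f x)} : Set D) := by rw [he]; exact h3
      rcases h3 with h3 | h3 | h3
      · exact h3
      · exact absurd (f.injective h3) hxx
      · exact absurd (f.injective (f.injective h3)) hx
  · rintro ⟨h, hx⟩
    have hxx : f (f x) ≠ x := fun hxx => hx (by rw [hxx] at h; exact h)
    have he : {y | cyc f x y} = {x, f x, f (f x)} := by
      ext y
      constructor
      · exact cyc_of_cube h
      · rintro (rfl | rfl | rfl)
        · exact Setoid.refl' (cyc f) _
        · exact h1
        · exact h2
    change Set.ncard {y | cyc f x y} = 3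
    rw [he]
    exact Set.ncard_eq_three.2 ⟨x, f x, f (f x), hx.symm, hxx.symm,
      fun h => hx (f.injective h).symm, rfl⟩

theorem Loopless.facePerm_ne (h : M.Loopless) (x : D) : M.facePerm x ≠ x := by
  intro hx
  have := M.origin_facePerm x
  rw [hx] at this
  exact h x this

theorem isTriangulation_iff [Finite D] (h : M.Loopless) :
    M.IsTriangulation ↔ ∀ x, M.facePerm (M.facePerm (M.facePerm x)) = x := by
  constructor
  · intro hT x
    have := hT (M.rightFace x)
    rw [faceDegree_rightFace, cycDeg_eq_three_iff] at this
    exact this.1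
  · rintro hT ⟨x⟩
    refine (M.faceDegree_rightFace x).trans ?_
    rw [cycDeg_eq_three_iff]
    exact ⟨hT x, h.facePerm_ne M x⟩

/-- The vertices are connected if and only if the darts are. -/
theorem connected_iff [Nonempty D] :
    M.graph.Connected ↔ ∀ x y, conn M.next M.opp x y := by
  constructor
  · intro h x y
    have hr := h.preconnected (M.origin x) (M.origin y)
    have key : ∀ u v, M.graph.Reachable u v → ∀ x y, M.origin x = u → M.origin y = v →
        conn M.next M.opp x y := by
      rintro u v ⟨p⟩
      induction p with
      | nil =>
        intro x y hx hy
        exact cyc_le_conn_left _ _ (M.origin_eq_iff.1 (hx.trans hy.symm))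
      | cons hadj p ih =>
        intro x y hx hy
        obtain ⟨-, d, hd, hd'⟩ := hadj
        have h1 := cyc_le_conn_left M.next M.opp (M.origin_eq_iff.1 (hx.trans hd.symm))
        have h2 := cyc_le_conn_right M.next M.opp (cyc_apply M.opp d)
        exact Setoid.trans' _ h1 (Setoid.trans' _ h2 (ih _ _ hd' hy))
    exact key _ _ hr x y rfl rfl
  · intro h
    let s : Setoid D := ⟨fun x y => M.graph.Reachable (M.origin x) (M.origin y),
      fun _ => SimpleGraph.Reachable.refl _, fun h => h.symm, fun h k => h.trans k⟩
    have hs : conn M.next M.opp ≤ s := by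
      refine conn_le_iff.2 ⟨fun x => ?_, fun x => ?_⟩
      · change M.graph.Reachable (M.origin x) (M.origin (M.next x))
        rw [origin_next]
      · by_cases hx : M.origin x = M.target x
        · change M.graph.Reachable (M.origin x) (M.target x)
          rw [← hx]
        · exact SimpleGraph.Adj.reachable ⟨hx, x, rfl, rfl⟩
    have : Nonempty M.Vertex := ⟨M.origin (Classical.arbitrary D)⟩
    refine ⟨?_⟩
    rintro ⟨x⟩ ⟨y⟩
    exact hs (h x y)

/-- The neighbours of a vertex of a loopless triangulation, in the order of the rotation, form a
closed walk.  So any path through the vertex can be rerouted. -/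
theorem nonSeparable_of_triangles (hl : M.Loopless)
    (ht : ∀ x, M.facePerm (M.facePerm (M.facePerm x)) = x)
    (hc : ∀ x y, conn M.next M.opp x y) : M.NonSeparable := by
  classical
  refine ⟨hl, fun v => ?_⟩
  have hv : ∀ d, M.origin d = v → M.target d ≠ v := fun d h k => hl d (h.trans k.symm)
  -- a vertex other than `v` at each dart: its origin if possible, and its target otherwise
  let rep : D → ({v}ᶜ : Set M.Vertex) := fun d =>
    if h : M.origin d = v then ⟨M.target d, hv d h⟩ else ⟨M.origin d, h⟩
  have rep_pos : ∀ d, M.origin d = v → (rep d : M.Vertex) = M.target d := fun d h => by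
    simp only [rep, dif_pos h]
  have rep_neg : ∀ d, M.origin d ≠ v → (rep d : M.Vertex) = M.origin d := fun d h => by
    simp only [rep, dif_neg h]
  let s : Setoid D := ⟨fun x y => (M.graph.induce {v}ᶜ).Reachable (rep x) (rep y),
    fun _ => SimpleGraph.Reachable.refl _, fun h => h.symm, fun h k => h.trans k⟩
  have hs : conn M.next M.opp ≤ s := by
    refine conn_le_iff.2 ⟨fun d => ?_, fun d => ?_⟩
    · change (M.graph.induce {v}ᶜ).Reachable (rep d) (rep (M.next d))
      by_cases h : M.origin d = v
      · have h' : M.origin (M.next d) = v := (M.origin_next d).trans h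
        -- the third side of the triangle between two consecutive darts at `v`
        have h1 : M.origin (M.facePerm (M.next d)) = M.target (M.next d) := M.origin_facePerm _
        have h2 : M.target (M.facePerm (M.next d)) = M.target d := by
          have h3 := ht (M.opp d)
          rw [show M.facePerm (M.opp d) = M.next d by
            rw [facePerm, Equiv.Perm.mul_apply, M.opp_opp]] at h3
          rw [← M.origin_facePerm, h3, target]
        refine (SimpleGraph.Adj.reachable ?_).symm
        refine ⟨?_, M.facePerm (M.next d), ?_, ?_⟩
        · intro k
          have k : (rep (M.next d) : M.Vertex) = rep d := k
          rw [rep_pos _ h', rep_pos _ h, ← h1, ← h2] at k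
          exact hl _ k
        · exact h1.trans (rep_pos _ h').symm
        · exact h2.trans (rep_pos _ h).symm
      · have : rep (M.next d) = rep d := Subtype.ext <| by
          rw [rep_neg _ h, rep_neg _ (by rwa [origin_next]), origin_next]
        rw [this]
    · change (M.graph.induce {v}ᶜ).Reachable (rep d) (rep (M.opp d))
      by_cases h : M.origin d = v
      · have : rep (M.opp d) = rep d := Subtype.ext <| by
          rw [rep_pos _ h, rep_neg (M.opp d) (hv d h)]; rfl
        rw [this]
      · by_cases h' : M.origin (M.opp d) = v
        · have : rep (M.opp d) = rep d := Subtype.ext <| by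
            rw [rep_pos _ h', rep_neg d h, target_opp]
          rw [this]
        · refine SimpleGraph.Adj.reachable ⟨?_, d, (rep_neg d h).symm, (rep_neg _ h').symm⟩
          intro k
          have k : (rep d : M.Vertex) = rep (M.opp d) := k
          rw [rep_neg _ h, rep_neg _ h'] at k
          exact hl d k
  rintro ⟨⟨x⟩, hx⟩ ⟨⟨y⟩, hy⟩
  have h1 : rep x = ⟨M.origin x, hx⟩ := Subtype.ext (rep_neg x hx)
  have h2 : rep y = ⟨M.origin y, hy⟩ := Subtype.ext (rep_neg y hy)
  have := hs (hc x y)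
  change (M.graph.induce {v}ᶜ).Reachable (rep x) (rep y) at this
  rw [h1, h2] at this
  exact this

end CombMap

namespace RootedMap

variable {D : Type}

/-- The polygon that is obtained by opening the face on the right of the root.  The face is assumed
to be a triangle: its first three darts are listed. -/
def polygon (M : RootedMap D) : Patch D where
  next := M.next
  opp := M.opp
  bdry := [[M.root, M.facePerm M.root, M.facePerm (M.facePerm M.root)]]

/-- Rooted non-separable triangulations are triangulated polygons with three vertices. -/
theorem polygon_good_iff [Finite D] (M : RootedMap D) : M.polygon.Good ↔
    M.NonSeparable ∧ M.IsTriangulation ∧ ∀ x, M.origin x = M.origin M.root ∨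
      M.origin x = M.origin (M.facePerm M.root) ∨
      M.origin x = M.origin (M.facePerm (M.facePerm M.root)) ∨
      4 ≤ M.vertexDegree (M.origin x) := by
  have : Nonempty D := ⟨M.root⟩
  have hmem : ∀ x, x ∈ M.polygon.bdry.flatten ↔ x = M.root ∨ x = M.facePerm M.root ∨
      x = M.facePerm (M.facePerm M.root) := by intro x; simp [polygon]
  have hin : (∀ x, M.origin x = M.origin M.root ∨ M.origin x = M.origin (M.facePerm M.root) ∨
      M.origin x = M.origin (M.facePerm (M.facePerm M.root)) ∨
      4 ≤ M.vertexDegree (M.origin x)) ↔ InnerOn M.polygon.next M.polygon.bdry.flatten := by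
    refine forall_congr' fun x => ?_
    simp only [hmem, M.origin_eq_iff, M.vertexDegree_origin, or_and_right, exists_or,
      exists_eq_left, or_assoc]
    rfl
  rw [hin]
  constructor
  · intro h
    have hl : M.Loopless := fun d k => h.loopless d (M.origin_eq_iff.1 k)
    have ht : ∀ x, M.facePerm (M.facePerm (M.facePerm x)) = x := by
      have hr : M.facePerm (M.facePerm (M.facePerm M.root)) = M.root :=
        (h.cyclic _ (List.mem_singleton_self _)).2.2
      intro x
      by_cases hx : x ∈ M.polygon.bdry.flatten
      · rcases (hmem x).1 hx with rfl | rfl | rfl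
        · exact hr
        · rw [hr]
        · rw [hr]
      · exact h.triangle x hx
    exact ⟨M.nonSeparable_of_triangles hl ht (M.connected_iff.1 M.connected),
      (M.isTriangulation_iff hl).2 ht, h.inner⟩
  · rintro ⟨⟨hl, -⟩, ht, hi⟩
    rw [M.isTriangulation_iff hl] at ht
    have hs : ∀ x, ¬ cyc M.next x (M.facePerm x) := fun x k => hl x <| by
      rw [← M.origin_facePerm]; exact M.origin_eq_iff.2 k
    have hsimple : SimpleOn M.next M.polygon.bdry.flatten := by
      have h3 : ¬ cyc M.next M.root (M.facePerm (M.facePerm M.root)) := fun k => by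
        refine hs (M.facePerm (M.facePerm M.root)) ?_
        rw [ht]
        exact Setoid.symm' _ k
      simp [polygon, SimpleOn, hs, h3]
    refine ⟨⟨M.opp_opp, M.opp_ne, fun d => ⟨_, List.mem_singleton_self _, M.root, by simp,
      M.connected_iff.1 M.connected _ _⟩, List.pairwise_singleton _ _, M.euler, ?_,
      (simpleOn_iff.1 hsimple).1, fun d _ => ht d, fun d k => hl d (M.origin_eq_iff.2 k)⟩,
      hsimple, hi⟩
    intro L hL
    obtain rfl := List.mem_singleton.1 hL
    exact ⟨rfl, rfl, ht _⟩

/-- The vertices at the root are the first two boundary vertices of the polygon. -/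
theorem isH_iff [Finite D] (M : RootedMap D) : M.IsH ↔ M.polygon.Good ∧
    4 ≤ cycDeg M.next (M.facePerm (M.facePerm M.root)) := by
  rw [polygon_good_iff, IsH, and_assoc, and_assoc]
  refine and_congr_right fun hN => and_congr_right fun hT => ?_
  rw [M.isTriangulation_iff hN.1] at hT
  rw [← M.vertexDegree_origin]
  constructor
  · intro h
    have h' : ∀ x, M.origin x = M.origin M.root ∨ M.origin x = M.origin (M.facePerm M.root) ∨
        4 ≤ M.vertexDegree (M.origin x) := fun x => by
      rw [M.origin_facePerm, ← or_assoc, or_iff_not_imp_left, not_or]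
      exact fun k => h _ k.1 k.2
    refine ⟨fun x => (h' x).imp_right (Or.imp_right Or.inr), ?_⟩
    rcases h' (M.facePerm (M.facePerm M.root)) with k | k | k
    · exact absurd (k.trans ((congrArg M.origin (hT M.root)).symm.trans (M.origin_facePerm _)))
        (hN.1 _)
    · rw [M.origin_facePerm (M.facePerm M.root)] at k
      exact absurd k.symm (hN.1 _)
    · exact k
  · rintro ⟨h, h4⟩ ⟨x⟩ hx hx'
    rcases h x with k | k | k | k
    · exact absurd k hx
    · exact absurd (k.trans (M.origin_facePerm _)) hx'
    · exact h4.trans_eq (congrArg M.vertexDegree k.symm)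
    · exact k

theorem isHStar_iff [Finite D] (M : RootedMap D) : M.IsHStar ↔ M.polygon.Good ∧
    4 ≤ cycDeg M.next M.root ∧ 4 ≤ cycDeg M.next (M.facePerm M.root) ∧
    4 ≤ cycDeg M.next (M.facePerm (M.facePerm M.root)) := by
  rw [polygon_good_iff, IsHStar, and_assoc, and_assoc]
  refine and_congr_right fun hN => and_congr_right fun hT => ?_
  simp only [← M.vertexDegree_origin]
  constructor
  · exact fun h => ⟨fun x => Or.inr (Or.inr (Or.inr (h _))), h _, h _, h _⟩
  · rintro ⟨h, h1, h2, h3⟩ ⟨x⟩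
    rcases h x with k | k | k | k
    · exact h1.trans_eq (congrArg M.vertexDegree k.symm)
    · exact h2.trans_eq (congrArg M.vertexDegree k.symm)
    · exact h3.trans_eq (congrArg M.vertexDegree k.symm)
    · exact k

/-- A good patch with one triangular boundary cycle is the polygon of a rooted map. -/
theorem exists_polygon_eq [Finite D] {S : Patch D} (hS : S.Good) {a b c : D}
    (hb : S.bdry = [[a, b, c]]) : ∃ M : RootedMap D, M.polygon = S := by
  have : Nonempty D := ⟨a⟩
  let M₀ : CombMap D := ⟨S.next, S.opp, hS.opp_opp, hS.opp_ne⟩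
  have hcyc := hS.cyclic [a, b, c] (by rw [hb]; exact List.mem_singleton_self _)
  have hc : ∀ x, S.comp a x := by
    intro x
    obtain ⟨L, hL, y, hy, hyx⟩ := hS.cover x
    rw [hb, List.mem_singleton] at hL
    subst hL
    exact S.comp.trans (hcyc.rel S.face_le_comp List.mem_cons_self hy) hyx
  refine ⟨⟨M₀, M₀.connected_iff.2 fun x y => S.comp.trans (S.comp.symm (hc x)) (hc y), ?_, a⟩, ?_⟩
  · have := hS.euler
    rw [hb] at this
    exact this
  · have h1 : S.face a = b := hcyc.1
    have h2 : S.face b = c := hcyc.2.1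
    have : S = ⟨S.next, S.opp, [[a, S.face a, S.face (S.face a)]]⟩ := by
      rw [h1, h2, ← hb]
    exact this.symm

theorem iso_iff_polygon_iso {M N : RootedMap D} : Iso M N ↔ Patch.Iso M.polygon N.polygon := by
  constructor
  · rintro ⟨e, h1, h2, h3⟩
    have hf : ∀ d, e (M.facePerm d) = N.facePerm (e d) := fun d => (h1 _).trans (by rw [h2]; rfl)
    exact ⟨e, h1, h2, by simp [polygon, hf, h3]⟩
  · rintro ⟨e, h1, h2, h3⟩
    simp only [polygon, List.map_cons, List.map_nil, List.cons.injEq] at h3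
    exact ⟨e, h1, h2, h3.1.1.symm⟩

end RootedMap

namespace PolygonTree

/-! ### Counting rooted maps -/

/-- The size of a polygon has the parity of the number of its vertices. -/
theorem even_size_add_len {t : PolygonTree} (ht : t.Good) : Even (t.size + t.len) := by
  induction t with
  | edge => exact ⟨1, rfl⟩
  | cap t ih =>
    have h := ih ht.1
    rw [← len_cap ht] at h
    rw [size]
    convert h using 1
    ring
  | join t u ih ih' =>
    have h := (ih ht.1).add (ih' ht.2)
    have h1 := len_join ht.1 ht.2
    rw [size, Nat.even_iff] at *
    omega

end PolygonTree

/-- Two maps with the same fibres on a set have images of the same size. -/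
theorem Set.ncard_image_eq_of_iff {α β γ : Type*} {s : Set α} {f : α → β} {g : α → γ}
    (h : ∀ x ∈ s, ∀ y ∈ s, f x = f y ↔ g x = g y) : (f '' s).ncard = (g '' s).ncard := by
  refine Set.ncard_congr (fun b hb => g hb.choose) (fun b hb => ⟨_, hb.choose_spec.1, rfl⟩) ?_ ?_
  · intro b b' hb hb' hg
    rw [← hb.choose_spec.2, ← hb'.choose_spec.2]
    exact (h _ hb.choose_spec.1 _ hb'.choose_spec.1).2 hg
  · rintro _ ⟨x, hx, rfl⟩
    have hb : f x ∈ f '' s := ⟨x, hx, rfl⟩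
    exact ⟨f x, hb, (h _ hb.choose_spec.1 _ hx).1 hb.choose_spec.2⟩

namespace RootedMap

open PolygonTree

open scoped Classical in
/-- Rooted triangulations are counted by trees. -/
theorem count_eq {n : ℕ} (P : RootedMap (Fin (2 * (3 * (n + 1)))) → Prop) (p : ℕ → ℕ → ℕ → Prop)
    (hP : ∀ M, P M ↔ M.polygon.Good ∧ p (cycDeg M.next M.root)
      (cycDeg M.next (M.facePerm M.root)) (cycDeg M.next (M.facePerm (M.facePerm M.root)))) :
    count (3 * (n + 1)) P = ((trees (2 * n + 1)).filter fun t =>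
      t.len = 3 ∧ p (t.dg 0) (t.dg 1) (t.dg 2)).card := by
  have : Nonempty PolygonTree := ⟨edge⟩
  choose! τ h1 h2 using fun (M : RootedMap (Fin (2 * (3 * (n + 1))))) (h : M.polygon.Good) =>
    exists_iso_poly h rfl
  have hdeg : ∀ (M : RootedMap (Fin (2 * (3 * (n + 1))))) (t : PolygonTree), t.Good →
      Patch.Iso M.polygon t.poly → t.deg = [cycDeg M.next M.root,
        cycDeg M.next (M.facePerm M.root), cycDeg M.next (M.facePerm (M.facePerm M.root))] := by
    intro M t ht hI
    have h := hI.degs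
    rw [poly_degs ht] at h
    exact (List.cons.inj h).1
  rw [count, Set.ncard_image_eq_of_iff (g := τ), ← Set.ncard_coe_finset]
  · congr 1
    ext t
    simp only [Set.mem_image, Set.mem_ofPred_eq, Finset.coe_filter, mem_trees]
    constructor
    · rintro ⟨M, hM, rfl⟩
      obtain ⟨hg, hp⟩ := (hP M).1 hM
      have hd := hdeg M _ (h1 M hg) (h2 M hg)
      have hl : (τ M).len = 3 := by simp [len, hd]
      refine ⟨⟨h1 M hg, ?_⟩, hl, by simpa [dg, hd] using hp⟩
      obtain ⟨e, -⟩ := h2 M hg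
      have hc := Nat.card_congr e
      rw [card_darts (h1 M hg), ← len, hl] at hc
      simp at hc
      omega
    · rintro ⟨⟨ht, hs⟩, hl, hp⟩
      have hc : Nat.card (t.darts Empty) = Nat.card (Fin (2 * (3 * (n + 1)))) := by
        rw [card_darts ht, ← len, hl, hs]
        simp
        ring
      obtain ⟨e⟩ := (Finite.card_eq (α := t.darts Empty)).1 hc
      have hI := Patch.isIso_relabel e t.poly
      have hg := (poly_good ht).of_isIso hI
      obtain ⟨L, hL⟩ := exists_bdry_poly ht
      have hL3 : L.length = 3 := by
        have := poly_degs ht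
        rw [Patch.degs, hL] at this
        rw [← hl, len, ← (List.cons.inj this).1, List.length_map]
      obtain ⟨a, b, c, rfl⟩ := List.length_eq_three.1 hL3
      obtain ⟨M, hM⟩ := exists_polygon_eq hg (a := e a) (b := e b) (c := e c) (by
        rw [hI.bdry, hL]; rfl)
      have hI' : Patch.Iso M.polygon t.poly := by rw [hM]; exact Patch.Iso.symm ⟨e, hI⟩
      have hMg : M.polygon.Good := by rw [hM]; exact hg
      refine ⟨M, (hP M).2 ⟨hMg, ?_⟩,
        poly_injective (h1 M hMg) ht ((h2 M hMg).symm.trans hI')⟩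
      have hd := hdeg M t ht hI'
      simpa [dg, hd] using hp
  · -- maps are isomorphic if and only if they have the same tree
    intro M hM N hN
    have hM := ((hP M).1 hM).1
    have hN := ((hP N).1 hN).1
    rw [Quotient.eq]
    change Iso M N ↔ _
    rw [iso_iff_polygon_iso]
    constructor
    · exact fun h => poly_injective (h1 M hM) (h1 N hN) ((h2 M hM).symm.trans (h.trans (h2 N hN)))
    · intro h
      have := h2 N hN
      rw [← h] at this
      exact (h2 M hM).trans this.symm

open scoped Classical in
/-- The triangulations with `3 * n` edges have `2 * n` triangles, one of which is the face on the
right of the root. -/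
theorem expand_count (P : ∀ D : Type, RootedMap D → Prop) (p : ℕ → ℕ → ℕ → Prop)
    (hP : ∀ (D : Type) [Finite D] (M : RootedMap D), P D M ↔ M.polygon.Good ∧
      p (cycDeg M.next M.root) (cycDeg M.next (M.facePerm M.root))
        (cycDeg M.next (M.facePerm (M.facePerm M.root)))) :
    (PowerSeries.mk fun n => (count (3 * n) (P _) : ℚ)).expand 2 two_ne_zero =
      PowerSeries.X * triangles fun a b c => if p a b c then 1 else 0 := by
  have hco : ∀ k, PowerSeries.coeff k (triangles fun a b c => if p a b c then 1 else 0) =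
      ((trees k).filter fun t => t.len = 3 ∧ p (t.dg 0) (t.dg 1) (t.dg 2)).card := by
    intro k
    simp only [triangles, gf, PowerSeries.coeff_mk, ← ite_and]
    rw [Finset.sum_boole]
  ext k
  rcases Nat.even_or_odd' k with ⟨n, rfl | rfl⟩
  · rw [PowerSeries.coeff_expand_mul, PowerSeries.coeff_mk]
    cases n with
    | zero =>
      have : {M : RootedMap (Fin (2 * (3 * 0))) | P _ M} = ∅ := by
        ext M; exact M.root.elim0
      rw [count, this]
      simp
    | succ n =>
      rw [show 2 * (n + 1) = (2 * n + 1) + 1 by ring, PowerSeries.coeff_succ_X_mul, hco,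
        count_eq _ p (hP _)]
  · rw [PowerSeries.coeff_expand_of_not_dvd _ _ _ (by omega), PowerSeries.coeff_succ_X_mul, hco,
      Finset.filter_false_of_mem, Finset.card_empty, Nat.cast_zero]
    rintro t ht ⟨hl, -⟩
    rw [mem_trees] at ht
    have := even_size_add_len ht.1
    rw [ht.2, hl, Nat.even_iff] at this
    omega

/-- Digons with at least one triangle are capped triangles, that is, triangulations in which only
the degrees at the root are unrestricted. -/
theorem expand_genH : genH.expand 2 two_ne_zero = digons ℚ - 1 := by
  classical
  have h := expand_count (fun _ M => M.IsH) (fun _ _ c => 4 ≤ c) fun D _ M => M.isH_iff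
  rw [genH, digons_eq, add_sub_cancel_left]
  refine h.trans ?_
  congr 1
  refine Eq.trans ?_ (triangles_rotate fun _ b _ => if 4 ≤ b then 1 else 0)
  congr!

theorem expand_genHStar : genHStar.expand 2 two_ne_zero = PowerSeries.X *
    triangles fun a b c => if 4 ≤ a ∧ 4 ≤ b ∧ 4 ≤ c then 1 else 0 := by
  classical
  have h := expand_count (fun _ M => M.IsHStar) (fun a b c => 4 ≤ a ∧ 4 ≤ b ∧ 4 ≤ c)
    fun D _ M => M.isHStar_iff
  rw [genHStar]
  refine h.trans ?_
  congr!

end RootedMap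

theorem mainTheorem6 (t p : ℚ⟦X⟧) (ht : t = PowerSeries.X)
    (hp : p = 1 - 5 * t + 5 * t ^ 2 - 3 * t ^ 3) :
    -- the relation between the two generating functions
    RootedMap.genHStar = p * (1 - t)⁻¹ * RootedMap.genH ∧
    -- the algebraic equation that determines `genH`
    (∀ Y : ℚ⟦X⟧, Y = RootedMap.genH ↔
      16 * t ^ 2 * (t - 1) ^ 4 * Y ^ 3
      + (t ^ 8 + 12 * t ^ 7 - 14 * t ^ 6 - 84 * t ^ 5 + 207 * t ^ 4 - 192 * t ^ 3
          + 86 * t ^ 2 - 16 * t + 1) * Y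
      + 8 * t * (t - 1) ^ 2 * (t ^ 4 + 4 * t ^ 3 - 13 * t ^ 2 + 8 * t + 1) * Y ^ 2
      + t ^ 4 * (t - 1) * (t ^ 3 + 5 * t ^ 2 - 8 * t + 1) = 0) ∧
    -- the resulting algebraic equation that determines `genHStar`
    (∀ Y : ℚ⟦X⟧, Y = RootedMap.genHStar ↔
      16 * t ^ 2 * (1 - t) ^ 6 * Y ^ 3
      + 8 * t * (1 - t) ^ 3 * (t ^ 4 + 4 * t ^ 3 - 13 * t ^ 2 + 8 * t + 1) * p * Y ^ 2
      + (t ^ 8 + 12 * t ^ 7 - 14 * t ^ 6 - 84 * t ^ 5 + 207 * t ^ 4 - 192 * t ^ 3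
          + 86 * t ^ 2 - 16 * t + 1) * p ^ 2 * Y
      - t ^ 4 * (t ^ 3 + 5 * t ^ 2 - 8 * t + 1) * p ^ 3 = 0) :=
  PowerSeries.cubic_of_expand RootedMap.expand_genH RootedMap.expand_genHStar t p ht hp
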